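/- **Theorem (Scaling law for sketched multiple regression).** *Setting.* Let $d,p,M\ge 1$ and $N\ge 2$ be integers. Let $G\in\mathbb{R}^{d\times d}$ be positive semidefinite with eigenvalues $\lambda_1\ge\dots\ge\lambda_d$. A parameter $W^*\in\mathbb{R}^{d\times p}$ is drawn from a prior with $\mathbb{E}[W^*W^{*\top}]=I_d$. Given $W^*$, the pair $(x,y)\in\mathbb{R}^d\times\mathbb{R}^p$ has a law $P$ (depending measurably on $W^*$) such that, for almost every $W^*$, $$x\sim\mathcal N(0,G),\qquad \mathbb{E}[y\mid x]=W^{*\top}x,\qquad \mathbb{E}\|y-W^{*\top}x\|_2^2=\sigma^2,\qquad \mathbb{E}\big[\|y-W^{*\top}x\|_2^2\,xx^\top\big]\preceq s\,G .$$ (The last condition holds with $s=\sigma^2$ when the noise has constant conditional variance given $x$.) The sketch $R\in\mathbb{R}^{M\times d}$ has i.i.d. $\mathcal N(0,1/M)$ entries and is independent of everything else. For $V\in\mathbb{R}^{M\times p}$ let $\mathcal L_R(V)=\mathbb{E}_{(x,y)\sim P}\|V^\top Rx-y\|_2^2$. One-pass SGD on i.i.d. samples $(x_1,y_1),\dots,(x_N,y_N)\sim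 P$ with initial step size $\gamma$ is $$V_0=0,\qquad V_t=V_{t-1}-\gamma_t\,Rx_t\,(V_{t-1}^\top Rx_t-y_t)^\top,\qquad \gamma_t=\gamma\,2^{-\left\lfloor (t-1)/(N/\log_2N)\right\rfloor}\quad(1\le t\le N).$$ Put $N_{\mathrm{eff}}=N/\log N$. *Claim.* Let $a>1$ and $0<b_1\le b_2$. There is $c>0$ depending only on $a,b_1,b_2$; for every $\rho>1$ there is $\kappa>0$ depending only on $a,b_1,b_2,\rho$; and for all $s,r>0$ there are $C_1,C_2>0$ depending only on $a,b_1,b_2,\rho,s,r$, such that the following holds for every model as above with $$b_1i^{-a}\le\lambda_i\le b_2i^{-a}\ (1\le i\le d),\qquad d\ge\rho M,\qquad \gamma\le c,\qquad N_{\mathrm{eff}}\gamma\ge r .$$ With probability at least $1-e^{-\kappa M}$ over $R$, $$\sigma^2+C_1\Big(M^{1-a}+(N_{\mathrm{eff}}\gamma)^{-(a-1)/a}\Big)\le \mathbb{E}\big[\mathcal L_R(V_N)\big]\le \sigma^2+C_2\Big(M^{1-a}+(N_{\mathrm{eff}}\gamma)^{-(a-1)/a}\Big),$$ that is, $\mathbb{E}[\mathcal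 L_R(V_N)]=\sigma^2+\Theta(M^{1-a})+\Theta\big((N_{\mathrm{eff}}\gamma)^{-(a-1)/a}\big)$. The expectation is over $W^*$ and the $N$ samples, with $R$ fixed. -/

import Mathlib

open MeasureTheory ProbabilityTheory Matrix
open scoped ENNReal NNReal

/-- Matrices carry the product (entrywise Borel) sigma-algebra. -/
instance matrixMeasurableSpace {m n : Type*} : MeasurableSpace (Matrix m n ℝ) :=
  inferInstanceAs (MeasurableSpace (m → n → ℝ))

namespace SketchedRegression

/-- The linear map `x ↦ A x` between Euclidean spaces. -/
noncomputable def act {m n : ℕ} (A : Matrix (Fin m) (Fin n) ℝ) (x : EuclideanSpace ℝ (Fin n)) :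
    EuclideanSpace ℝ (Fin m) :=
  WithLp.toLp 2 (A *ᵥ x.ofLp)

/-- The law of a Gaussian sketch `R ∈ ℝ^{M × d}`: independent entries of law `N(0, 1 / M)`. -/
noncomputable def sketchLaw (M d : ℕ) : Measure (Matrix (Fin M) (Fin d) ℝ) :=
  (Measure.pi fun _ : Fin M => Measure.pi fun _ : Fin d => gaussianReal 0 ((M : ℝ≥0)⁻¹) :
    Measure (Fin M → Fin d → ℝ))

/-- The population error `E_{(x, y) ∼ P} ‖Vᵀ (R x) - y‖²` of the sketched predictor with
parameter `V`, as an extended nonnegative number. -/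
noncomputable def sketchedRisk {M d p : ℕ}
    (P : Measure (EuclideanSpace ℝ (Fin d) × EuclideanSpace ℝ (Fin p)))
    (R : Matrix (Fin M) (Fin d) ℝ) (V : Matrix (Fin M) (Fin p) ℝ) : ℝ≥0∞ :=
  ∫⁻ z, ‖act Vᵀ (act R z.1) - z.2‖ₑ ^ 2 ∂P

/-- Geometrically decaying step sizes with initial value `γ`: the step size is halved after every
`N / log₂ N` steps. The index `t = 0, …, N - 1` counts the steps already made. -/
noncomputable def stepSize (γ : ℝ) (N t : ℕ) : ℝ :=
  γ / 2 ^ ⌊(t : ℝ) / ((N : ℝ) / Real.logb 2 N)⌋₊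

/-- One SGD step `V ↦ V - η (R x) (Vᵀ (R x) - y)ᵀ` on the sample `(x, y)`. -/
noncomputable def sgdStep {M d p : ℕ} (R : Matrix (Fin M) (Fin d) ℝ) (η : ℝ)
    (V : Matrix (Fin M) (Fin p) ℝ)
    (z : EuclideanSpace ℝ (Fin d) × EuclideanSpace ℝ (Fin p)) : Matrix (Fin M) (Fin p) ℝ :=
  V - η • Matrix.vecMulVec (act R z.1).ofLp (act Vᵀ (act R z.1) - z.2).ofLp

/-- The iterate `V_t` of one-pass SGD along a sequence of samples, started at `V_0 = 0`. -/
noncomputable def sgdIter {M d p : ℕ} (R : Matrix (Fin M) (Fin d) ℝ) (η : ℕ → ℝ)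
    (z : ℕ → EuclideanSpace ℝ (Fin d) × EuclideanSpace ℝ (Fin p)) :
    ℕ → Matrix (Fin M) (Fin p) ℝ
  | 0 => 0
  | t + 1 => sgdStep R (η t) (sgdIter R η z t) (z t)

/-- The output `V_N` of one-pass SGD on the data set `D` of `N` samples, with initial step
size `γ`. -/
noncomputable def sgdOutput {M d p N : ℕ} (R : Matrix (Fin M) (Fin d) ℝ) (γ : ℝ)
    (D : Fin N → EuclideanSpace ℝ (Fin d) × EuclideanSpace ℝ (Fin p)) :
    Matrix (Fin M) (Fin p) ℝ :=
  sgdIter R (stepSize γ N) (fun t => if h : t < N then D ⟨t, h⟩ else 0) N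

/-- The expected error of the SGD output for a fixed sketch `R`. The parameter `W` is drawn from
the prior `π`, the `N` samples are i.i.d. with law `P W`, and the error is that under `P W`. -/
noncomputable def expectedRisk {M d p : ℕ} (π : Measure (Matrix (Fin d) (Fin p) ℝ))
    (P : Kernel (Matrix (Fin d) (Fin p) ℝ)
      (EuclideanSpace ℝ (Fin d) × EuclideanSpace ℝ (Fin p)))
    (R : Matrix (Fin M) (Fin d) ℝ) (γ : ℝ) (N : ℕ) : ℝ≥0∞ :=
  ∫⁻ W, ∫⁻ D, sketchedRisk (P W) R (sgdOutput R γ D) ∂(Measure.pi fun _ : Fin N => P W) ∂π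

/-- The law `P` of `(x, y)` is a Gaussian-design, well-specified multiple regression model with
parameter `W`, feature covariance `G` and noise level `σ²`, whose noise satisfies
`E[‖y - Wᵀ x‖² x xᵀ] ≼ s G`. -/
structure IsRegressionModel {d p : ℕ}
    (P : Measure (EuclideanSpace ℝ (Fin d) × EuclideanSpace ℝ (Fin p)))
    (G : Matrix (Fin d) (Fin d) ℝ) (W : Matrix (Fin d) (Fin p) ℝ) (σ s : ℝ) : Prop where
  /-- `x ∼ N(0, G)` -/
  gaussian_features : P.map Prod.fst = multivariateGaussian 0 G
  /-- `E[y | x] = Wᵀ x` -/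
  well_specified :
    P[(Prod.snd : EuclideanSpace ℝ (Fin d) × EuclideanSpace ℝ (Fin p) → EuclideanSpace ℝ (Fin p)) |
      MeasurableSpace.comap Prod.fst inferInstance] =ᵐ[P] fun z => act Wᵀ z.1
  /-- `E ‖y - Wᵀ x‖² = σ²` -/
  noise_level : ∫⁻ z, ‖z.2 - act Wᵀ z.1‖ₑ ^ 2 ∂P = ENNReal.ofReal (σ ^ 2)
  /-- `E[‖y - Wᵀ x‖² x xᵀ] ≼ s G`, tested on vectors -/
  noise_covariance : ∀ u : Fin d → ℝ,
    ∫⁻ z, ‖z.2 - act Wᵀ z.1‖ₑ ^ 2 * ENNReal.ofReal ((u ⬝ᵥ z.1.ofLp) ^ 2) ∂P ≤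
      ENNReal.ofReal (s * (u ⬝ᵥ G *ᵥ u))

/-- The `i`-th largest eigenvalue of `G` (`i = 1, …, d`) lies between `b₁ i^{-a}` and
`b₂ i^{-a}`. -/
def HasPowerLawSpectrum {d : ℕ} {G : Matrix (Fin d) (Fin d) ℝ} (hG : G.PosSemidef)
    (a b₁ b₂ : ℝ) : Prop :=
  ∀ i : Fin (Fintype.card (Fin d)),
    b₁ * ((i : ℝ) + 1) ^ (-a) ≤ hG.isHermitian.eigenvalues₀ i ∧
      hG.isHermitian.eigenvalues₀ i ≤ b₂ * ((i : ℝ) + 1) ^ (-a)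

/-- The effective sample size `N / log N`. -/
noncomputable def effSampleSize (N : ℕ) : ℝ := N / Real.log N

/-- The sum `M^{1 - a} + (N_eff γ)^{-(a - 1) / a}` of the two rates of the scaling law. -/
noncomputable def scalingRate (a γ : ℝ) (M N : ℕ) : ℝ :=
  (M : ℝ) ^ (1 - a) + (effSampleSize N * γ) ^ (-((a - 1) / a))

end SketchedRegression

/-! Write G = B Bᵀ, the columns of B being eigenvectors of G scaled by the roots of the eigenvalues
λ_i, put A = R B, and let v_j, τ_j be an orthonormal eigenbasis of Aᵀ A. The vectors f_j = B v_j
satisfy ∑ f_j f_jᵀ = G and G Rᵀ R f_j = τ_j f_j. Hence the excess risk is the sum of the energies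
|f_jᵀ(Rᵀ V - W)|², and SGD contracts each component by 1 - η τ_j in the mean. Measuring the residual
against the full W keeps the noise centred given x; the approximation error is just the energy in
the directions with τ_j = 0. One step takes an energy b_j to at least (1 - η τ_j)² b_j and at most
(1 - 2 η τ_j) b_j + (η τ_j)² (3 ∑ b_l + s) (`lintegral_dirSq_sgdStep`). The isotropic prior makes
the initial mean energy |f_j|² = ∑_i λ_i v_{ji}².

Upper bound: for γ tr(Aᵀ A) ≤ 1/3 the total energy stays bounded, so every direction obeys a scalar
recursion. With L the stage length and S = γ L, the decaying steps yield a ridge bias with weights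
1/(1 + S τ_j) plus a constant times 1/L times the effective dimension ∑ S τ_j/(1 + S τ_j)
(`riskRec_stepSize_le`). Both are controlled by splitting off leading coordinates
(`sum_le_add_colTail`, `ridge_bias_le`), with critical dimension (N_eff γ)^{1/a}.

Lower bound: directions with τ_j ≤ 1/(8 N_eff γ) retain a quarter of their energy. The number m of
other directions is at most M and at most a multiple of the critical dimension, and m orthonormal
vectors cannot absorb more than m of the mass on the leading coordinates, so energy of order (m +
1)^{1-a} remains (`le_sum_weight_mul`).

About R only two facts are needed: tail columns of A have total squared length at most 16 times a
bound on the mean (chi-squared moments and Jensen), and R is bounded below on the span of about M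
leading eigenvectors (`sketchLaw_not_lower_le`, which averages exponentials over balls in place of a
net argument). -/

namespace SketchedRegression

/-! ### Tails of the series ∑ i^{-a}. -/

section PowerSums

/-- Each term of the series `∑ i^{-a}` is dominated by a telescoping difference. -/
lemma rpow_neg_le_telescope {a : ℝ} (ha : 1 < a) {x : ℝ} (hx : 1 ≤ x) :
    x ^ (-a) ≤ 2 ^ a / (a - 1) * (x ^ (1 - a) - (x + 1) ^ (1 - a)) := by
  have hx0 : 0 < x := by linarith
  obtain ⟨y, ⟨hy1, hy2⟩, hy⟩ := exists_hasDerivAt_eq_slope (fun t : ℝ => t ^ (1 - a))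
    (fun t => (1 - a) * t ^ (1 - a - 1)) (show x < x + 1 by linarith)
    (fun t ht => (Real.continuousAt_rpow_const _ _ (Or.inl (by linarith [ht.1]))).continuousWithinAt)
    (fun t ht => Real.hasDerivAt_rpow_const (Or.inl (by linarith [ht.1])))
  have h1 : (1 - a - 1 : ℝ) = -a := by ring
  rw [h1] at hy
  have h2 : x ^ (1 - a) - (x + 1) ^ (1 - a) = (a - 1) * y ^ (-a) := by
    have : x + 1 - x = 1 := by ring
    rw [this, div_one] at hy
    linarith
  -- The intermediate point satisfies y ≤ x + 1 ≤ 2 x because x ≥ 1; this is the source of the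
  -- factor 2^a.
  have h3 : (2 * x) ^ (-a) ≤ y ^ (-a) :=
    Real.rpow_le_rpow_of_nonpos (by linarith) (by linarith) (by linarith)
  rw [h2, Real.mul_rpow (by norm_num) hx0.le] at *
  have h4 : (2 : ℝ) ^ a * 2 ^ (-a) = 1 := by
    rw [← Real.rpow_add (by norm_num)]; simp
  have h5 : (0 : ℝ) < 2 ^ a := by positivity
  have h6 : 0 < a - 1 := by linarith
  calc x ^ (-a) = (2 : ℝ) ^ a * (2 ^ (-a) * x ^ (-a)) := by rw [← mul_assoc, h4, one_mul]
    _ ≤ 2 ^ a * y ^ (-a) := by gcongr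
    _ = _ := by field_simp

lemma sum_range_rpow_tail_le {a : ℝ} (ha : 1 < a) (k n : ℕ) :
    ∑ i ∈ Finset.range n, ((k + i : ℕ) + 1 : ℝ) ^ (-a) ≤
      2 ^ a / (a - 1) * ((k + 1 : ℝ) ^ (1 - a) - ((k + n : ℕ) + 1 : ℝ) ^ (1 - a)) := by
  induction n with
  | zero => simp
  | succ n ih =>
    rw [Finset.sum_range_succ]
    have h := rpow_neg_le_telescope ha (x := ((k + n : ℕ) + 1 : ℝ)) (by simp; positivity)
    have h2 : (((k + (n + 1) : ℕ) : ℝ) + 1) = ((k + n : ℕ) : ℝ) + 1 + 1 := by push_cast; ring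
    rw [h2]
    linarith

lemma sum_tail_rpow_le {a : ℝ} (ha : 1 < a) (d k : ℕ) :
    ∑ i : Fin d with k ≤ i.val, ((i : ℝ) + 1) ^ (-a) ≤
      2 ^ a / (a - 1) * ((k : ℝ) + 1) ^ (1 - a) := by
  have h1 : ∑ i : Fin d with k ≤ i.val, ((i : ℝ) + 1) ^ (-a) =
      ∑ i ∈ Finset.Ico k d, ((i : ℝ) + 1) ^ (-a) := by
    rw [Finset.sum_filter, Fin.sum_univ_eq_sum_range
      (fun i => if k ≤ i then ((i : ℝ) + 1) ^ (-a) else 0), ← Finset.sum_filter]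
    congr 1
    ext i
    simp [and_comm]
  rw [h1, Finset.sum_Ico_eq_sum_range]
  refine (sum_range_rpow_tail_le ha k (d - k)).trans ?_
  have h5 : (0 : ℝ) < 2 ^ a := by positivity
  have h6 : 0 < a - 1 := by linarith
  gcongr
  have : (0 : ℝ) ≤ ((k + (d - k) : ℕ) + 1 : ℝ) ^ (1 - a) := by positivity
  linarith

end PowerSums

/-! ### The step-size schedule and scalar recursions driven by it. -/

section StepSize

variable {γ : ℝ} {N : ℕ}

/-- The number of steps in one stage of the schedule. -/
noncomputable def stageLength (N : ℕ) : ℝ := (N : ℝ) / Real.logb 2 N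

/-- The per-step decay rate of the smoothed schedule. -/
noncomputable def stageRatio (N : ℕ) : ℝ := (1 / 2 : ℝ) ^ (1 / stageLength N)

lemma one_le_logb (hN : 2 ≤ N) : 1 ≤ Real.logb 2 N := by
  rw [Real.le_logb_iff_rpow_le (by norm_num) (by positivity)]
  simpa using (by exact_mod_cast hN : (2 : ℝ) ≤ N)

lemma one_le_stageLength (hN : 2 ≤ N) : 1 ≤ stageLength N := by
  have h := one_le_logb hN
  rw [stageLength, one_le_div (by linarith), Real.logb_le_iff_le_rpow (by norm_num) (by positivity)]
  rw [Real.rpow_natCast]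
  exact_mod_cast (Nat.lt_two_pow_self).le

lemma stageRatio_pow (n : ℕ) :
    stageRatio N ^ n = (2 : ℝ) ^ (-((n : ℝ) / stageLength N)) := by
  rw [stageRatio, ← Real.rpow_mul_natCast (by norm_num), one_div, Real.inv_rpow (by norm_num),
    ← Real.rpow_neg (by norm_num)]
  congr 1
  ring

lemma stageRatio_pow_self (hN : 2 ≤ N) : stageRatio N ^ N = (N : ℝ)⁻¹ := by
  have h := one_le_logb hN
  have h0 : (N : ℝ) ≠ 0 := by positivity
  have hN0 : (0 : ℝ) < N := by positivity
  rw [stageRatio_pow, stageLength, div_div_cancel₀ h0, Real.rpow_neg (by norm_num),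
    Real.rpow_logb (by norm_num) (by norm_num) hN0]

lemma stageRatio_pos : 0 < stageRatio N := by unfold stageRatio; positivity

lemma stageRatio_le (hN : 2 ≤ N) : stageRatio N ≤ 1 - 1 / (2 * stageLength N) := by
  have hL := one_le_stageLength hN
  have h := rpow_one_add_le_one_add_mul_self (s := -1/2) (p := 1 / stageLength N) (by norm_num)
    (by positivity) (by rw [div_le_one (by linarith)]; exact hL)
  rw [stageRatio]
  convert h using 1
  · norm_num
  · field_simp; ring

lemma le_stageRatio (hN : 2 ≤ N) : 1 - 1 / stageLength N ≤ stageRatio N := by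
  have hL := one_le_stageLength hN
  rw [stageRatio, Real.rpow_def_of_pos (by norm_num)]
  refine le_trans ?_ (Real.add_one_le_exp _)
  have h1 : Real.log (1 / 2) = - Real.log 2 := by rw [one_div, Real.log_inv]
  rw [h1]
  have h2 := Real.log_two_lt_d9
  have : Real.log 2 * (1 / stageLength N) ≤ 1 * (1 / stageLength N) := by
    gcongr; linarith
  linarith

lemma half_le_stageRatio (hN : 2 ≤ N) : 1 / 2 ≤ stageRatio N := by
  have hL := one_le_stageLength hN
  rw [stageRatio]
  refine Real.self_le_rpow_of_le_one (by norm_num) (by norm_num) ?_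
  rw [div_le_one (by linarith)]; exact hL

lemma stageRatio_lt_one (hN : 2 ≤ N) : stageRatio N < 1 := by
  have h := stageRatio_le hN
  have hL := one_le_stageLength hN
  have : 0 < 1 / (2 * stageLength N) := by positivity
  linarith

/-- The floor only delays the halvings, by less than one stage. The schedule therefore lies within a
factor 2 of an exact geometric sequence, whose sums are explicit. -/
lemma le_stepSize (hγ : 0 ≤ γ) (hN : 2 ≤ N) (t : ℕ) : γ * stageRatio N ^ t ≤ stepSize γ N t := by
  have hL := one_le_stageLength hN
  rw [stageRatio_pow, stepSize, Real.rpow_neg (by norm_num), ← div_eq_mul_inv]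
  gcongr
  rw [← Real.rpow_natCast]
  exact Real.rpow_le_rpow_of_exponent_le (by norm_num) (Nat.floor_le (by unfold stageLength at *; positivity))

lemma stepSize_le (hγ : 0 ≤ γ) (t : ℕ) :
    stepSize γ N t ≤ 2 * (γ * stageRatio N ^ t) := by
  rw [stageRatio_pow, stepSize, Real.rpow_neg (by norm_num), ← div_eq_mul_inv, ← mul_div_assoc,
    div_le_div_iff₀ (by positivity) (by positivity)]
  have : (2 : ℝ) ^ ((t : ℝ) / stageLength N) ≤ 2 * 2 ^ ⌊(t : ℝ) / ((N : ℝ) / Real.logb 2 N)⌋₊ := by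
    rw [← pow_succ', ← Real.rpow_natCast]
    refine Real.rpow_le_rpow_of_exponent_le (by norm_num) ?_
    push_cast
    exact (Nat.lt_floor_add_one _).le
  nlinarith

lemma stepSize_pos (hγ : 0 < γ) (t : ℕ) : 0 < stepSize γ N t := by
  unfold stepSize; positivity

lemma stepSize_le_self (hγ : 0 ≤ γ) (t : ℕ) : stepSize γ N t ≤ γ := by
  unfold stepSize
  exact div_le_self hγ (one_le_pow₀ (by norm_num))

lemma sum_Ico_stepSize_ge (hγ : 0 ≤ γ) (hN : 2 ≤ N) {m : ℕ} (hm : m ≤ N) :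
    γ * stageLength N * (stageRatio N ^ m - (N : ℝ)⁻¹) ≤ ∑ l ∈ Finset.Ico m N, stepSize γ N l := by
  have hL := one_le_stageLength hN
  have hq := stageRatio_lt_one hN
  have hq0 := stageRatio_pos (N := N)
  have hq2 := le_stageRatio hN
  have h1 : ∑ l ∈ Finset.Ico m N, γ * stageRatio N ^ l ≤ ∑ l ∈ Finset.Ico m N, stepSize γ N l :=
    Finset.sum_le_sum fun l _ => le_stepSize hγ hN l
  refine le_trans ?_ h1
  rw [← Finset.mul_sum, mul_assoc]
  gcongr
  have h2 : ∑ l ∈ Finset.Ico m N, stageRatio N ^ l =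
      (stageRatio N ^ m - stageRatio N ^ N) / (1 - stageRatio N) := by
    rw [geom_sum_Ico' hq.ne hm]
  rw [h2, stageRatio_pow_self hN, le_div_iff₀ (by linarith)]
  have h3 : (N : ℝ)⁻¹ ≤ stageRatio N ^ m := by
    rw [← stageRatio_pow_self hN]
    exact pow_le_pow_of_le_one hq0.le hq.le hm
  have h4 : stageLength N * (1 - stageRatio N) ≤ 1 := by
    have : 1 - stageRatio N ≤ 1 / stageLength N := by linarith
    calc _ ≤ stageLength N * (1 / stageLength N) := by gcongr
      _ = 1 := by field_simp
  nlinarith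

lemma sum_stepSize_ge (hγ : 0 ≤ γ) (hN : 2 ≤ N) :
    γ * stageLength N / 2 ≤ ∑ l ∈ Finset.range N, stepSize γ N l := by
  have h := sum_Ico_stepSize_ge hγ hN (Nat.zero_le N)
  rw [Finset.range_eq_Ico]
  refine le_trans ?_ h
  have hL := one_le_stageLength hN
  have : (N : ℝ)⁻¹ ≤ 2⁻¹ := by gcongr; exact_mod_cast hN
  have h0 : 0 ≤ γ * stageLength N := by positivity
  simp only [pow_zero]
  nlinarith

lemma sum_stepSize_le (hγ : 0 ≤ γ) (hN : 2 ≤ N) :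
    ∑ l ∈ Finset.range N, stepSize γ N l ≤ 4 * (γ * stageLength N) := by
  have hL := one_le_stageLength hN
  have hq := stageRatio_lt_one hN
  have hq0 := stageRatio_pos (N := N)
  have hq2 := stageRatio_le hN
  calc _ ≤ ∑ l ∈ Finset.range N, 2 * γ * stageRatio N ^ l :=
        Finset.sum_le_sum fun l _ => (stepSize_le hγ l).trans_eq (by ring)
    _ = 2 * γ * ((1 - stageRatio N ^ N) / (1 - stageRatio N)) := by
        rw [← Finset.mul_sum, geom_sum_eq hq.ne, ← neg_div_neg_eq, neg_sub, neg_sub]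
    _ ≤ 2 * γ * (2 * stageLength N) := by
        gcongr
        rw [div_le_iff₀ (by linarith)]
        have h1 : 1 ≤ 2 * stageLength N * (1 - stageRatio N) := by
          have : 1 / (2 * stageLength N) ≤ 1 - stageRatio N := by linarith
          calc (1 : ℝ) = 2 * stageLength N * (1 / (2 * stageLength N)) := by field_simp
            _ ≤ _ := by gcongr
        have : 0 ≤ stageRatio N ^ N := by positivity
        linarith
    _ = _ := by ring

/-- Trades the exponential for x/(1 + x)², which is the derivative of x/(1 + x) with respect to log
x; its sums over geometric sequences therefore telescope. -/
lemma sq_mul_exp_neg_le {x : ℝ} (hx : 0 ≤ x) :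
    x ^ 2 * Real.exp (-x) ≤ 27 * (x / (1 + x) ^ 2) := by
  have h1 : 1 + x ≤ 3 * Real.exp (x / 3) := by
    have := Real.add_one_le_exp (x / 3)
    linarith
  have h2 : (1 + x) ^ 3 ≤ 27 * Real.exp x := by
    calc (1 + x) ^ 3 ≤ (3 * Real.exp (x / 3)) ^ 3 := by gcongr
      _ = 27 * Real.exp x := by
        rw [mul_pow, ← Real.exp_nat_mul]; norm_num; ring
  rw [Real.exp_neg, ← div_eq_mul_inv, ← mul_div_assoc, div_le_div_iff₀ (by positivity)
    (by positivity)]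
  have h3 : x * (1 + x) ^ 2 ≤ (1 + x) ^ 3 := by nlinarith [sq_nonneg (1 + x)]
  calc x ^ 2 * (1 + x) ^ 2 = x * (x * (1 + x) ^ 2) := by ring
    _ ≤ x * (27 * Real.exp x) := mul_le_mul_of_nonneg_left (h3.trans h2) hx
    _ = _ := by ring

lemma sum_geometric_profile_le (hN : 2 ≤ N) {θ : ℝ} (hθ : 0 ≤ θ) (n : ℕ) :
    ∑ i ∈ Finset.range n, θ * stageRatio N ^ i / (1 + θ * stageRatio N ^ i) ^ 2 ≤
      2 * stageLength N * (θ / (1 + θ)) := by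
  have hL := one_le_stageLength hN
  have hq := stageRatio_lt_one hN
  have hq0 := stageRatio_pos (N := N)
  have hq2 := stageRatio_le hN
  -- The telescoping form, with the last value subtracted, is what the induction can carry.
  suffices h : ∑ i ∈ Finset.range n, θ * stageRatio N ^ i / (1 + θ * stageRatio N ^ i) ^ 2 ≤
      2 * stageLength N * (θ / (1 + θ) - θ * stageRatio N ^ n / (1 + θ * stageRatio N ^ n)) by
    refine h.trans ?_
    gcongr
    have : 0 ≤ θ * stageRatio N ^ n / (1 + θ * stageRatio N ^ n) := by positivity
    linarith
  induction n with
  | zero => simp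
  | succ n ih =>
    rw [Finset.sum_range_succ]
    set x := θ * stageRatio N ^ n with hx
    have hx0 : 0 ≤ x := by positivity
    have hxs : θ * stageRatio N ^ (n + 1) = x * stageRatio N := by rw [hx]; ring
    rw [hxs]
    have key : x / (1 + x) ^ 2 ≤
        2 * stageLength N * (x / (1 + x) - x * stageRatio N / (1 + x * stageRatio N)) := by
      have h1 : x / (1 + x) - x * stageRatio N / (1 + x * stageRatio N) =
          x * (1 - stageRatio N) / ((1 + x) * (1 + x * stageRatio N)) := by
        field_simp
        ring
      have h2 : 1 ≤ 2 * stageLength N * (1 - stageRatio N) := by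
        have : 1 / (2 * stageLength N) ≤ 1 - stageRatio N := by linarith
        calc (1 : ℝ) = 2 * stageLength N * (1 / (2 * stageLength N)) := by field_simp
          _ ≤ _ := by gcongr
      have h3 : x * stageRatio N ≤ x := mul_le_of_le_one_right hx0 hq.le
      calc x / (1 + x) ^ 2 ≤ x / ((1 + x) * (1 + x * stageRatio N)) := by
            rw [sq]; gcongr
        _ ≤ x * (2 * stageLength N * (1 - stageRatio N)) / ((1 + x) * (1 + x * stageRatio N)) := by
            gcongr
            exact le_mul_of_one_le_right hx0 h2
        _ = _ := by rw [h1]; ring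
    linarith

/-- The accumulated noise in an eigendirection with eigenvalue `τ`. -/
noncomputable def noiseSum (η : ℕ → ℝ) (τ : ℝ) (n : ℕ) : ℝ :=
  ∑ i ∈ Finset.range n, (η i * τ) ^ 2 * ∏ l ∈ Finset.Ico (i + 1) n, (1 - 2 * (η l * τ))

lemma noiseSum_succ (η : ℕ → ℝ) (τ : ℝ) (n : ℕ) :
    noiseSum η τ (n + 1) = (1 - 2 * (η n * τ)) * noiseSum η τ n + (η n * τ) ^ 2 := by
  unfold noiseSum
  rw [Finset.sum_range_succ, Finset.Ico_self, Finset.prod_empty, mul_one, Finset.mul_sum]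
  congr 1
  refine Finset.sum_congr rfl fun i hi => ?_
  rw [Finset.prod_Ico_succ_top (by simpa using Finset.mem_range.1 hi)]
  ring

lemma recursion_le {η b : ℕ → ℝ} {τ K : ℝ} {n : ℕ} (h0 : ∀ t, 0 ≤ 1 - 2 * (η t * τ))
    (hb : ∀ t < n, b (t + 1) ≤ (1 - 2 * (η t * τ)) * b t + (η t * τ) ^ 2 * K) :
    b n ≤ (∏ l ∈ Finset.range n, (1 - 2 * (η l * τ))) * b 0 + K * noiseSum η τ n := by
  induction n with
  | zero => simp [noiseSum]
  | succ n ih =>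
    have h1 := ih fun t ht => hb t (by omega)
    have h2 := hb n (by omega)
    rw [noiseSum_succ, Finset.prod_range_succ]
    have h3 := mul_le_mul_of_nonneg_left h1 (h0 n)
    linarith

lemma prod_one_sub_le_exp {η : ℕ → ℝ} {τ : ℝ} (h0 : ∀ t, 0 ≤ 1 - 2 * (η t * τ)) (s : Finset ℕ) :
    ∏ l ∈ s, (1 - 2 * (η l * τ)) ≤ Real.exp (-(2 * τ * ∑ l ∈ s, η l)) := by
  rw [Finset.mul_sum, ← Finset.sum_neg_distrib, Real.exp_sum]
  refine Finset.prod_le_prod (fun l _ => h0 l) fun l _ => ?_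
  have := Real.add_one_le_exp (-(2 * τ * η l))
  linarith

/-- With x = θ q^i, noise injected at step i has size of order x²/L², and the steps that follow damp
it by about e^{-x}, since the remaining step sizes sum to about γ L q^i. Early noise is forgotten
and late noise is small; summing over geometric scales leaves (1/L) θ/(1 + θ). -/
lemma noiseSum_stepSize_le (hγ : 0 < γ) (hN : 2 ≤ N) {τ : ℝ} (hτ : 0 ≤ τ) (hγτ : γ * τ ≤ 1 / 2) :
    noiseSum (stepSize γ N) τ N ≤ 648 / stageLength N *
      (stageLength N * γ * τ / (1 + stageLength N * γ * τ)) := by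
  have hL := one_le_stageLength hN
  have hq := stageRatio_lt_one hN
  have hq0 := stageRatio_pos (N := N)
  have hq3 := half_le_stageRatio hN
  have h0 : ∀ t, 0 ≤ 1 - 2 * (stepSize γ N t * τ) := fun t => by
    have := mul_le_mul_of_nonneg_right (stepSize_le_self (N := N) hγ.le t) hτ
    linarith
  set θ := stageLength N * γ * τ with hθ
  have hθ0 : 0 ≤ θ := by positivity
  have hterm : ∀ i ∈ Finset.range N, (stepSize γ N i * τ) ^ 2 *
      ∏ l ∈ Finset.Ico (i + 1) N, (1 - 2 * (stepSize γ N l * τ)) ≤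
      324 / stageLength N ^ 2 *
        (θ * stageRatio N ^ i / (1 + θ * stageRatio N ^ i) ^ 2) := by
    intro i hi
    have hi' : i + 1 ≤ N := by simpa using hi
    set x := θ * stageRatio N ^ i with hx
    have hx0 : 0 ≤ x := by positivity
    have h1 : ∏ l ∈ Finset.Ico (i + 1) N, (1 - 2 * (stepSize γ N l * τ)) ≤ 3 * Real.exp (-x) := by
      refine (prod_one_sub_le_exp h0 _).trans ?_
      have h2 := sum_Ico_stepSize_ge hγ.le hN hi'
      have h3 : 2 * τ * (γ * stageLength N * (stageRatio N ^ (i + 1) - (N : ℝ)⁻¹)) ≤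
          2 * τ * ∑ l ∈ Finset.Ico (i + 1) N, stepSize γ N l := by gcongr
      -- The geometric sum stops at q^N = 1/N. The missing tail costs at most 1 in the exponent,
      -- hence the factor e ≤ 3.
      have h4 : 2 * τ * γ * (stageLength N * (N : ℝ)⁻¹) ≤ 1 := by
        have h5 : stageLength N * (N : ℝ)⁻¹ ≤ 1 := by
          have hN0 : (N : ℝ) ≠ 0 := by positivity
          rw [stageLength, ← div_eq_mul_inv, div_right_comm, div_self hN0,
            div_le_one (by linarith [one_le_logb hN])]
          exact one_le_logb hN
        have : 0 ≤ 2 * τ * γ := by positivity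
        nlinarith
      have h6 : x ≤ 2 * τ * (γ * stageLength N * stageRatio N ^ (i + 1)) := by
        have : 2 * τ * (γ * stageLength N * stageRatio N ^ (i + 1)) = x * (2 * stageRatio N) := by
          rw [hx, hθ]; ring
        rw [this]
        exact le_mul_of_one_le_right hx0 (by linarith)
      calc _ ≤ Real.exp (1 + -x) := Real.exp_le_exp.2 (by linarith)
        _ = Real.exp 1 * Real.exp (-x) := Real.exp_add _ _
        _ ≤ _ := by
          gcongr
          linarith [Real.exp_one_lt_d9]
    have h2 : (stepSize γ N i * τ) ^ 2 ≤ 4 / stageLength N ^ 2 * x ^ 2 := by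
      have : 4 / stageLength N ^ 2 * x ^ 2 = (2 * (γ * stageRatio N ^ i) * τ) ^ 2 := by
        rw [hx, hθ]; field_simp; ring
      rw [this]
      have h3 := (stepSize_pos (N := N) hγ i).le
      have h4 := stepSize_le (N := N) hγ.le i
      gcongr
    calc _ ≤ 4 / stageLength N ^ 2 * x ^ 2 * (3 * Real.exp (-x)) :=
          mul_le_mul h2 h1 (Finset.prod_nonneg fun l _ => h0 l) (by positivity)
      _ = 12 / stageLength N ^ 2 * (x ^ 2 * Real.exp (-x)) := by ring
      _ ≤ 12 / stageLength N ^ 2 * (27 * (x / (1 + x) ^ 2)) := by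
          exact mul_le_mul_of_nonneg_left (sq_mul_exp_neg_le hx0) (by positivity)
      _ = _ := by ring
  refine (Finset.sum_le_sum hterm).trans ?_
  rw [← Finset.mul_sum]
  calc _ ≤ 324 / stageLength N ^ 2 * (2 * stageLength N * (θ / (1 + θ))) := by
        gcongr; exact sum_geometric_profile_le hN hθ0 N
    _ = _ := by field_simp; ring

lemma prod_stepSize_le (hγ : 0 < γ) (hN : 2 ≤ N) {τ : ℝ} (hτ : 0 ≤ τ) (hγτ : γ * τ ≤ 1 / 2) :
    ∏ l ∈ Finset.range N, (1 - 2 * (stepSize γ N l * τ)) ≤ 1 / (1 + γ * stageLength N * τ) := by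
  have hL := one_le_stageLength hN
  have h0 : ∀ t, 0 ≤ 1 - 2 * (stepSize γ N t * τ) := fun t => by
    have := mul_le_mul_of_nonneg_right (stepSize_le_self (N := N) hγ.le t) hτ
    linarith
  refine (prod_one_sub_le_exp h0 _).trans ?_
  have h1 := mul_le_mul_of_nonneg_left (sum_stepSize_ge hγ.le hN) (show 0 ≤ 2 * τ by positivity)
  rw [Real.exp_neg, ← one_div]
  refine one_div_le_one_div_of_le (by positivity) ?_
  refine le_trans ?_ (Real.add_one_le_exp _)
  linarith

lemma one_sub_sum_le_prod {x : ℕ → ℝ} (h0 : ∀ t, 0 ≤ x t) (n : ℕ)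
    (h1 : ∑ t ∈ Finset.range n, x t ≤ 1) :
    1 - ∑ t ∈ Finset.range n, x t ≤ ∏ t ∈ Finset.range n, (1 - x t) := by
  induction n with
  | zero => simp
  | succ n ih =>
    rw [Finset.sum_range_succ] at h1 ⊢
    rw [Finset.prod_range_succ]
    have hs : 0 ≤ ∑ t ∈ Finset.range n, x t := Finset.sum_nonneg fun i _ => h0 i
    have h2 := ih (by linarith [h0 n])
    have h3 := mul_le_mul_of_nonneg_right h2 (show 0 ≤ 1 - x n by linarith)
    nlinarith [mul_nonneg hs (h0 n)]

lemma le_prod_one_sub_sq {x : ℕ → ℝ} {n : ℕ} (h0 : ∀ t, 0 ≤ x t)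
    (h1 : ∑ t ∈ Finset.range n, x t ≤ 1 / 2) :
    1 / 4 ≤ ∏ t ∈ Finset.range n, (1 - x t) ^ 2 := by
  rw [Finset.prod_pow]
  have h2 := one_sub_sum_le_prod h0 n (by linarith)
  nlinarith

end StepSize

/-! ### Deterministic spectral estimates for Aᵀ A. -/

section Spectral

variable {d M : ℕ}

/-- The vectors `v j` form an orthonormal eigenbasis of `Aᵀ A` with eigenvalues `τ j`. -/
structure IsGramEigenbasis (A : Matrix (Fin M) (Fin d) ℝ) (v : Fin d → Fin d → ℝ)
    (τ : Fin d → ℝ) : Prop where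
  nonneg : ∀ j, 0 ≤ τ j
  sum_mul : ∀ i l, ∑ j, v j i * v j l = if i = l then 1 else 0
  norm_sq : ∀ j, ∑ i, v j i ^ 2 = 1
  gram : ∀ j, Aᵀ *ᵥ (A *ᵥ v j) = τ j • v j
  card_ne_zero : (Finset.univ.filter fun j => τ j ≠ 0).card ≤ M

lemma exists_isGramEigenbasis (A : Matrix (Fin M) (Fin d) ℝ) :
    ∃ v τ, IsGramEigenbasis A v τ := by
  have hT : (Aᵀ * A).PosSemidef := by
    simpa [conjTranspose_eq_transpose_of_trivial] using posSemidef_conjTranspose_mul_self A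
  let b := hT.isHermitian.eigenvectorBasis
  refine ⟨fun j => (b j).ofLp, hT.isHermitian.eigenvalues, fun j => hT.eigenvalues_nonneg j,
    fun i l => ?_, fun j => ?_, fun j => ?_, ?_⟩
  · have h := b.sum_inner_mul_inner (EuclideanSpace.single i 1) (EuclideanSpace.single l 1)
    simp only [EuclideanSpace.inner_single_left, EuclideanSpace.inner_single_right] at h
    simpa [Pi.single_apply, eq_comm] using h
  · have h := b.orthonormal.1 j
    have h2 := EuclideanSpace.norm_sq_eq (b j)
    rw [h] at h2
    simpa using h2.symm
  · rw [mulVec_mulVec]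
    exact hT.isHermitian.mulVec_eigenvectorBasis j
  · have h := hT.isHermitian.rank_eq_card_non_zero_eigs
    rw [Fintype.card_subtype] at h
    rw [← h]
    calc (Aᵀ * A).rank ≤ A.rank := rank_mul_le_right _ _
      _ ≤ M := by simpa using A.rank_le_height

namespace IsGramEigenbasis

variable {A : Matrix (Fin M) (Fin d) ℝ} {v : Fin d → Fin d → ℝ} {τ : Fin d → ℝ}

lemma parseval (h : IsGramEigenbasis A v τ) (x : Fin d → ℝ) :
    ∑ j, (x ⬝ᵥ v j) ^ 2 = ∑ i, x i ^ 2 := by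
  have h1 : ∀ j, (x ⬝ᵥ v j) ^ 2 = ∑ i, ∑ l, x i * x l * (v j i * v j l) := fun j => by
    rw [sq, dotProduct, Finset.sum_mul_sum]
    exact Finset.sum_congr rfl fun i _ => Finset.sum_congr rfl fun l _ => by ring
  simp_rw [h1]
  rw [Finset.sum_comm]
  refine Finset.sum_congr rfl fun i _ => ?_
  rw [Finset.sum_comm]
  simp_rw [← Finset.mul_sum, h.sum_mul]
  simp [sq]

lemma sum_sq (h : IsGramEigenbasis A v τ) (i : Fin d) : ∑ j, v j i ^ 2 = 1 := by
  have := h.sum_mul i i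
  simpa [sq] using this

lemma norm_sq_mulVec (h : IsGramEigenbasis A v τ) (j : Fin d) :
    ∑ m, (A *ᵥ v j) m ^ 2 = τ j := by
  have h1 : (A *ᵥ v j) ⬝ᵥ (A *ᵥ v j) = τ j := by
    rw [dotProduct_mulVec, ← mulVec_transpose, h.gram, smul_dotProduct]
    have := h.norm_sq j
    simp only [sq] at this
    simp [dotProduct, this]
  rw [← h1]
  simp [dotProduct, sq]

/-- Both sides are the diagonal entry (Aᵀ A)_{ii}. This links eigenvalue sums to column lengths, the
quantities that concentrate. -/
lemma sum_eigenvalue_mul_sq (h : IsGramEigenbasis A v τ) (i : Fin d) :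
    ∑ j, τ j * v j i ^ 2 = ∑ m, A m i ^ 2 := by
  have h1 : ∀ j, τ j * v j i ^ 2 = ∑ m, A m i * ∑ l, A m l * (v j l * v j i) := fun j => by
    have h2 := congrFun (h.gram j) i
    simp only [mulVec, dotProduct, Pi.smul_apply, smul_eq_mul, transpose_apply] at h2
    rw [sq, ← mul_assoc, ← h2, Finset.sum_mul]
    refine Finset.sum_congr rfl fun m _ => ?_
    rw [mul_assoc, Finset.sum_mul]
    congr 1
    exact Finset.sum_congr rfl fun l _ => by ring
  simp_rw [h1]
  rw [Finset.sum_comm]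
  refine Finset.sum_congr rfl fun m _ => ?_
  rw [← Finset.mul_sum, Finset.sum_comm]
  simp_rw [← Finset.mul_sum, h.sum_mul]
  simp [sq]

/-- The total squared length of the columns of `A` with index at least `k`. -/
def _root_.SketchedRegression.colTail (A : Matrix (Fin M) (Fin d) ℝ) (k : ℕ) : ℝ :=
  ∑ i : Fin d with k ≤ i.val, ∑ m, A m i ^ 2

lemma _root_.SketchedRegression.colTail_nonneg (A : Matrix (Fin M) (Fin d) ℝ) (k : ℕ) :
    0 ≤ colTail A k :=
  Finset.sum_nonneg fun _ _ => Finset.sum_nonneg fun _ _ => sq_nonneg _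

lemma sum_eigenvalues (h : IsGramEigenbasis A v τ) : ∑ j, τ j = colTail A 0 := by
  simp only [colTail, zero_le, Finset.filter_true]
  simp_rw [← h.sum_eigenvalue_mul_sq]
  rw [Finset.sum_comm]
  simp_rw [← Finset.mul_sum, h.norm_sq, mul_one]

lemma _root_.SketchedRegression.card_filter_lt_le (d k : ℕ) :
    (Finset.univ.filter fun i : Fin d => ¬ k ≤ i.val).card ≤ k := by
  calc _ = ((Finset.univ.filter fun i : Fin d => ¬ k ≤ i.val).map Fin.valEmbedding).card := by simp
    _ ≤ (Finset.range k).card := Finset.card_le_card fun i hi => by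
        simp only [Finset.mem_map, Finset.mem_filter, Finset.mem_univ, true_and] at hi
        obtain ⟨a, ha, rfl⟩ := hi
        simpa using ha
    _ = k := by simp

/-- A bound on the effective dimension of `Aᵀ A`. -/
lemma sum_le_add_colTail (h : IsGramEigenbasis A v τ) {g : Fin d → ℝ} {s : ℝ}
    (hg1 : ∀ j, g j ≤ 1) (hg2 : ∀ j, g j ≤ s * τ j) (k : ℕ) :
    ∑ j, g j ≤ k + s * colTail A k := by
  -- The trace of g(Aᵀ A) is read off in the original coordinates: each of the first k diagonal
  -- entries is at most 1, and any other is at most s times a squared column length.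
  have h1 : ∑ j, g j = ∑ i, ∑ j, g j * v j i ^ 2 := by
    rw [Finset.sum_comm]
    simp_rw [← Finset.mul_sum, h.norm_sq, mul_one]
  rw [h1, ← Finset.sum_filter_add_sum_filter_not Finset.univ (fun i : Fin d => k ≤ i.val), add_comm]
  refine add_le_add ?_ ?_
  · calc _ ≤ ∑ i : Fin d with ¬ k ≤ i.val, (1 : ℝ) := by
          refine Finset.sum_le_sum fun i _ => ?_
          rw [← h.sum_sq i]
          exact Finset.sum_le_sum fun j _ => mul_le_of_le_one_left (sq_nonneg _) (hg1 j)
      _ ≤ k := by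
          rw [Finset.sum_const, nsmul_eq_mul, mul_one]
          exact_mod_cast card_filter_lt_le d k
  · rw [colTail, Finset.mul_sum]
    refine Finset.sum_le_sum fun i _ => ?_
    rw [← h.sum_eigenvalue_mul_sq, Finset.mul_sum]
    refine Finset.sum_le_sum fun j _ => ?_
    rw [← mul_assoc]
    exact mul_le_mul_of_nonneg_right (hg2 j) (sq_nonneg _)

/-- The indicator of τ > t is dominated by both 1 and τ/t. -/
lemma card_lt_le (h : IsGramEigenbasis A v τ) {t : ℝ} (ht : 0 < t) (k : ℕ) :
    ((Finset.univ.filter fun j => t < τ j).card : ℝ) ≤ k + t⁻¹ * colTail A k := by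
  have := h.sum_le_add_colTail (g := fun j => if t < τ j then 1 else 0) (s := t⁻¹)
    (fun j => by split_ifs <;> norm_num) (fun j => by
      have := h.nonneg j
      split_ifs with hj
      · rw [inv_mul_eq_div, one_le_div ht]; exact hj.le
      · positivity) k
  simpa using this

lemma card_lt_le_height (h : IsGramEigenbasis A v τ) {t : ℝ} (ht : 0 < t) :
    (Finset.univ.filter fun j => t < τ j).card ≤ M :=
  (Finset.card_le_card (Finset.monotone_filter_right _ fun _ _ hj =>
    (ht.trans hj).ne')).trans h.card_ne_zero

lemma sum_effdim_le (h : IsGramEigenbasis A v τ) {s : ℝ} (hs : 0 ≤ s) (k : ℕ) :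
    ∑ j, s * τ j / (1 + s * τ j) ≤ k + s * colTail A k := by
  refine h.sum_le_add_colTail (fun j => ?_) (fun j => ?_) k
  · have := mul_nonneg hs (h.nonneg j)
    rw [div_le_one (by linarith)]; linarith
  · have := mul_nonneg hs (h.nonneg j)
    exact div_le_self this (by linarith)

/-- A Frobenius norm does not depend on the orthonormal basis: the left side computes that of A
restricted to the tail coordinates in the basis v, the right side in the standard one. -/
lemma sum_norm_sq_mulVec_tail (h : IsGramEigenbasis A v τ) (k : ℕ) :
    ∑ j, ∑ m, (A *ᵥ fun i => if k ≤ i.val then v j i else 0) m ^ 2 = colTail A k := by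
  have h1 : ∀ j m, (A *ᵥ fun i => if k ≤ i.val then v j i else 0) m =
      (fun i => if k ≤ i.val then A m i else 0) ⬝ᵥ v j := fun j m => by
    simp only [mulVec, dotProduct]
    exact Finset.sum_congr rfl fun i _ => by split_ifs <;> simp
  simp_rw [h1]
  rw [Finset.sum_comm]
  simp_rw [h.parseval]
  rw [Finset.sum_comm, colTail, Finset.sum_filter]
  refine Finset.sum_congr rfl fun i _ => ?_
  split_ifs <;> simp

/-- Upper bound on the ridge bias in terms of a lower bound for `A` on the leading coordinates. -/
lemma ridge_bias_le (h : IsGramEigenbasis A v τ) {lam : Fin d → ℝ} (hlam : ∀ i, 0 ≤ lam i)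
    {c s : ℝ} (hc : 0 < c) (hs : 0 < s) (k : ℕ)
    (hA : ∀ u : Fin d → ℝ, (∀ i, k ≤ i.val → u i = 0) →
      c * ∑ i, lam i * u i ^ 2 ≤ ∑ m, (A *ᵥ u) m ^ 2) :
    ∑ j, 1 / (1 + s * τ j) * ∑ i, lam i * v j i ^ 2 ≤
      ∑ i : Fin d with k ≤ i.val, lam i + 2 / c * (k / s + 2 * colTail A k) := by
  -- Split v_j = u_j + w_j into leading and tail coordinates. The tail part costs at most the tail
  -- of λ. For the head, `hA` gives a bound by |A u_j|² ≤ 2 (τ_j + |A w_j|²), and τ_j/(1 + s τ_j)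
  -- sums to 1/s times the effective dimension.
  let w : Fin d → Fin d → ℝ := fun j i => if k ≤ i.val then v j i else 0
  let u : Fin d → Fin d → ℝ := fun j i => if k ≤ i.val then 0 else v j i
  have hw : ∑ j, ∑ m, (A *ᵥ w j) m ^ 2 = colTail A k := h.sum_norm_sq_mulVec_tail k
  have hsτ : ∀ j, 0 ≤ s * τ j := fun j => mul_nonneg hs.le (h.nonneg j)
  have hu : ∀ j, ∑ i, lam i * u j i ^ 2 ≤ 2 / c * (τ j + ∑ m, (A *ᵥ w j) m ^ 2) := fun j => by
    have h1 := hA (u j) fun i hi => by simp [u, hi]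
    have h2 : u j = v j - w j := by
      ext i
      simp only [u, w, Pi.sub_apply]
      split_ifs <;> simp
    have h3 : ∑ m, (A *ᵥ u j) m ^ 2 ≤ 2 * (τ j + ∑ m, (A *ᵥ w j) m ^ 2) := by
      rw [← h.norm_sq_mulVec j, ← Finset.sum_add_distrib, Finset.mul_sum]
      refine Finset.sum_le_sum fun m _ => ?_
      rw [h2, mulVec_sub, Pi.sub_apply]
      nlinarith [sq_nonneg ((A *ᵥ v j) m + (A *ᵥ w j) m)]
    have h4 := h1.trans h3
    rw [div_mul_eq_mul_div, le_div_iff₀ hc]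
    linarith
  have hsplit : ∀ j, ∑ i, lam i * v j i ^ 2 =
      ∑ i : Fin d with k ≤ i.val, lam i * v j i ^ 2 + ∑ i, lam i * u j i ^ 2 := fun j => by
    rw [Finset.sum_filter, ← Finset.sum_add_distrib]
    refine Finset.sum_congr rfl fun i _ => ?_
    simp only [u]
    split_ifs <;> simp
  have hg : ∀ j, 1 / (1 + s * τ j) ≤ 1 := fun j => by
    rw [div_le_one (by linarith [hsτ j])]; linarith [hsτ j]
  have hg0 : ∀ j, 0 ≤ 1 / (1 + s * τ j) := fun j => by
    have := hsτ j; positivity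
  have hterm : ∀ j, 1 / (1 + s * τ j) * ∑ i, lam i * v j i ^ 2 ≤
      ∑ i : Fin d with k ≤ i.val, lam i * v j i ^ 2 +
        2 / c * (1 / s * (s * τ j / (1 + s * τ j)) + ∑ m, (A *ᵥ w j) m ^ 2) := fun j => by
    have h5 : 0 ≤ ∑ i : Fin d with k ≤ i.val, lam i * v j i ^ 2 :=
      Finset.sum_nonneg fun i _ => mul_nonneg (hlam i) (sq_nonneg _)
    have h6 : 0 ≤ ∑ m, (A *ᵥ w j) m ^ 2 := Finset.sum_nonneg fun _ _ => sq_nonneg _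
    rw [hsplit, mul_add]
    refine add_le_add (mul_le_of_le_one_left h5 (hg j)) ?_
    calc _ ≤ 1 / (1 + s * τ j) * (2 / c * (τ j + ∑ m, (A *ᵥ w j) m ^ 2)) :=
          mul_le_mul_of_nonneg_left (hu j) (hg0 j)
      _ = 2 / c * (1 / s * (s * τ j / (1 + s * τ j)) +
            1 / (1 + s * τ j) * ∑ m, (A *ᵥ w j) m ^ 2) := by
          have := hsτ j
          field_simp
      _ ≤ _ := by
          gcongr
          exact mul_le_of_le_one_left h6 (hg j)
  refine (Finset.sum_le_sum fun j _ => hterm j).trans ?_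
  rw [Finset.sum_add_distrib, ← Finset.mul_sum, Finset.sum_add_distrib, hw, ← Finset.mul_sum]
  refine add_le_add ?_ ?_
  · rw [Finset.sum_comm]
    simp_rw [← Finset.mul_sum, h.sum_sq, mul_one]
    rfl
  · refine mul_le_mul_of_nonneg_left ?_ (by positivity)
    have h7 := h.sum_effdim_le hs.le k
    have h8 : 1 / s * ∑ j, s * τ j / (1 + s * τ j) ≤ 1 / s * (k + s * colTail A k) := by gcongr
    have h9 : 1 / s * (k + s * colTail A k) = k / s + colTail A k := by field_simp
    linarith

/-- Weights bounded below off few eigendirections keep a fixed share of the spectrum. -/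
lemma le_sum_weight_mul (h : IsGramEigenbasis A v τ) {lam q : Fin d → ℝ} (hlam : ∀ i, 0 ≤ lam i)
    (hq : ∀ j, 0 ≤ q j) {t ε l : ℝ} (hε : 0 ≤ ε) (hl : 0 ≤ l) (hqt : ∀ j, τ j ≤ t → ε ≤ q j)
    {m n : ℕ} (hm : (Finset.univ.filter fun j => t < τ j).card ≤ m) (hmn : m + n ≤ d)
    (hlow : ∀ i : Fin d, i.val < m + n → l ≤ lam i) :
    ε * (n * l) ≤ ∑ j, q j * ∑ i, lam i * v j i ^ 2 := by
  have h1 : ∀ j, ∑ i : Fin d with i.val < m + n, l * v j i ^ 2 ≤ ∑ i, lam i * v j i ^ 2 := fun j =>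
    (Finset.sum_le_sum fun i hi => mul_le_mul_of_nonneg_right
      (hlow i (Finset.mem_filter.1 hi).2) (sq_nonneg _)).trans
      (Finset.sum_le_sum_of_subset_of_nonneg (Finset.filter_subset _ _)
        fun i _ _ => mul_nonneg (hlam i) (sq_nonneg _))
  have h2 : ∑ j with ¬ t < τ j, ε * ∑ i : Fin d with i.val < m + n, l * v j i ^ 2 ≤
      ∑ j, q j * ∑ i, lam i * v j i ^ 2 := by
    refine (Finset.sum_le_sum fun j hj => ?_).trans
      (Finset.sum_le_sum_of_subset_of_nonneg (Finset.filter_subset _ _) fun j _ _ =>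
        mul_nonneg (hq j) (Finset.sum_nonneg fun i _ => mul_nonneg (hlam i) (sq_nonneg _)))
    exact mul_le_mul (hqt j (not_lt.1 (Finset.mem_filter.1 hj).2)) (h1 j)
      (Finset.sum_nonneg fun i _ => mul_nonneg hl (sq_nonneg _)) (hq j)
  refine le_trans ?_ h2
  rw [← Finset.mul_sum]
  gcongr
  simp_rw [← Finset.mul_sum]
  rw [mul_comm]
  gcongr
  -- Dimension count: the projection onto the first m + n coordinates has trace m + n, and the at
  -- most m eigenvectors with τ_j > t carry at most m of it, leaving n for the others.
  have h3 : ∑ j, ∑ i : Fin d with i.val < m + n, v j i ^ 2 = ((m + n : ℕ) : ℝ) := by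
    rw [Finset.sum_comm]
    simp_rw [h.sum_sq]
    rw [Finset.sum_const, nsmul_eq_mul, mul_one, Fin.card_filter_val_lt]
    simp [hmn]
  have h4 : ∑ j with t < τ j, ∑ i : Fin d with i.val < m + n, v j i ^ 2 ≤ m := by
    calc _ ≤ ∑ j with t < τ j, (1 : ℝ) := Finset.sum_le_sum fun j _ => by
          rw [← h.norm_sq j]
          exact Finset.sum_le_sum_of_subset_of_nonneg (Finset.filter_subset _ _)
            fun _ _ _ => sq_nonneg _
      _ ≤ m := by
          rw [Finset.sum_const, nsmul_eq_mul, mul_one]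
          exact_mod_cast hm
  rw [← Finset.sum_filter_add_sum_filter_not Finset.univ (fun j => t < τ j)] at h3
  push_cast at h3
  linarith

end IsGramEigenbasis

end Spectral

/-! ### The coupled recursion for the energies. -/

section RiskRecursion

variable {d : ℕ}

/-- The recursion that dominates the second moments of the SGD residual along the eigenvectors. -/
def riskRec (η : ℕ → ℝ) (τ : Fin d → ℝ) (s : ℝ) (β : Fin d → ℝ) : ℕ → Fin d → ℝ
  | 0 => β
  | t + 1 => fun j => (1 - 2 * (η t * τ j)) * riskRec η τ s β t j +
      (η t * τ j) ^ 2 * (3 * ∑ l, riskRec η τ s β t l + s)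

variable {η : ℕ → ℝ} {τ : Fin d → ℝ} {s : ℝ} {β : Fin d → ℝ}

lemma riskRec_nonneg (h0 : ∀ t j, 0 ≤ 1 - 2 * (η t * τ j)) (hs : 0 ≤ s) (hβ : ∀ j, 0 ≤ β j)
    (t : ℕ) (j : Fin d) : 0 ≤ riskRec η τ s β t j := by
  induction t generalizing j with
  | zero => exact hβ j
  | succ t ih =>
    have := Finset.sum_nonneg fun l (_ : l ∈ Finset.univ) => ih l
    exact add_nonneg (mul_nonneg (h0 t j) (ih j)) (by positivity)

/-- Suppose the total is at most K. Then β_j + (3K + s) γ τ_j / 2 is a barrier for direction j,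
since contraction removes a fraction 2 η τ_j of it and the injected noise is at most (η τ_j)(γ
τ_j)(3K + s). Summing the barriers with γ ∑ τ_j ≤ 1/3 gives back a total at most K, so the induction
closes. -/
lemma sum_riskRec_le {γ : ℝ} (hη : ∀ t, 0 ≤ η t) (hηγ : ∀ t, η t ≤ γ) (hτ : ∀ j, 0 ≤ τ j)
    (hγτ : γ * ∑ j, τ j ≤ 1 / 3) (h0 : ∀ t j, 0 ≤ 1 - 2 * (η t * τ j)) (hs : 0 ≤ s)
    (hβ : ∀ j, 0 ≤ β j) (t : ℕ) :
    ∑ j, riskRec η τ s β t j ≤ 2 * ∑ j, β j + s := by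
  set K := 2 * ∑ j, β j + s with hK
  have hβs := Finset.sum_nonneg fun l (_ : l ∈ Finset.univ) => hβ l
  have hγ : 0 ≤ γ := (hη 0).trans (hηγ 0)
  have hK0 : 0 ≤ K := by positivity
  have hsum : ∀ t, (∀ j, riskRec η τ s β t j ≤ β j + (3 * K + s) * (γ * τ j) / 2) →
      ∑ j, riskRec η τ s β t j ≤ K := fun t ht => by
    refine (Finset.sum_le_sum fun j _ => ht j).trans ?_
    rw [Finset.sum_add_distrib, ← Finset.sum_div, ← Finset.mul_sum, ← Finset.mul_sum]
    nlinarith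
  refine hsum t ?_
  induction t with
  | zero =>
    intro j
    have := mul_nonneg hγ (hτ j)
    simp only [riskRec, le_add_iff_nonneg_right]
    positivity
  | succ t ih =>
    intro j
    have h1 := hsum t ih
    have h2 := mul_le_mul_of_nonneg_left (ih j) (h0 t j)
    have h3 : (η t * τ j) ^ 2 * (3 * ∑ l, riskRec η τ s β t l + s) ≤
        (η t * τ j) ^ 2 * (3 * K + s) := by gcongr
    have hx : 0 ≤ η t * τ j := mul_nonneg (hη t) (hτ j)
    have hxy : η t * τ j ≤ γ * τ j := mul_le_mul_of_nonneg_right (hηγ t) (hτ j)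
    have h4 : (η t * τ j) ^ 2 * (3 * K + s) ≤ (η t * τ j) * (γ * τ j) * (3 * K + s) := by
      rw [sq]; gcongr
    have h5 : 0 ≤ 2 * (η t * τ j) * β j := mul_nonneg (by positivity) (hβ j)
    simp only [riskRec]
    linarith

/-- Replacing the coupling 3 ∑ b_l + s by its uniform bound 6 ∑ β + 4 s turns the system into
independent scalar recursions, solved by the schedule estimates. -/
lemma riskRec_stepSize_le {γ : ℝ} {N : ℕ} (hγ : 0 < γ) (hN : 2 ≤ N) (hτ : ∀ j, 0 ≤ τ j)
    (hγτ : γ * ∑ j, τ j ≤ 1 / 3) (hs : 0 ≤ s) (hβ : ∀ j, 0 ≤ β j) :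
    ∑ j, riskRec (stepSize γ N) τ s β N j ≤
      ∑ j, 1 / (1 + γ * stageLength N * τ j) * β j +
        (6 * ∑ j, β j + 4 * s) * (648 / stageLength N) *
          ∑ j, γ * stageLength N * τ j / (1 + γ * stageLength N * τ j) := by
  have hτγ : ∀ j, γ * τ j ≤ 1 / 2 := fun j => by
    have h1 := Finset.single_le_sum (fun i _ => hτ i) (Finset.mem_univ j)
    have h2 := mul_le_mul_of_nonneg_left h1 hγ.le
    linarith
  have h0 : ∀ t j, 0 ≤ 1 - 2 * (stepSize γ N t * τ j) := fun t j => by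
    have := mul_le_mul_of_nonneg_right (stepSize_le_self (N := N) hγ.le t) (hτ j)
    linarith [hτγ j]
  have hK := sum_riskRec_le (η := stepSize γ N) (fun t => (stepSize_pos hγ t).le)
    (fun t => stepSize_le_self hγ.le t) hτ hγτ h0 hs hβ
  have hL := one_le_stageLength hN
  have hβs := Finset.sum_nonneg fun l (_ : l ∈ Finset.univ) => hβ l
  rw [Finset.mul_sum, ← Finset.sum_add_distrib]
  refine Finset.sum_le_sum fun j _ => ?_
  have h1 := recursion_le (b := fun t => riskRec (stepSize γ N) τ s β t j) (n := N)
    (K := 6 * ∑ j, β j + 4 * s) (fun t => h0 t j) fun t _ => by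
      have := mul_le_mul_of_nonneg_left (show 3 * ∑ l, riskRec (stepSize γ N) τ s β t l + s ≤
        6 * ∑ j, β j + 4 * s by linarith [hK t]) (sq_nonneg (stepSize γ N t * τ j))
      simp only [riskRec]
      linarith
  refine h1.trans (add_le_add ?_ ?_)
  · exact mul_le_mul_of_nonneg_right (prod_stepSize_le hγ hN (hτ j) (hτγ j)) (hβ j)
  · have h2 := noiseSum_stepSize_le hγ hN (hτ j) (hτγ j)
    rw [mul_assoc]
    refine mul_le_mul_of_nonneg_left (h2.trans_eq ?_) (by positivity)
    rw [mul_comm γ]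

end RiskRecursion

/-! ### Concentration of the Gaussian sketch. -/

section GaussianSketch

variable {M d : ℕ}

lemma map_dotProduct_pi_gaussianReal (v : ℝ≥0) (u : Fin d → ℝ) :
    (Measure.pi fun _ : Fin d => gaussianReal 0 v).map (fun r => r ⬝ᵥ u) =
      gaussianReal 0 (v * (∑ i, u i ^ 2).toNNReal) := by
  have hmeas : Measurable fun r : Fin d → ℝ => r ⬝ᵥ u := by
    unfold dotProduct; fun_prop
  refine Measure.ext_of_charFun (funext fun t => ?_)
  rw [charFun_gaussianReal, charFun_apply_real, integral_map hmeas.aemeasurable (by fun_prop)]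
  have h1 : ∀ r : Fin d → ℝ, Complex.exp (t * ((r ⬝ᵥ u : ℝ) : ℂ) * Complex.I) =
      ∏ i, Complex.exp ((t * u i : ℝ) * (r i : ℂ) * Complex.I) := fun r => by
    rw [← Complex.exp_sum, dotProduct]
    push_cast
    rw [Finset.mul_sum, Finset.sum_mul]
    congr 1
    exact Finset.sum_congr rfl fun i _ => by ring
  simp_rw [h1]
  rw [integral_fintype_prod_eq_prod (𝕜 := ℂ)
    (fun i (x : ℝ) => Complex.exp ((t * u i : ℝ) * (x : ℂ) * Complex.I))]
  simp_rw [← charFun_apply_real, charFun_gaussianReal]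
  rw [← Complex.exp_sum]
  congr 1
  simp only [Complex.ofReal_zero, mul_zero, zero_mul, zero_sub, Finset.sum_neg_distrib]
  congr 1
  rw [NNReal.coe_mul, Real.coe_toNNReal _ (by positivity)]
  push_cast
  rw [Finset.mul_sum, Finset.sum_mul, Finset.sum_div]
  exact Finset.sum_congr rfl fun i _ => by ring

lemma lintegral_exp_sq_gaussianReal (v : ℝ≥0) {t : ℝ} (ht : 2 * t * v < 1) :
    ∫⁻ x, ENNReal.ofReal (Real.exp (t * x ^ 2)) ∂gaussianReal 0 v =
      ENNReal.ofReal (√(1 - 2 * t * v))⁻¹ := by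
  rcases eq_or_ne v 0 with rfl | hv
  · simp [gaussianReal_zero_var, lintegral_dirac]
  have hv0 : (0 : ℝ) < v := by positivity
  rw [gaussianReal_of_var_ne_zero _ hv, lintegral_withDensity_eq_lintegral_mul _
    (measurable_gaussianPDF _ _) (by fun_prop)]
  set b : ℝ := (1 - 2 * t * v) / (2 * v) with hb
  have hb0 : 0 < b := div_pos (by linarith) (by linarith)
  have h1 : ∀ x : ℝ, (gaussianPDF 0 v * fun x => ENNReal.ofReal (Real.exp (t * x ^ 2))) x =
      ENNReal.ofReal ((√(2 * Real.pi * v))⁻¹ * Real.exp (-b * x ^ 2)) := fun x => by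
    rw [Pi.mul_apply, gaussianPDF, ← ENNReal.ofReal_mul (gaussianPDFReal_nonneg _ _ _),
      gaussianPDFReal, mul_assoc, ← Real.exp_add]
    congr 3
    rw [hb]
    field_simp
    ring
  simp_rw [h1]
  rw [← ofReal_integral_eq_lintegral_ofReal ((integrable_exp_neg_mul_sq hb0).const_mul _)
    (Filter.Eventually.of_forall fun x => by positivity), integral_const_mul, integral_gaussian]
  congr 1
  rw [← Real.sqrt_inv, ← Real.sqrt_inv, ← Real.sqrt_mul (by positivity)]
  congr 1
  rw [hb]
  have : 1 - 2 * t * v ≠ 0 := by linarith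
  field_simp

/-- The squared length of `R u`. -/
def sqLen (R : Matrix (Fin M) (Fin d) ℝ) (u : Fin d → ℝ) : ℝ := ∑ m, (R *ᵥ u) m ^ 2

lemma measurable_entry {m n : ℕ} (i : Fin m) (j : Fin n) :
    Measurable fun R : Matrix (Fin m) (Fin n) ℝ => R i j :=
  (measurable_pi_apply (X := fun _ : Fin n => ℝ) j).comp
    (measurable_pi_apply (X := fun _ : Fin m => Fin n → ℝ) i)

lemma measurable_sqLen (u : Fin d → ℝ) :
    Measurable fun R : Matrix (Fin M) (Fin d) ℝ => sqLen R u := by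
  unfold sqLen mulVec dotProduct
  exact Finset.measurable_sum _ fun m _ => (Finset.measurable_sum _ fun i _ =>
    (measurable_entry m i).mul_const _).pow_const 2

instance : IsProbabilityMeasure (sketchLaw M d) := by
  unfold sketchLaw
  exact inferInstanceAs (IsProbabilityMeasure (Measure.pi fun _ : Fin M =>
    Measure.pi fun _ : Fin d => gaussianReal 0 ((M : ℝ≥0)⁻¹)))

/-- The exponential moments of `M |R u|²`, a multiple of a chi-squared variable. -/
lemma lintegral_exp_sqLen (hM : 1 ≤ M) (u : Fin d → ℝ) {c : ℝ} (hc : 2 * c * ∑ i, u i ^ 2 < 1) :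
    ∫⁻ R, ENNReal.ofReal (Real.exp (c * M * sqLen R u)) ∂sketchLaw M d =
      ENNReal.ofReal (√(1 - 2 * c * ∑ i, u i ^ 2))⁻¹ ^ M := by
  have hM0 : (M : ℝ) ≠ 0 := by positivity
  let ν : Measure (Fin d → ℝ) := Measure.pi fun _ : Fin d => gaussianReal 0 ((M : ℝ≥0)⁻¹)
  let F : (Fin d → ℝ) → ℝ≥0∞ := fun r => ENNReal.ofReal (Real.exp (c * M * (r ⬝ᵥ u) ^ 2))
  have hdot : Measurable fun r : Fin d → ℝ => r ⬝ᵥ u := by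
    unfold dotProduct; fun_prop
  have hF : Measurable F := by
    simp only [F]
    fun_prop
  have h1 : ∀ R : Matrix (Fin M) (Fin d) ℝ,
      ENNReal.ofReal (Real.exp (c * M * sqLen R u)) = ∏ m, F (R m) := fun R => by
    rw [sqLen, Finset.mul_sum, Real.exp_sum, ENNReal.ofReal_prod_of_nonneg
      fun _ _ => (Real.exp_pos _).le]
    rfl
  simp_rw [h1]
  have h2 : ∫⁻ r, F r ∂ν = ENNReal.ofReal (√(1 - 2 * c * ∑ i, u i ^ 2))⁻¹ := by
    have h3 : ∫⁻ x, ENNReal.ofReal (Real.exp (c * M * x ^ 2))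
        ∂(ν.map fun r => r ⬝ᵥ u) = ∫⁻ r, F r ∂ν :=
      lintegral_map (by fun_prop) hdot
    have hv : 2 * (c * M) * (((M : ℝ≥0)⁻¹ * (∑ i, u i ^ 2).toNNReal : ℝ≥0) : ℝ) =
        2 * c * ∑ i, u i ^ 2 := by
      rw [NNReal.coe_mul, Real.coe_toNNReal _ (by positivity)]
      push_cast
      field_simp
    rw [← h3, map_dotProduct_pi_gaussianReal, lintegral_exp_sq_gaussianReal _ (by rw [hv]; exact hc),
      hv]
  change ∫⁻ R : Fin M → Fin d → ℝ, ∏ m, F (R m) ∂(Measure.pi fun _ : Fin M => ν) = _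
  rw [lintegral_prod_eq_prod_lintegral_of_indepFun Finset.univ
    (fun m (R : Fin M → Fin d → ℝ) => F (R m))
    (iIndepFun_pi (μ := fun _ : Fin M => ν) (X := fun _ => F) fun _ => hF.aemeasurable)
    fun m => hF.comp (measurable_pi_apply m)]
  have h4 : ∀ m : Fin M, ∫⁻ R : Fin M → Fin d → ℝ, F (R m) ∂(Measure.pi fun _ : Fin M => ν) =
      ENNReal.ofReal (√(1 - 2 * c * ∑ i, u i ^ 2))⁻¹ := fun m => by
    rw [← h2]
    exact (measurePreserving_eval (fun _ : Fin M => ν) m).lintegral_comp hF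
  simp [h4]

lemma inv_sqrt_half_le : (√(1 / 2 : ℝ))⁻¹ ≤ Real.exp 1 := by
  have h1 : (1 / 2 : ℝ) ≤ √(1 / 2) := Real.le_sqrt_of_sq_le (by norm_num)
  have h2 := inv_anti₀ (by norm_num : (0 : ℝ) < 1 / 2) h1
  have h3 : ((1 / 2 : ℝ))⁻¹ = 2 := by norm_num
  have := Real.add_one_le_exp 1
  linarith

lemma ofReal_exp_pow (x : ℝ) (n : ℕ) :
    ENNReal.ofReal (Real.exp x) ^ n = ENNReal.ofReal (Real.exp (n * x)) := by
  rw [← ENNReal.ofReal_pow (Real.exp_pos _).le, Real.exp_nat_mul]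

/-- Weighted sums of squared column lengths exceed their mean by a constant factor with
exponentially small probability only. -/
lemma sketchLaw_weighted_sqLen_gt_le (hM : 1 ≤ M) {ι : Type*} (s : Finset ι) (w : ι → ℝ)
    (hw : ∀ i ∈ s, 0 ≤ w i) (e : ι → Fin d → ℝ) (he : ∀ i ∈ s, ∑ l, e i l ^ 2 = 1) :
    sketchLaw M d {R | 16 * ∑ i ∈ s, w i < ∑ i ∈ s, w i * sqLen R (e i)} ≤
      ENNReal.ofReal (Real.exp (-(3 * M))) := by
  set S := ∑ i ∈ s, w i with hS
  rcases (Finset.sum_nonneg hw).eq_or_lt with h0 | h0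
  · have h1 := (Finset.sum_eq_zero_iff_of_nonneg hw).1 h0.symm
    have : {R : Matrix (Fin M) (Fin d) ℝ | 16 * S < ∑ i ∈ s, w i * sqLen R (e i)} = ∅ := by
      ext R
      simp only [Set.mem_ofPred_eq, Set.mem_empty_iff_false, iff_false, not_lt]
      rw [Finset.sum_eq_zero fun i hi => by rw [h1 i hi, zero_mul], hS, ← h0]
      simp
    rw [this]
    simp
  rw [← hS] at h0
  -- Jensen bounds the exponential of the weighted mean by the weighted mean of exponentials, so no
  -- orthogonality or independence between the directions e_i is used. The rate 1/4 gives moments at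
  -- most e^M against a threshold e^{4M}.
  let X : Matrix (Fin M) (Fin d) ℝ → ℝ≥0∞ := fun R =>
    ∑ i ∈ s, ENNReal.ofReal (w i / S) * ENNReal.ofReal (Real.exp (1 / 4 * M * sqLen R (e i)))
  have hXm : Measurable X := Finset.measurable_sum _ fun i _ =>
    ((((measurable_sqLen (e i)).const_mul _).exp).ennreal_ofReal).const_mul _
  have hXint : ∫⁻ R, X R ∂sketchLaw M d ≤ ENNReal.ofReal (Real.exp M) := by
    simp only [X]
    rw [lintegral_finsetSum _ fun i _ =>
      ((((measurable_sqLen (e i)).const_mul _).exp).ennreal_ofReal).const_mul _]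
    have h1 : ∀ i ∈ s, ∫⁻ R, ENNReal.ofReal (w i / S) *
        ENNReal.ofReal (Real.exp (1 / 4 * M * sqLen R (e i))) ∂sketchLaw M d ≤
        ENNReal.ofReal (w i / S) * ENNReal.ofReal (Real.exp M) := fun i hi => by
      rw [lintegral_const_mul _ (((measurable_sqLen (e i)).const_mul _).exp).ennreal_ofReal,
        lintegral_exp_sqLen hM _ (by rw [he i hi]; norm_num), he i hi]
      gcongr
      calc _ ≤ ENNReal.ofReal (Real.exp 1) ^ M := by
            gcongr
            convert inv_sqrt_half_le using 3
            norm_num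
        _ = _ := by rw [ofReal_exp_pow, mul_one]
    refine (Finset.sum_le_sum h1).trans ?_
    rw [← Finset.sum_mul, ← ENNReal.ofReal_sum_of_nonneg fun i hi => div_nonneg (hw i hi) h0.le,
      ← Finset.sum_div, ← hS, div_self h0.ne']
    simp
  have hsub : {R : Matrix (Fin M) (Fin d) ℝ | 16 * S < ∑ i ∈ s, w i * sqLen R (e i)} ⊆
      {R | ENNReal.ofReal (Real.exp (4 * M)) ≤ X R} := fun R hR => by
    simp only [Set.mem_ofPred_eq] at hR ⊢
    have hX : X R = ENNReal.ofReal
        (∑ i ∈ s, w i / S * Real.exp (1 / 4 * M * sqLen R (e i))) := by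
      rw [ENNReal.ofReal_sum_of_nonneg fun i hi =>
        mul_nonneg (div_nonneg (hw i hi) h0.le) (Real.exp_pos _).le]
      exact Finset.sum_congr rfl fun i hi =>
        (ENNReal.ofReal_mul (div_nonneg (hw i hi) h0.le)).symm
    rw [hX]
    refine ENNReal.ofReal_le_ofReal ?_
    have hJ := convexOn_exp.map_sum_le (t := s) (w := fun i => w i / S)
      (p := fun i => 1 / 4 * M * sqLen R (e i)) (fun i hi => div_nonneg (hw i hi) h0.le)
      (by rw [← Finset.sum_div, ← hS, div_self h0.ne']) (fun _ _ => Set.mem_univ _)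
    simp only [smul_eq_mul] at hJ
    refine le_trans (Real.exp_le_exp.2 ?_) hJ
    have h2 : ∑ i ∈ s, w i / S * (1 / 4 * M * sqLen R (e i)) =
        1 / 4 * M * ((∑ i ∈ s, w i * sqLen R (e i)) / S) := by
      rw [Finset.sum_div, Finset.mul_sum]
      exact Finset.sum_congr rfl fun i _ => by ring
    rw [h2]
    have h3 : 16 ≤ (∑ i ∈ s, w i * sqLen R (e i)) / S := by
      rw [le_div_iff₀ h0]; exact hR.le
    calc (4 : ℝ) * M = 1 / 4 * M * 16 := by ring
      _ ≤ _ := by gcongr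
  refine (measure_mono hsub).trans ((meas_ge_le_lintegral_div hXm.aemeasurable (by simp [Real.exp_pos])
    (by simp)).trans ?_)
  refine (ENNReal.div_le_div_right hXint _).trans ?_
  rw [← ENNReal.ofReal_div_of_pos (Real.exp_pos _), ← Real.exp_sub]
  refine ENNReal.ofReal_le_ofReal (Real.exp_le_exp.2 ?_)
  linarith

/-! ### Extreme values of the sketch on a fixed subspace. -/

section SmallBall

variable {k : ℕ}

/-- The vector of `ℝ^d` with coordinates `u` in the family `e`. -/
def combine (e : Fin k → Fin d → ℝ) (u : EuclideanSpace ℝ (Fin k)) : Fin d → ℝ :=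
  ∑ l, u l • e l

lemma combine_add (e : Fin k → Fin d → ℝ) (u w : EuclideanSpace ℝ (Fin k)) :
    combine e (u + w) = combine e u + combine e w := by
  simp [combine, add_smul, Finset.sum_add_distrib]

lemma combine_sub (e : Fin k → Fin d → ℝ) (u w : EuclideanSpace ℝ (Fin k)) :
    combine e (u - w) = combine e u - combine e w := by
  simp [combine, sub_smul, Finset.sum_sub_distrib]

lemma combine_smul (e : Fin k → Fin d → ℝ) (c : ℝ) (u : EuclideanSpace ℝ (Fin k)) :
    combine e (c • u) = c • combine e u := by
  simp [combine, mul_smul, Finset.smul_sum]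

lemma sum_sq_combine {e : Fin k → Fin d → ℝ}
    (he : ∀ l l', e l ⬝ᵥ e l' = if l = l' then 1 else 0) (u : EuclideanSpace ℝ (Fin k)) :
    ∑ i, combine e u i ^ 2 = ‖u‖ ^ 2 := by
  have h1 : ∑ i, combine e u i ^ 2 = combine e u ⬝ᵥ combine e u := by simp [dotProduct, sq]
  rw [h1, EuclideanSpace.norm_sq_eq]
  nth_rewrite 1 [combine]
  rw [sum_dotProduct]
  refine Finset.sum_congr rfl fun l _ => ?_
  rw [combine, smul_dotProduct, dotProduct_sum]
  simp [dotProduct_smul, he, sq]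

lemma sqLen_smul (R : Matrix (Fin M) (Fin d) ℝ) (c : ℝ) (u : Fin d → ℝ) :
    sqLen R (c • u) = c ^ 2 * sqLen R u := by
  simp [sqLen, mulVec_smul, mul_pow, Finset.mul_sum]

lemma sqLen_nonneg (R : Matrix (Fin M) (Fin d) ℝ) (u : Fin d → ℝ) : 0 ≤ sqLen R u :=
  Finset.sum_nonneg fun _ _ => sq_nonneg _

lemma sqLen_parallelogram (R : Matrix (Fin M) (Fin d) ℝ) (u w : Fin d → ℝ) :
    sqLen R (u + w) + sqLen R (u - w) = 2 * sqLen R u + 2 * sqLen R w := by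
  simp only [sqLen, mulVec_add, mulVec_sub, Pi.add_apply, Pi.sub_apply]
  rw [← Finset.sum_add_distrib, Finset.mul_sum, Finset.mul_sum, ← Finset.sum_add_distrib]
  exact Finset.sum_congr rfl fun _ _ => by ring

lemma measurable_exp_sqLen_combine (e : Fin k → Fin d → ℝ) (t : ℝ) :
    Measurable fun x : Matrix (Fin M) (Fin d) ℝ × EuclideanSpace ℝ (Fin k) =>
      ENNReal.ofReal (Real.exp (t * sqLen x.1 (combine e x.2))) := by
  have hc : ∀ i, Measurable fun u : EuclideanSpace ℝ (Fin k) => combine e u i := fun i => by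
    simp only [combine, Finset.sum_apply, Pi.smul_apply, smul_eq_mul]
    fun_prop
  refine (Measurable.exp (Measurable.const_mul ?_ _)).ennreal_ofReal
  unfold sqLen mulVec dotProduct
  exact Finset.measurable_sum _ fun m _ => (Finset.measurable_sum _ fun i _ =>
    ((measurable_entry m i).comp measurable_fst).mul ((hc i).comp measurable_snd)).pow_const 2

/-- Tonelli and Markov for the average of an exponential of `|R u|²` over a set of directions. -/
lemma sketchLaw_setLIntegral_exp_ge_le (e : Fin k → Fin d → ℝ) (t : ℝ)
    {S : Set (EuclideanSpace ℝ (Fin k))} {B c : ℝ≥0∞}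
    (hB : ∀ u ∈ S, ∫⁻ R, ENNReal.ofReal (Real.exp (t * sqLen R (combine e u))) ∂sketchLaw M d ≤ B)
    (hc : c ≠ 0) (hc' : c ≠ ∞) :
    sketchLaw M d {R | c ≤ ∫⁻ u in S, ENNReal.ofReal (Real.exp (t * sqLen R (combine e u)))} ≤
      B * volume S / c := by
  have hm := measurable_exp_sqLen_combine (M := M) e t
  refine (meas_ge_le_lintegral_div hm.lintegral_prod_right'.aemeasurable hc hc').trans ?_
  refine ENNReal.div_le_div_right ?_ _
  rw [lintegral_lintegral_swap hm.aemeasurable]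
  exact (setLIntegral_mono measurable_const hB).trans_eq (setLIntegral_const _ _)

lemma volume_ball_ratio (hk : 1 ≤ k) (x y : EuclideanSpace ℝ (Fin k)) {r s : ℝ} (hr : 0 < r)
    (hs : 0 < s) :
    volume (Metric.ball x r) = ENNReal.ofReal ((r / s) ^ k) * volume (Metric.ball y s) := by
  have : NeZero k := ⟨by omega⟩
  rw [Measure.addHaar_ball _ x hr.le, Measure.addHaar_ball _ y hs.le, ← mul_assoc,
    ← ENNReal.ofReal_mul (by positivity), finrank_euclideanSpace_fin, div_pow,
    div_mul_cancel₀ _ (by positivity)]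

variable {e : Fin k → Fin d → ℝ}

/-- The measure is invariant under h ↦ u + h and h ↦ u - h, so a lower bound on the symmetric sum
f(u + h) + f(u - h) passes to twice the integral. One bad point u thus forces a large integral. -/
lemma mul_volume_ball_le_setLIntegral {E : Type*} [NormedAddCommGroup E] [MeasurableSpace E]
    [BorelSpace E] {μ : Measure E} [μ.IsAddHaarMeasure]
    [μ.IsNegInvariant] {f : E → ℝ≥0∞} (hf : Measurable f) {u : E}
    {r ρ : ℝ} (hr : ‖u‖ + r ≤ ρ) {a : ℝ≥0∞} (ha : ∀ h, ‖h‖ < r → a ≤ f (u + h) + f (u - h)) :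
    a * μ (Metric.ball 0 r) ≤ 2 * ∫⁻ w in Metric.ball 0 ρ, f w ∂μ := by
  set g : E → ℝ≥0∞ := (Metric.ball 0 ρ).indicator f with hg
  have hgm : Measurable g := hf.indicator measurableSet_ball
  have h1 : ∫⁻ w in Metric.ball 0 ρ, f w ∂μ = ∫⁻ w, g w ∂μ :=
    (lintegral_indicator measurableSet_ball f).symm
  have h2 : ∀ h, (Metric.ball (0 : E) r).indicator (fun _ => a) h ≤ g (u + h) + g (u - h) :=
      fun h => by
    by_cases hh : h ∈ Metric.ball (0 : E) r
    · have hn : ‖h‖ < r := by simpa using hh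
      have hp : u + h ∈ Metric.ball (0 : E) ρ := by
        simpa using (norm_add_le u h).trans_lt (by linarith)
      have hm : u - h ∈ Metric.ball (0 : E) ρ := by
        simpa using (norm_sub_le u h).trans_lt (by linarith)
      rw [Set.indicator_of_mem hh, hg, Set.indicator_of_mem hp, Set.indicator_of_mem hm]
      exact ha h hn
    · rw [Set.indicator_of_notMem hh]
      exact bot_le
  calc a * μ (Metric.ball 0 r) = ∫⁻ h, (Metric.ball (0 : E) r).indicator (fun _ => a) h ∂μ :=
        (lintegral_indicator_const measurableSet_ball a).symm
    _ ≤ ∫⁻ h, g (u + h) + g (u - h) ∂μ := lintegral_mono h2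
    _ = ∫⁻ h, g (u + h) ∂μ + ∫⁻ h, g (u - h) ∂μ :=
        lintegral_add_left (hgm.comp (measurable_const_add u)) _
    _ = 2 * ∫⁻ w in Metric.ball 0 ρ, f w ∂μ := by
        rw [lintegral_add_left_eq_self g u, lintegral_sub_left_eq_self g u, h1, two_mul]

/-- The operator norm of the sketch on a `k`-dimensional subspace, `k ≤ M`, is bounded. -/
lemma sketchLaw_exists_sqLen_gt_le (hk : 1 ≤ k) (hkM : k ≤ M)
    (he : ∀ l l', e l ⬝ᵥ e l' = if l = l' then 1 else 0) :
    sketchLaw M d {R | ∃ u : EuclideanSpace ℝ (Fin k), ‖u‖ = 1 ∧ 112 < sqLen R (combine e u)} ≤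
      ENNReal.ofReal (Real.exp (-(3 * M))) := by
  have hM : 1 ≤ M := hk.trans hkM
  have hM1 : (1 : ℝ) ≤ M := by exact_mod_cast hM
  have hV0 : volume (Metric.ball (0 : EuclideanSpace ℝ (Fin k)) 2) ≠ 0 :=
    (Metric.measure_ball_pos _ _ (by norm_num)).ne'
  have hVt : volume (Metric.ball (0 : EuclideanSpace ℝ (Fin k)) 2) ≠ ∞ := measure_ball_lt_top.ne
  have hball : volume (Metric.ball (0 : EuclideanSpace ℝ (Fin k)) (1 / 2)) =
      ENNReal.ofReal ((1 / 2 / 2) ^ k) * volume (Metric.ball (0 : EuclideanSpace ℝ (Fin k)) 2) :=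
    volume_ball_ratio hk _ _ (by norm_num) (by norm_num)
  have hB : ∀ u ∈ Metric.ball (0 : EuclideanSpace ℝ (Fin k)) 2,
      ∫⁻ R, ENNReal.ofReal (Real.exp (1 / 16 * M * sqLen R (combine e u))) ∂sketchLaw M d ≤
        ENNReal.ofReal (Real.exp M) := fun u hu => by
    have hu2 : ‖u‖ ^ 2 ≤ 4 := by
      have : ‖u‖ < 2 := by simpa using hu
      nlinarith [norm_nonneg u]
    rw [lintegral_exp_sqLen hM _ (by rw [sum_sq_combine he]; linarith), sum_sq_combine he]
    calc _ ≤ ENNReal.ofReal (Real.exp 1) ^ M := by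
          gcongr
          refine le_trans ?_ inv_sqrt_half_le
          gcongr
          linarith
      _ = _ := by rw [ofReal_exp_pow, mul_one]
  have h := sketchLaw_setLIntegral_exp_ge_le (M := M) e (1 / 16 * M) hB
    (c := ENNReal.ofReal (Real.exp (4 * M)) * volume (Metric.ball 0 2))
    (mul_ne_zero (by simp [Real.exp_pos]) hV0) (ENNReal.mul_ne_top (by simp) hVt)
  rw [ENNReal.mul_div_mul_right _ _ hV0 hVt, ← ENNReal.ofReal_div_of_pos (Real.exp_pos _),
    ← Real.exp_sub] at h
  refine (measure_mono ?_).trans (h.trans_eq (by ring_nf))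
  rintro R ⟨u, hu, hR⟩
  rw [Set.mem_ofPred_eq]
  -- By the parallelogram law, one of u + w and u - w is as badly stretched as u, so the integrand
  -- there is at least e^{112 M/16} = e^{7M}. Volume ratio and symmetrization lose at most 2 · 4^k ≤
  -- e^{3M}, leaving e^{4M} against a mean of at most e^M.
  have h2 := mul_volume_ball_le_setLIntegral (μ := volume) (u := u) (r := 1 / 2) (ρ := 2)
    (a := ENNReal.ofReal (Real.exp (7 * M)))
    ((measurable_exp_sqLen_combine e (1 / 16 * M)).comp (measurable_prodMk_left (x := R)))
    (by rw [hu]; norm_num) fun w _ => by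
      have h3 := sqLen_parallelogram R (combine e u) (combine e w)
      have h4 := sqLen_nonneg R (combine e w)
      simp only [Function.comp, combine_add, combine_sub]
      rcases le_total 112 (sqLen R (combine e u + combine e w)) with h5 | h5
      · refine le_trans (ENNReal.ofReal_le_ofReal (Real.exp_le_exp.2 ?_)) le_self_add
        nlinarith
      · refine le_trans (ENNReal.ofReal_le_ofReal (Real.exp_le_exp.2 ?_)) le_add_self
        have : 112 ≤ sqLen R (combine e u - combine e w) := by linarith
        nlinarith
  rw [hball, ← mul_assoc, ← ENNReal.ofReal_mul (Real.exp_pos _).le] at h2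
  refine (ENNReal.mul_le_mul_iff_right two_ne_zero (by simp)).1 (le_trans ?_ h2)
  rw [← mul_assoc]
  gcongr
  rw [← ENNReal.ofReal_ofNat 2, ← ENNReal.ofReal_mul (by norm_num)]
  refine ENNReal.ofReal_le_ofReal ?_
  have h6 : (4 : ℝ) ^ k ≤ Real.exp (2 * M) := by
    have h7 : (2 : ℝ) ≤ Real.exp 1 := by linarith [Real.add_one_le_exp 1]
    calc (4 : ℝ) ^ k = (2 ^ 2) ^ k := by norm_num
      _ ≤ (Real.exp 1 ^ 2) ^ k := by gcongr
      _ ≤ (Real.exp 1 ^ 2) ^ M := pow_le_pow_right₀ (by nlinarith) hkM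
      _ = Real.exp (2 * M) := by rw [← pow_mul, ← Real.exp_nat_mul]; push_cast; ring_nf
  have h8 : 2 ≤ Real.exp M := by linarith [Real.add_one_le_exp (M : ℝ)]
  have h9 : (1 / 2 / 2 : ℝ) ^ k = ((4 : ℝ) ^ k)⁻¹ := by rw [← inv_pow]; norm_num
  rw [h9, ← div_eq_mul_inv, le_div_iff₀ (by positivity)]
  calc 2 * Real.exp (4 * M) * 4 ^ k ≤ Real.exp M * Real.exp (4 * M) * Real.exp (2 * M) := by gcongr
    _ = _ := by rw [← Real.exp_add, ← Real.exp_add]; ring_nf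

/-- The lower bound for the sketch on subspaces of small dimension. -/
noncomputable def sketchLower : ℝ := (8 * Real.exp 10)⁻¹

/-- The radius of the balls in the small ball estimate. -/
noncomputable def netRadius : ℝ := √(sketchLower / 112)

lemma sketchLower_pos : 0 < sketchLower := by unfold sketchLower; positivity

lemma netRadius_pos : 0 < netRadius := Real.sqrt_pos.2 (div_pos sketchLower_pos (by norm_num))

lemma netRadius_sq : netRadius ^ 2 = sketchLower / 112 :=
  Real.sq_sqrt (div_pos sketchLower_pos (by norm_num)).le

lemma netRadius_le : netRadius ≤ 1 / 2 := by
  refine Real.sqrt_le_iff.2 ⟨by norm_num, ?_⟩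
  have : sketchLower ≤ 1 := by
    unfold sketchLower
    refine inv_le_one_of_one_le₀ ?_
    linarith [Real.add_one_le_exp 10]
  linarith

/-- Given the upper bound, a direction that R nearly kills has a whole ball of nearly killed
neighbours, on which exp(-2 e^{10} M |R w|²) is at least e^{-M}. That ball still makes the average
over the shell at least e^{-2M}, whereas its mean is at most e^{-5M}. -/
lemma sketchLaw_exists_sqLen_lt_le (hk : 1 ≤ k) (hM : 1 ≤ M) (hkM : (2 / netRadius) ^ k ≤ Real.exp M)
    (he : ∀ l l', e l ⬝ᵥ e l' = if l = l' then 1 else 0) :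
    sketchLaw M d {R | (∀ u : EuclideanSpace ℝ (Fin k), ‖u‖ = 1 → sqLen R (combine e u) ≤ 112) ∧
      ∃ u : EuclideanSpace ℝ (Fin k), ‖u‖ = 1 ∧ sqLen R (combine e u) < sketchLower} ≤
      ENNReal.ofReal (Real.exp (-(3 * M))) := by
  have hη := netRadius_pos
  have hη2 := netRadius_le
  have hV0 : volume (Metric.ball (0 : EuclideanSpace ℝ (Fin k)) 2) ≠ 0 :=
    (Metric.measure_ball_pos _ _ (by norm_num)).ne'
  have hVt : volume (Metric.ball (0 : EuclideanSpace ℝ (Fin k)) 2) ≠ ∞ := measure_ball_lt_top.ne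
  set S : Set (EuclideanSpace ℝ (Fin k)) := Metric.ball 0 2 \ Metric.ball 0 (1 / 2) with hS
  -- Chosen so that 1 - 2 t |u|² ≥ e^{10} once |u| ≥ 1/2: every row of R then contributes a factor
  -- e^{-5}.
  set t : ℝ := -(2 * Real.exp 10) with ht
  have hB : ∀ u ∈ S,
      ∫⁻ R, ENNReal.ofReal (Real.exp (t * M * sqLen R (combine e u))) ∂sketchLaw M d ≤
        ENNReal.ofReal (Real.exp (-(5 * M))) := fun u hu => by
    have hu2 : 1 / 4 ≤ ‖u‖ ^ 2 := by
      have : 1 / 2 ≤ ‖u‖ := by simpa using hu.2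
      nlinarith
    have hpos := Real.exp_pos 10
    have h1 : Real.exp 10 ≤ 1 - 2 * t * ‖u‖ ^ 2 := by rw [ht]; nlinarith
    rw [lintegral_exp_sqLen hM _ (by rw [sum_sq_combine he]; linarith), sum_sq_combine he]
    calc _ ≤ ENNReal.ofReal (Real.exp (-5)) ^ M := by
          gcongr
          rw [Real.exp_neg]
          gcongr
          refine Real.le_sqrt_of_sq_le (le_trans (le_of_eq ?_) h1)
          rw [← Real.exp_nat_mul]; norm_num
      _ = _ := by rw [ofReal_exp_pow]; ring_nf
  have h := sketchLaw_setLIntegral_exp_ge_le (M := M) e (t * M) hB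
    (c := ENNReal.ofReal (Real.exp (-(2 * M))) * volume (Metric.ball 0 2))
    (mul_ne_zero (by simp [Real.exp_pos]) hV0) (ENNReal.mul_ne_top (by simp) hVt)
  have h' : ENNReal.ofReal (Real.exp (-(5 * M))) * volume S /
      (ENNReal.ofReal (Real.exp (-(2 * M))) * volume (Metric.ball (0 : EuclideanSpace ℝ (Fin k)) 2)) ≤
      ENNReal.ofReal (Real.exp (-(3 * M))) := by
    refine (ENNReal.div_le_div_right (mul_le_mul_right (measure_mono Set.sdiff_subset) _) _).trans ?_
    rw [ENNReal.mul_div_mul_right _ _ hV0 hVt, ← ENNReal.ofReal_div_of_pos (Real.exp_pos _),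
      ← Real.exp_sub]
    exact le_of_eq (by ring_nf)
  refine (measure_mono ?_).trans (h.trans h')
  rintro R ⟨hub, u, hu, hR⟩
  rw [Set.mem_ofPred_eq]
  have hsub : Metric.ball u netRadius ⊆ S := fun w hw => by
    rw [mem_ball_iff_norm] at hw
    have h1 := abs_norm_sub_norm_le w u
    rw [hu, abs_le] at h1
    simp only [hS, Set.mem_sdiff, mem_ball_zero_iff, not_lt]
    constructor <;> linarith [h1.1, h1.2]
  have hball := volume_ball_ratio hk u (0 : EuclideanSpace ℝ (Fin k)) hη (s := 2) (by norm_num)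
  have hbd : ∀ w : EuclideanSpace ℝ (Fin k), sqLen R (combine e w) ≤ 112 * ‖w‖ ^ 2 := fun w => by
    rcases eq_or_ne w 0 with rfl | hw
    · simp [combine, sqLen]
    · have hw0 : ‖w‖ ≠ 0 := norm_ne_zero_iff.2 hw
      have h1 := hub (‖w‖⁻¹ • w) (by rw [norm_smul, norm_inv, norm_norm, inv_mul_cancel₀ hw0])
      rw [combine_smul, sqLen_smul, inv_pow, inv_mul_le_iff₀ (by positivity)] at h1
      linarith
  have hlow : ∀ w ∈ Metric.ball u netRadius, ENNReal.ofReal (Real.exp (-M)) ≤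
      ENNReal.ofReal (Real.exp (t * M * sqLen R (combine e w))) := fun w hw => by
    rw [mem_ball_iff_norm] at hw
    refine ENNReal.ofReal_le_ofReal (Real.exp_le_exp.2 ?_)
    have h1 := sqLen_parallelogram R (combine e u) (combine e (w - u))
    have h2 := sqLen_nonneg R (combine e u - combine e (w - u))
    have h3 := hbd (w - u)
    have h4 : ‖w - u‖ ^ 2 ≤ sketchLower / 112 := by
      rw [← netRadius_sq]; gcongr
    rw [← combine_add, add_sub_cancel] at h1
    -- Dropping the difference term in the parallelogram law leaves 2 |R u|² + 2 |R(w - u)|². The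
    -- radius makes the second term at most 2 `sketchLower` too.
    have h5 : sqLen R (combine e w) ≤ 4 * sketchLower := by linarith
    have h6 : 2 * Real.exp 10 * (4 * sketchLower) = 1 := by
      unfold sketchLower; field_simp; norm_num
    have h7 : 2 * Real.exp 10 * sqLen R (combine e w) ≤ 1 := by
      rw [← h6]; gcongr
    have h8 : (M : ℝ) * (2 * Real.exp 10 * sqLen R (combine e w)) ≤ M * 1 := by gcongr
    rw [ht]
    linarith
  calc ENNReal.ofReal (Real.exp (-(2 * M))) *
        volume (Metric.ball (0 : EuclideanSpace ℝ (Fin k)) 2)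
      ≤ ENNReal.ofReal (Real.exp (-M)) * volume (Metric.ball u netRadius) := by
        rw [hball, ← mul_assoc, ← ENNReal.ofReal_mul (Real.exp_pos _).le]
        gcongr
        have h9 : Real.exp (-M) ≤ (netRadius / 2) ^ k := by
          rw [Real.exp_neg, ← inv_div, inv_pow]
          gcongr
        calc Real.exp (-(2 * M)) = Real.exp (-M) * Real.exp (-M) := by
              rw [← Real.exp_add]; ring_nf
          _ ≤ _ := by gcongr
    _ = ∫⁻ _ in Metric.ball u netRadius, ENNReal.ofReal (Real.exp (-M)) :=
        (setLIntegral_const _ _).symm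
    _ ≤ ∫⁻ w in Metric.ball u netRadius, ENNReal.ofReal (Real.exp (t * M * sqLen R (combine e w))) :=
        setLIntegral_mono' measurableSet_ball hlow
    _ ≤ _ := lintegral_mono_set hsub

/-- With overwhelming probability the sketch is bounded below on a subspace of dimension at most a
small multiple of `M`. -/
lemma sketchLaw_not_lower_le (hM : 1 ≤ M) (hkM : (2 / netRadius) ^ k ≤ Real.exp M)
    (he : ∀ l l', e l ⬝ᵥ e l' = if l = l' then 1 else 0) :
    sketchLaw M d {R | ¬ ∀ u : EuclideanSpace ℝ (Fin k),
      sketchLower * ‖u‖ ^ 2 ≤ sqLen R (combine e u)} ≤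
      2 * ENNReal.ofReal (Real.exp (-(3 * M))) := by
  rcases Nat.eq_zero_or_pos k with rfl | hk
  · have : {R : Matrix (Fin M) (Fin d) ℝ | ¬ ∀ u : EuclideanSpace ℝ (Fin 0),
        sketchLower * ‖u‖ ^ 2 ≤ sqLen R (combine e u)} = ∅ := by
      ext R
      simp only [Set.mem_ofPred_eq, Set.mem_empty_iff_false, iff_false, not_not]
      intro u
      rw [Subsingleton.elim u 0]
      simpa using sqLen_nonneg R _
    rw [this]
    simp
  -- The entropy condition already forces this, because 2 / `netRadius` ≥ 4 > e.
  have hk' : k ≤ M := by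
    have h1 : Real.exp 1 ≤ 2 / netRadius := by
      rw [le_div_iff₀ netRadius_pos]
      nlinarith [Real.exp_one_lt_d9, netRadius_le, netRadius_pos]
    have h2 : Real.exp 1 ^ k ≤ Real.exp M := (pow_le_pow_left₀ (Real.exp_pos _).le h1 k).trans hkM
    rw [← Real.exp_nat_mul, mul_one, Real.exp_le_exp] at h2
    exact_mod_cast h2
  rw [two_mul]
  refine le_trans (le_trans (measure_mono ?_) (measure_union_le _ _))
    (add_le_add (sketchLaw_exists_sqLen_gt_le hk hk' he) (sketchLaw_exists_sqLen_lt_le hk hM hkM he))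
  intro R hR
  simp only [Set.mem_ofPred_eq, Set.mem_union, not_forall, not_le] at hR ⊢
  obtain ⟨u, hu⟩ := hR
  by_cases hb : ∃ u : EuclideanSpace ℝ (Fin k), ‖u‖ = 1 ∧ 112 < sqLen R (combine e u)
  · exact Or.inl hb
  · push Not at hb
    have hu0 : ‖u‖ ≠ 0 := fun h0 => by
      rw [h0] at hu
      have := sqLen_nonneg R (combine e u)
      simp at hu
      linarith
    refine Or.inr ⟨hb, ‖u‖⁻¹ • u, by rw [norm_smul, norm_inv, norm_norm, inv_mul_cancel₀ hu0], ?_⟩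
    rw [combine_smul, sqLen_smul, inv_pow, inv_mul_lt_iff₀ (by positivity)]
    linarith

end SmallBall

end GaussianSketch

/-! ### The fourth Gaussian moment. -/

section Moments

lemma integral_pow_four_gaussianReal (v : ℝ≥0) :
    ∫ x, x ^ 4 ∂gaussianReal 0 v = 3 * (v : ℝ) ^ 2 := by
  have h := iteratedDeriv_mgf_zero (X := id) (μ := gaussianReal 0 v)
    (by rw [integrableExpSet_id_gaussianReal]; simp) 4
  simp only [Pi.pow_apply, id] at h
  rw [← h, mgf_id_gaussianReal]
  have h0 : (fun t : ℝ => Real.exp ((0 : ℝ) * t + v * t ^ 2 / 2)) =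
      fun t => Real.exp (v * t ^ 2 / 2) := by simp
  rw [h0]
  have he : ∀ t : ℝ, HasDerivAt (fun t : ℝ => Real.exp (v * t ^ 2 / 2))
      (v * t * Real.exp (v * t ^ 2 / 2)) t := fun t => by
    have := (((hasDerivAt_pow 2 t).const_mul (v : ℝ)).div_const 2).exp
    refine this.congr_deriv ?_
    push_cast
    ring
  -- Differentiation maps q · exp to (q' + q v t) · exp, so the fourth derivative at 0 is obtained
  -- by tracking polynomials only.
  have key : ∀ (q q' : ℝ → ℝ), (∀ t, HasDerivAt q (q' t) t) →
      deriv (fun t : ℝ => q t * Real.exp (v * t ^ 2 / 2)) =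
        fun t => (q' t + q t * (v * t)) * Real.exp (v * t ^ 2 / 2) := fun q q' hq => by
    ext t
    rw [((hq t).fun_mul (he t)).deriv]
    ring
  have h1 : iteratedDeriv 1 (fun t : ℝ => Real.exp (v * t ^ 2 / 2)) =
      fun t => (v * t) * Real.exp (v * t ^ 2 / 2) := by
    rw [iteratedDeriv_one]; ext t; exact (he t).deriv
  rw [iteratedDeriv_succ, iteratedDeriv_succ, iteratedDeriv_succ, h1,
    key (fun t => v * t) (fun _ => v) fun t => by
      simpa using (hasDerivAt_id t).const_mul (v : ℝ),
    key (fun t => v + v * t * (v * t)) (fun t => 2 * v ^ 2 * t) fun t => by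
      have := ((hasDerivAt_pow 2 t).const_mul ((v : ℝ) ^ 2)).const_add (v : ℝ)
      have e : (fun t : ℝ => (v : ℝ) + v * t * (v * t)) = fun t => (v : ℝ) + (v : ℝ) ^ 2 * t ^ 2 := by
        funext t
        ring
      rw [e]
      exact this.congr_deriv (by push_cast; ring),
    key (fun t => 2 * v ^ 2 * t + (v + v * t * (v * t)) * (v * t))
      (fun t => 3 * v ^ 2 + 3 * v ^ 3 * t ^ 2) fun t => by
      have := ((hasDerivAt_id' t).const_mul (3 * (v : ℝ) ^ 2)).fun_add
        ((hasDerivAt_pow 3 t).const_mul ((v : ℝ) ^ 3))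
      have e : (fun t : ℝ => 2 * (v : ℝ) ^ 2 * t + (v + v * t * (v * t)) * (v * t)) =
          fun t => 3 * (v : ℝ) ^ 2 * t + (v : ℝ) ^ 3 * t ^ 3 := by
        funext t
        ring
      rw [e]
      exact this.congr_deriv (by push_cast; ring)]
  simp

end Moments

/-! ### Moments of the Gaussian features. -/

namespace IsRegressionModel

variable {d p : ℕ} {P : Measure (EuclideanSpace ℝ (Fin d) × EuclideanSpace ℝ (Fin p))}
  {G : Matrix (Fin d) (Fin d) ℝ} {W : Matrix (Fin d) (Fin p) ℝ} {σ s : ℝ}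

lemma measurable_dot (u : Fin d → ℝ) : Measurable fun x : EuclideanSpace ℝ (Fin d) => u ⬝ᵥ x.ofLp := by
  unfold dotProduct; fun_prop

lemma map_dot (h : IsRegressionModel P G W σ s) (hG : G.PosSemidef) (u : Fin d → ℝ) :
    P.map (fun z => u ⬝ᵥ z.1.ofLp) = gaussianReal 0 (u ⬝ᵥ G *ᵥ u).toNNReal := by
  have h1 : (fun z : EuclideanSpace ℝ (Fin d) × EuclideanSpace ℝ (Fin p) => u ⬝ᵥ z.1.ofLp) =
      (innerSL ℝ (WithLp.toLp 2 u)) ∘ Prod.fst := by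
    ext z
    simp [EuclideanSpace.inner_eq_star_dotProduct, dotProduct_comm]
  rw [h1, ← Measure.map_map (by fun_prop) measurable_fst, h.gaussian_features,
    IsGaussian.map_eq_gaussianReal, ContinuousLinearMap.integral_comp_id_comm IsGaussian.integrable_id]
  congr 1
  · simp
  · have h2 := covarianceBilin_self (μ := multivariateGaussian 0 G) IsGaussian.memLp_two_id
      (WithLp.toLp 2 u)
    rw [covarianceBilin_multivariateGaussian hG] at h2
    congr 1
    exact h2.symm

lemma measurable_dot_fst (u : Fin d → ℝ) :
    Measurable fun z : EuclideanSpace ℝ (Fin d) × EuclideanSpace ℝ (Fin p) => u ⬝ᵥ z.1.ofLp :=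
  (measurable_dot u).comp measurable_fst

lemma memLp_dot (h : IsRegressionModel P G W σ s) (hG : G.PosSemidef) (u : Fin d → ℝ) {q : ℝ≥0∞}
    (hq : q ≠ ∞) : MemLp (fun z => u ⬝ᵥ z.1.ofLp) q P := by
  have h1 := memLp_id_gaussianReal' (μ := 0) (v := (u ⬝ᵥ G *ᵥ u).toNNReal) q hq
  rw [← h.map_dot hG] at h1
  exact (memLp_map_measure_iff (by fun_prop) (measurable_dot_fst u).aemeasurable).1 h1

lemma quadForm_nonneg (hG : G.PosSemidef) (u : Fin d → ℝ) : 0 ≤ u ⬝ᵥ G *ᵥ u := by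
  simpa using hG.dotProduct_mulVec_nonneg u

lemma integral_dot_sq (h : IsRegressionModel P G W σ s) (hG : G.PosSemidef) (u : Fin d → ℝ) :
    ∫ z, (u ⬝ᵥ z.1.ofLp) ^ 2 ∂P = u ⬝ᵥ G *ᵥ u := by
  have h1 := integral_map (μ := P) (measurable_dot_fst u).aemeasurable
    (f := fun x : ℝ => x ^ 2) (by fun_prop)
  rw [← h1, h.map_dot hG]
  have h2 := variance_fun_id_gaussianReal (μ := 0) (v := (u ⬝ᵥ G *ᵥ u).toNNReal)
  rw [variance_of_integral_eq_zero (by fun_prop) (by simp)] at h2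
  rw [h2, Real.coe_toNNReal _ (quadForm_nonneg hG u)]

lemma integral_dot_pow_four (h : IsRegressionModel P G W σ s) (hG : G.PosSemidef)
    (u : Fin d → ℝ) : ∫ z, (u ⬝ᵥ z.1.ofLp) ^ 4 ∂P = 3 * (u ⬝ᵥ G *ᵥ u) ^ 2 := by
  have h1 := integral_map (μ := P) (measurable_dot_fst u).aemeasurable
    (f := fun x : ℝ => x ^ 4) (by fun_prop)
  rw [← h1, h.map_dot hG, integral_pow_four_gaussianReal,
    Real.coe_toNNReal _ (quadForm_nonneg hG u)]

lemma integrable_dot_mul_dot (h : IsRegressionModel P G W σ s) (hG : G.PosSemidef)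
    (u v : Fin d → ℝ) : Integrable (fun z => (u ⬝ᵥ z.1.ofLp) * (v ⬝ᵥ z.1.ofLp)) P :=
  (h.memLp_dot hG u (q := 2) ENNReal.ofNat_ne_top).integrable_mul (h.memLp_dot hG v (q := 2) ENNReal.ofNat_ne_top)

lemma integral_dot_mul_dot (h : IsRegressionModel P G W σ s) (hG : G.PosSemidef)
    (u v : Fin d → ℝ) : ∫ z, (u ⬝ᵥ z.1.ofLp) * (v ⬝ᵥ z.1.ofLp) ∂P = u ⬝ᵥ G *ᵥ v := by
  have h1 := h.integral_dot_sq hG (u + v)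
  have hi := h.integrable_dot_mul_dot hG
  simp only [add_dotProduct, add_sq, mulVec_add, dotProduct_add] at h1
  have hu := h.integral_dot_sq hG u
  have hv := h.integral_dot_sq hG v
  have hs : v ⬝ᵥ G *ᵥ u = u ⬝ᵥ G *ᵥ v := by
    rw [dotProduct_mulVec, ← mulVec_transpose, dotProduct_comm]
    congr 2
    simpa using hG.isHermitian.eq
  have e1 : ∀ z : EuclideanSpace ℝ (Fin d) × EuclideanSpace ℝ (Fin p),
      (u ⬝ᵥ z.1.ofLp) ^ 2 + 2 * (u ⬝ᵥ z.1.ofLp) * (v ⬝ᵥ z.1.ofLp) + (v ⬝ᵥ z.1.ofLp) ^ 2 =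
        (u ⬝ᵥ z.1.ofLp) * (u ⬝ᵥ z.1.ofLp) + 2 * ((u ⬝ᵥ z.1.ofLp) * (v ⬝ᵥ z.1.ofLp)) +
          (v ⬝ᵥ z.1.ofLp) * (v ⬝ᵥ z.1.ofLp) := fun z => by ring
  simp only [sq] at hu hv
  simp_rw [e1] at h1
  rw [integral_add ((hi u u).fun_add ((hi u v).const_mul 2)) (hi v v),
    integral_add (hi u u) ((hi u v).const_mul 2), integral_const_mul, hu, hv] at h1
  linarith

lemma memLp_dot_mul_dot (h : IsRegressionModel P G W σ s) (hG : G.PosSemidef)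
    (u v : Fin d → ℝ) : MemLp (fun z => (u ⬝ᵥ z.1.ofLp) * (v ⬝ᵥ z.1.ofLp)) 2 P := by
  have : ENNReal.HolderTriple 4 4 2 := ⟨by
    rw [← two_mul, show (4 : ℝ≥0∞) = 2 * 2 by norm_num,
      ENNReal.mul_inv (Or.inl two_ne_zero) (Or.inl ENNReal.ofNat_ne_top), ← mul_assoc,
      ENNReal.mul_inv_cancel two_ne_zero ENNReal.ofNat_ne_top, one_mul]⟩
  exact (h.memLp_dot hG v (q := 4) ENNReal.ofNat_ne_top).mul'
    (h.memLp_dot hG u (q := 4) ENNReal.ofNat_ne_top)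

/-- Cauchy–Schwarz and the Gaussian fourth moment. The 3 here is the 3 multiplying the total energy
in `riskRec`. -/
lemma integral_sq_mul_sq_le (h : IsRegressionModel P G W σ s) (hG : G.PosSemidef)
    (u v : Fin d → ℝ) : ∫ z, (u ⬝ᵥ z.1.ofLp) ^ 2 * (v ⬝ᵥ z.1.ofLp) ^ 2 ∂P ≤
      3 * (u ⬝ᵥ G *ᵥ u) * (v ⬝ᵥ G *ᵥ v) := by
  have hsq : ∀ u : Fin d → ℝ, MemLp (fun z => (u ⬝ᵥ z.1.ofLp) ^ 2) (ENNReal.ofReal 2) P := fun u => by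
    simpa [sq] using h.memLp_dot_mul_dot hG u u
  have h1 := integral_mul_le_Lp_mul_Lq_of_nonneg (μ := P) Real.HolderConjugate.two_two
    (f := fun z => (u ⬝ᵥ z.1.ofLp) ^ 2) (g := fun z => (v ⬝ᵥ z.1.ofLp) ^ 2)
    (Filter.Eventually.of_forall fun _ => sq_nonneg _)
    (Filter.Eventually.of_forall fun _ => sq_nonneg _) (hsq u) (hsq v)
  have h4 : ∀ u : Fin d → ℝ, (∫ z, ((u ⬝ᵥ z.1.ofLp) ^ 2) ^ (2 : ℝ) ∂P) ^ (1 / 2 : ℝ) =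
      √3 * (u ⬝ᵥ G *ᵥ u) := fun u => by
    have : ∀ z : EuclideanSpace ℝ (Fin d) × EuclideanSpace ℝ (Fin p),
        ((u ⬝ᵥ z.1.ofLp) ^ 2) ^ (2 : ℝ) = (u ⬝ᵥ z.1.ofLp) ^ 4 := fun z => by
      rw [Real.rpow_two]; ring
    simp_rw [this]
    rw [h.integral_dot_pow_four hG, ← Real.sqrt_eq_rpow, Real.sqrt_mul (by norm_num),
      Real.sqrt_sq (quadForm_nonneg hG u)]
  rw [h4, h4] at h1
  refine h1.trans_eq ?_
  have : √3 * √3 = (3 : ℝ) := Real.mul_self_sqrt (by norm_num)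
  linear_combination (u ⬝ᵥ G *ᵥ u) * (v ⬝ᵥ G *ᵥ v) * this

end IsRegressionModel

/-! ### Label noise and moments of the stochastic gradient. -/

lemma enorm_sq_eq_ofReal {p : ℕ} (x : EuclideanSpace ℝ (Fin p)) :
    ‖x‖ₑ ^ 2 = ENNReal.ofReal (∑ c, x c ^ 2) := by
  rw [← ofReal_norm, ← ENNReal.ofReal_pow (norm_nonneg _), EuclideanSpace.norm_sq_eq]
  simp

lemma integral_sub_add {Ω : Type*} [MeasurableSpace Ω] {μ : Measure Ω} {f g k : Ω → ℝ}
    (hf : Integrable f μ) (hg : Integrable g μ) (hk : Integrable k μ) :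
    ∫ z, f z - g z + k z ∂μ = ∫ z, f z ∂μ - ∫ z, g z ∂μ + ∫ z, k z ∂μ :=
  (integral_add (f := fun z => f z - g z) (hf.sub hg) hk).trans (by rw [integral_sub hf hg])

/-- The coordinate `c` of the label noise. -/
def noise {d p : ℕ} (W : Matrix (Fin d) (Fin p) ℝ) (c : Fin p)
    (z : EuclideanSpace ℝ (Fin d) × EuclideanSpace ℝ (Fin p)) : ℝ :=
  z.2 c - Wᵀ c ⬝ᵥ z.1.ofLp

lemma measurable_noise {d p : ℕ} (W : Matrix (Fin d) (Fin p) ℝ) (c : Fin p) :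
    Measurable (noise W c) := by
  unfold noise dotProduct; fun_prop

namespace IsRegressionModel

variable {d p : ℕ} {P : Measure (EuclideanSpace ℝ (Fin d) × EuclideanSpace ℝ (Fin p))}
  {G : Matrix (Fin d) (Fin d) ℝ} {W : Matrix (Fin d) (Fin p) ℝ} {σ s : ℝ}

lemma integrable_sum_noise_sq (h : IsRegressionModel P G W σ s) :
    Integrable (fun z => ∑ c, noise W c z ^ 2) P ∧ ∫ z, ∑ c, noise W c z ^ 2 ∂P = σ ^ 2 := by
  have h1 : ∫⁻ z, ENNReal.ofReal (∑ c, noise W c z ^ 2) ∂P = ENNReal.ofReal (σ ^ 2) := by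
    rw [← h.noise_level]
    refine lintegral_congr fun z => ?_
    rw [enorm_sq_eq_ofReal]
    rfl
  have hm : AEStronglyMeasurable (fun z => ∑ c, noise W c z ^ 2) P :=
    (Finset.measurable_sum _ fun c _ => (measurable_noise W c).pow_const 2).aestronglyMeasurable
  have h0 : 0 ≤ᵐ[P] fun z => ∑ c, noise W c z ^ 2 :=
    Filter.Eventually.of_forall fun z => Finset.sum_nonneg fun _ _ => sq_nonneg _
  have hi : Integrable (fun z => ∑ c, noise W c z ^ 2) P :=
    (lintegral_ofReal_ne_top_iff_integrable hm h0).1 (by rw [h1]; simp)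
  refine ⟨hi, ?_⟩
  rw [integral_eq_lintegral_of_nonneg_ae h0 hm, h1, ENNReal.toReal_ofReal (sq_nonneg _)]

lemma memLp_noise (h : IsRegressionModel P G W σ s) (c : Fin p) : MemLp (noise W c) 2 P := by
  rw [memLp_two_iff_integrable_sq (measurable_noise W c).aestronglyMeasurable]
  refine h.integrable_sum_noise_sq.1.mono' ((measurable_noise W c).pow_const 2).aestronglyMeasurable
    (Filter.Eventually.of_forall fun z => ?_)
  rw [Real.norm_of_nonneg (sq_nonneg _)]
  exact Finset.single_le_sum (f := fun c => noise W c z ^ 2) (fun _ _ => sq_nonneg _)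
    (Finset.mem_univ c)

/-- Well-specification says that the noise has zero conditional mean given x; the factor φ(x) is
pulled out of the conditional expectation. Every cross term below vanishes by this. -/
lemma integral_mul_noise [IsProbabilityMeasure P] (h : IsRegressionModel P G W σ s)
    (hG : G.PosSemidef) {φ : EuclideanSpace ℝ (Fin d) → ℝ} (hφ : Measurable φ) (c : Fin p)
    (hi : Integrable (fun z => φ z.1 * noise W c z) P) :
    ∫ z, φ z.1 * noise W c z ∂P = 0 := by
  set m : MeasurableSpace (EuclideanSpace ℝ (Fin d) × EuclideanSpace ℝ (Fin p)) :=
    MeasurableSpace.comap Prod.fst inferInstance with hm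
  have hle : m ≤ Prod.instMeasurableSpace := measurable_fst.comap_le
  have hfst : Measurable[m] (Prod.fst : _ → EuclideanSpace ℝ (Fin d)) := comap_measurable _
  have hnoise : Integrable (noise W c) P := (h.memLp_noise c).integrable one_le_two
  have hdot : ∀ c, Integrable
      (fun z : EuclideanSpace ℝ (Fin d) × EuclideanSpace ℝ (Fin p) => Wᵀ c ⬝ᵥ z.1.ofLp) P :=
    fun c => (h.memLp_dot hG (Wᵀ c) (q := 1) ENNReal.one_ne_top).integrable le_rfl
  have hco : ∀ c, Integrable
      (fun z : EuclideanSpace ℝ (Fin d) × EuclideanSpace ℝ (Fin p) => z.2 c) P := fun c => by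
    have := ((h.memLp_noise c).integrable one_le_two).add (hdot c)
    refine this.congr (Filter.Eventually.of_forall fun z => ?_)
    simp [noise]
  have hsnd : Integrable
      (Prod.snd : EuclideanSpace ℝ (Fin d) × EuclideanSpace ℝ (Fin p) → _) P :=
    Integrable.of_eval_piLp hco
  have h1 : P[fun z => z.2 c | m] =ᵐ[P] fun z => Wᵀ c ⬝ᵥ z.1.ofLp := by
    have h2 := (EuclideanSpace.proj (𝕜 := ℝ) c).comp_condExp_comm (m := m) hsnd
    refine h2.symm.trans ?_
    filter_upwards [h.well_specified] with z hz
    simp only [Function.comp]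
    rw [hz]
    rfl
  have h3 : P[noise W c | m] =ᵐ[P] 0 := by
    have h4 : P[fun z => Wᵀ c ⬝ᵥ z.1.ofLp | m] = fun z => Wᵀ c ⬝ᵥ z.1.ofLp :=
      condExp_of_stronglyMeasurable hle ((measurable_dot (Wᵀ c)).comp hfst).stronglyMeasurable
        (hdot c)
    have h5 := condExp_sub (hco c) (hdot c) m
    refine h5.trans ?_
    filter_upwards [h1] with z hz
    rw [Pi.sub_apply, hz, h4]
    simp
  have h6 := condExp_mul_of_stronglyMeasurable_left (μ := P) (m := m) (f := fun z => φ z.1)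
    (g := noise W c) (hφ.comp hfst).stronglyMeasurable hi hnoise
  have h7 : P[(fun z => φ z.1) * noise W c | m] =ᵐ[P] 0 := by
    refine h6.trans ?_
    filter_upwards [h3] with z hz
    simp [hz]
  have h8 := integral_condExp (μ := P) (f := (fun z => φ z.1) * noise W c) hle
  rw [integral_congr_ae h7] at h8
  simpa using h8.symm

lemma integrable_sq_mul_noise_sq (h : IsRegressionModel P G W σ s) (hG : G.PosSemidef)
    (hs : 0 ≤ s) (u : Fin d → ℝ) :
    Integrable (fun z => ∑ c, ((u ⬝ᵥ z.1.ofLp) * noise W c z) ^ 2) P ∧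
      ∫ z, ∑ c, ((u ⬝ᵥ z.1.ofLp) * noise W c z) ^ 2 ∂P ≤ s * (u ⬝ᵥ G *ᵥ u) := by
  have h1 : ∫⁻ z, ENNReal.ofReal (∑ c, ((u ⬝ᵥ z.1.ofLp) * noise W c z) ^ 2) ∂P ≤
      ENNReal.ofReal (s * (u ⬝ᵥ G *ᵥ u)) := by
    refine le_trans (le_of_eq (lintegral_congr fun z => ?_)) (h.noise_covariance u)
    rw [enorm_sq_eq_ofReal, ← ENNReal.ofReal_mul (Finset.sum_nonneg fun _ _ => sq_nonneg _)]
    simp_rw [mul_pow]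
    rw [← Finset.mul_sum, mul_comm]
    rfl
  have hm : AEStronglyMeasurable (fun z => ∑ c, ((u ⬝ᵥ z.1.ofLp) * noise W c z) ^ 2) P :=
    (Finset.measurable_sum _ fun c _ =>
      ((measurable_dot_fst u).mul (measurable_noise W c)).pow_const 2).aestronglyMeasurable
  have h0 : 0 ≤ᵐ[P] fun z => ∑ c, ((u ⬝ᵥ z.1.ofLp) * noise W c z) ^ 2 :=
    Filter.Eventually.of_forall fun z => Finset.sum_nonneg fun _ _ => sq_nonneg _
  have hi := (lintegral_ofReal_ne_top_iff_integrable hm h0).1 (h1.trans_lt (by simp)).ne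
  refine ⟨hi, ?_⟩
  rw [integral_eq_lintegral_of_nonneg_ae h0 hm]
  exact ENNReal.toReal_le_of_le_ofReal (mul_nonneg hs (quadForm_nonneg hG u)) h1

lemma memLp_dot_mul_noise (h : IsRegressionModel P G W σ s) (hG : G.PosSemidef) (hs : 0 ≤ s)
    (u : Fin d → ℝ) (c : Fin p) : MemLp (fun z => (u ⬝ᵥ z.1.ofLp) * noise W c z) 2 P := by
  have hm := (measurable_dot_fst u).mul (measurable_noise W c)
  refine (memLp_two_iff_integrable_sq hm.aestronglyMeasurable).2 ?_
  refine (h.integrable_sq_mul_noise_sq hG hs u).1.mono' (hm.pow_const 2).aestronglyMeasurable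
    (Filter.Eventually.of_forall fun z => ?_)
  rw [Real.norm_of_nonneg (sq_nonneg _)]
  exact Finset.single_le_sum (f := fun c => ((u ⬝ᵥ z.1.ofLp) * noise W c z) ^ 2)
    (fun _ _ => sq_nonneg _) (Finset.mem_univ c)

variable [IsProbabilityMeasure P]

/-- The expected squared residual of a linear predictor. -/
lemma lintegral_residual_sq (h : IsRegressionModel P G W σ s) (hG : G.PosSemidef)
    (D : Fin p → Fin d → ℝ) :
    ∫⁻ z, ENNReal.ofReal (∑ c, (D c ⬝ᵥ z.1.ofLp - noise W c z) ^ 2) ∂P =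
      ENNReal.ofReal (σ ^ 2 + ∑ c, D c ⬝ᵥ G *ᵥ D c) := by
  have hD := fun c => h.memLp_dot hG (D c) (q := 2) ENNReal.ofNat_ne_top
  have hx : ∀ c, Integrable (fun z => (D c ⬝ᵥ z.1.ofLp) * noise W c z) P := fun c =>
    (hD c).integrable_mul (h.memLp_noise c)
  have hint : ∀ c, Integrable (fun z => (D c ⬝ᵥ z.1.ofLp - noise W c z) ^ 2) P := fun c =>
    ((hD c).sub (h.memLp_noise c)).integrable_sq
  rw [← ofReal_integral_eq_lintegral_ofReal (integrable_finsetSum _ fun c _ => hint c)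
    (Filter.Eventually.of_forall fun z => Finset.sum_nonneg fun _ _ => sq_nonneg _),
    integral_finsetSum _ fun c _ => hint c]
  congr 1
  have h1 : ∀ c, ∫ z, (D c ⬝ᵥ z.1.ofLp - noise W c z) ^ 2 ∂P =
      ∫ z, noise W c z ^ 2 ∂P + D c ⬝ᵥ G *ᵥ D c := fun c => by
    have e : ∀ z, (D c ⬝ᵥ z.1.ofLp - noise W c z) ^ 2 =
        (D c ⬝ᵥ z.1.ofLp) ^ 2 - 2 * ((D c ⬝ᵥ z.1.ofLp) * noise W c z) + noise W c z ^ 2 :=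
      fun z => by ring
    simp_rw [e]
    rw [integral_sub_add (hD c).integrable_sq ((hx c).const_mul 2) (h.memLp_noise c).integrable_sq,
      integral_const_mul, h.integral_mul_noise hG (measurable_dot (D c)) c (hx c),
      h.integral_dot_sq hG]
    ring
  simp_rw [h1]
  rw [Finset.sum_add_distrib, ← integral_finsetSum _ fun c _ => (h.memLp_noise c).integrable_sq,
    h.integrable_sum_noise_sq.2]

/-- First and second moments of the stochastic gradient in a fixed direction. -/
lemma gradient_moments (h : IsRegressionModel P G W σ s) (hG : G.PosSemidef) (hs : 0 ≤ s)
    (u : Fin d → ℝ) (D : Fin p → Fin d → ℝ) :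
    (∀ c, MemLp (fun z => (u ⬝ᵥ z.1.ofLp) * (D c ⬝ᵥ z.1.ofLp - noise W c z)) 2 P) ∧
    (∀ c, ∫ z, (u ⬝ᵥ z.1.ofLp) * (D c ⬝ᵥ z.1.ofLp - noise W c z) ∂P = u ⬝ᵥ G *ᵥ D c) ∧
    ∑ c, ∫ z, ((u ⬝ᵥ z.1.ofLp) * (D c ⬝ᵥ z.1.ofLp - noise W c z)) ^ 2 ∂P ≤
      (u ⬝ᵥ G *ᵥ u) * (3 * ∑ c, D c ⬝ᵥ G *ᵥ D c + s) := by
  have hA := fun c => h.memLp_dot_mul_dot hG u (D c)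
  have hB := fun c => h.memLp_dot_mul_noise hG hs u c
  have hAB : ∀ c, Integrable (fun z => ((u ⬝ᵥ z.1.ofLp) * (D c ⬝ᵥ z.1.ofLp)) *
      ((u ⬝ᵥ z.1.ofLp) * noise W c z)) P := fun c => (hA c).integrable_mul (hB c)
  refine ⟨fun c => ?_, fun c => ?_, ?_⟩
  · refine ((hA c).sub (hB c)).ae_eq (Filter.Eventually.of_forall fun z => ?_)
    simp only [Pi.sub_apply]
    ring
  · simp_rw [mul_sub]
    rw [integral_sub ((hA c).integrable one_le_two) ((hB c).integrable one_le_two),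
      h.integral_dot_mul_dot hG,
      h.integral_mul_noise hG (measurable_dot u) c ((hB c).integrable one_le_two), sub_zero]
  · have h1 : ∀ c, ∫ z, ((u ⬝ᵥ z.1.ofLp) * (D c ⬝ᵥ z.1.ofLp - noise W c z)) ^ 2 ∂P =
        ∫ z, (u ⬝ᵥ z.1.ofLp) ^ 2 * (D c ⬝ᵥ z.1.ofLp) ^ 2 ∂P +
          ∫ z, ((u ⬝ᵥ z.1.ofLp) * noise W c z) ^ 2 ∂P := fun c => by
      have e : ∀ z, ((u ⬝ᵥ z.1.ofLp) * (D c ⬝ᵥ z.1.ofLp - noise W c z)) ^ 2 =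
          ((u ⬝ᵥ z.1.ofLp) * (D c ⬝ᵥ z.1.ofLp)) ^ 2 -
            2 * (((u ⬝ᵥ z.1.ofLp) * (D c ⬝ᵥ z.1.ofLp)) * ((u ⬝ᵥ z.1.ofLp) * noise W c z)) +
            ((u ⬝ᵥ z.1.ofLp) * noise W c z) ^ 2 := fun z => by ring
      -- The cross term is quadratic in the noise-free part and linear in the noise, hence of the
      -- form φ(x) times noise.
      have e2 : ∫ z, ((u ⬝ᵥ z.1.ofLp) * (D c ⬝ᵥ z.1.ofLp)) *
          ((u ⬝ᵥ z.1.ofLp) * noise W c z) ∂P = 0 := by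
        have e3 : ∀ z, ((u ⬝ᵥ z.1.ofLp) * (D c ⬝ᵥ z.1.ofLp)) * ((u ⬝ᵥ z.1.ofLp) * noise W c z) =
            (u ⬝ᵥ z.1.ofLp) ^ 2 * (D c ⬝ᵥ z.1.ofLp) * noise W c z := fun z => by ring
        have hi := hAB c
        simp_rw [e3] at hi ⊢
        exact h.integral_mul_noise hG (φ := fun x => (u ⬝ᵥ x.ofLp) ^ 2 * (D c ⬝ᵥ x.ofLp))
          (((measurable_dot u).pow_const 2).mul (measurable_dot (D c))) c hi
      simp_rw [e]
      rw [integral_sub_add (hA c).integrable_sq ((hAB c).const_mul 2) (hB c).integrable_sq,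
        integral_const_mul, e2]
      simp_rw [mul_pow]
      ring
    simp_rw [h1]
    rw [Finset.sum_add_distrib, ← integral_finsetSum _ fun c _ => (hB c).integrable_sq, mul_add]
    refine add_le_add ?_ ((h.integrable_sq_mul_noise_sq hG hs u).2.trans_eq (mul_comm _ _))
    rw [Finset.mul_sum, Finset.mul_sum]
    exact Finset.sum_le_sum fun c _ => (h.integral_sq_mul_sq_le hG u (D c)).trans_eq (by ring)

/-- The second moment of one stochastic gradient step in a fixed direction. -/
lemma lintegral_step_sq (h : IsRegressionModel P G W σ s) (hG : G.PosSemidef) (hs : 0 ≤ s)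
    (u : Fin d → ℝ) (D : Fin p → Fin d → ℝ) (η : ℝ) (a : Fin p → ℝ) :
    ∃ Q : ℝ, ∑ c, (u ⬝ᵥ G *ᵥ D c) ^ 2 ≤ Q ∧
      Q ≤ (u ⬝ᵥ G *ᵥ u) * (3 * ∑ c, D c ⬝ᵥ G *ᵥ D c + s) ∧
      ∫⁻ z, ENNReal.ofReal (∑ c,
        (a c - η * ((u ⬝ᵥ z.1.ofLp) * (D c ⬝ᵥ z.1.ofLp - noise W c z))) ^ 2) ∂P =
        ENNReal.ofReal (∑ c, (a c ^ 2 - 2 * η * a c * (u ⬝ᵥ G *ᵥ D c)) + η ^ 2 * Q) := by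
  obtain ⟨h1, h2, h3⟩ := h.gradient_moments hG hs u D
  refine ⟨_, ?_, h3, ?_⟩
  · refine Finset.sum_le_sum fun c _ => ?_
    -- The second moment dominates the squared mean. This is all that the lower risk bound uses
    -- about the gradient noise.
    have h4 := variance_nonneg (fun z => (u ⬝ᵥ z.1.ofLp) * (D c ⬝ᵥ z.1.ofLp - noise W c z)) P
    rw [variance_eq_sub (h1 c), h2] at h4
    simpa using h4
  · have hint : ∀ c, Integrable (fun z =>
        (a c - η * ((u ⬝ᵥ z.1.ofLp) * (D c ⬝ᵥ z.1.ofLp - noise W c z))) ^ 2) P := fun c =>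
      ((memLp_const (a c)).sub ((h1 c).const_mul η)).integrable_sq
    rw [← ofReal_integral_eq_lintegral_ofReal (integrable_finsetSum _ fun c _ => hint c)
      (Filter.Eventually.of_forall fun z => Finset.sum_nonneg fun _ _ => sq_nonneg _),
      integral_finsetSum _ fun c _ => hint c, Finset.mul_sum, ← Finset.sum_add_distrib]
    congr 1
    refine Finset.sum_congr rfl fun c _ => ?_
    have e : ∀ z, (a c - η * ((u ⬝ᵥ z.1.ofLp) * (D c ⬝ᵥ z.1.ofLp - noise W c z))) ^ 2 =
        a c ^ 2 - 2 * η * a c * ((u ⬝ᵥ z.1.ofLp) * (D c ⬝ᵥ z.1.ofLp - noise W c z)) +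
          η ^ 2 * ((u ⬝ᵥ z.1.ofLp) * (D c ⬝ᵥ z.1.ofLp - noise W c z)) ^ 2 := fun z => by ring
    have hi := (h1 c).integrable one_le_two
    simp_rw [e]
    rw [integral_sub_add (integrable_const _) (hi.const_mul _) ((h1 c).integrable_sq.const_mul _),
      integral_const_mul, integral_const_mul, h2]
    simp

end IsRegressionModel

/-! ### Dynamics of the residual in adapted directions. -/

variable {d p M : ℕ}

/-- The column `c` of the residual `Rᵀ V - W`. -/
def resid (R : Matrix (Fin M) (Fin d) ℝ) (W : Matrix (Fin d) (Fin p) ℝ)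
    (V : Matrix (Fin M) (Fin p) ℝ) (c : Fin p) : Fin d → ℝ :=
  (Rᵀ * V - W)ᵀ c

/-- The squared length of `fᵀ (Rᵀ V - W)`. -/
def dirSq (R : Matrix (Fin M) (Fin d) ℝ) (W : Matrix (Fin d) (Fin p) ℝ) (f : Fin d → ℝ)
    (V : Matrix (Fin M) (Fin p) ℝ) : ℝ :=
  ∑ c, (f ⬝ᵥ resid R W V c) ^ 2

lemma dirSq_nonneg (R : Matrix (Fin M) (Fin d) ℝ) (W : Matrix (Fin d) (Fin p) ℝ) (f : Fin d → ℝ)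
    (V : Matrix (Fin M) (Fin p) ℝ) : 0 ≤ dirSq R W f V :=
  Finset.sum_nonneg fun _ _ => sq_nonneg _

lemma residual_apply (R : Matrix (Fin M) (Fin d) ℝ) (W : Matrix (Fin d) (Fin p) ℝ)
    (V : Matrix (Fin M) (Fin p) ℝ) (z : EuclideanSpace ℝ (Fin d) × EuclideanSpace ℝ (Fin p))
    (c : Fin p) :
    (act Vᵀ (act R z.1) - z.2) c = resid R W V c ⬝ᵥ z.1.ofLp - noise W c z := by
  have h1 : resid R W V c ⬝ᵥ z.1.ofLp = (Vᵀ *ᵥ (R *ᵥ z.1.ofLp)) c - Wᵀ c ⬝ᵥ z.1.ofLp := by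
    rw [mulVec_mulVec]
    have : resid R W V c = (Vᵀ * R) c - Wᵀ c := by
      ext i
      simp only [resid, transpose_apply, Matrix.sub_apply, Pi.sub_apply, mul_apply]
      simp_rw [mul_comm]
    rw [this, sub_dotProduct]
    rfl
  rw [h1, noise, PiLp.sub_apply]
  simp only [act]
  ring

lemma IsRegressionModel.sketchedRisk_eq
    {P : Measure (EuclideanSpace ℝ (Fin d) × EuclideanSpace ℝ (Fin p))} [IsProbabilityMeasure P]
    {G : Matrix (Fin d) (Fin d) ℝ} {W : Matrix (Fin d) (Fin p) ℝ} {σ s : ℝ}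
    (h : IsRegressionModel P G W σ s) (hG : G.PosSemidef) (R : Matrix (Fin M) (Fin d) ℝ)
    (V : Matrix (Fin M) (Fin p) ℝ) :
    sketchedRisk P R V =
      ENNReal.ofReal (σ ^ 2 + ∑ c, resid R W V c ⬝ᵥ G *ᵥ resid R W V c) := by
  rw [sketchedRisk, ← h.lintegral_residual_sq hG]
  refine lintegral_congr fun z => ?_
  rw [enorm_sq_eq_ofReal]
  simp_rw [residual_apply R W V z]

lemma dotProduct_resid_sgdStep (R : Matrix (Fin M) (Fin d) ℝ) (W : Matrix (Fin d) (Fin p) ℝ)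
    (V : Matrix (Fin M) (Fin p) ℝ) (η : ℝ) (f : Fin d → ℝ)
    (z : EuclideanSpace ℝ (Fin d) × EuclideanSpace ℝ (Fin p)) (c : Fin p) :
    f ⬝ᵥ resid R W (sgdStep R η V z) c = f ⬝ᵥ resid R W V c -
      η * (((Rᵀ *ᵥ (R *ᵥ f)) ⬝ᵥ z.1.ofLp) * (resid R W V c ⬝ᵥ z.1.ofLp - noise W c z)) := by
  have h1 : resid R W (sgdStep R η V z) c = resid R W V c -
      (η * (resid R W V c ⬝ᵥ z.1.ofLp - noise W c z)) • (Rᵀ *ᵥ (R *ᵥ z.1.ofLp)) := by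
    rw [← residual_apply]
    ext i
    simp only [resid, sgdStep, transpose_apply, Matrix.sub_apply, mul_apply, Matrix.smul_apply, vecMulVec_apply,
      Pi.sub_apply, Pi.smul_apply, smul_eq_mul, mulVec, dotProduct, act]
    simp_rw [mul_sub]
    rw [Finset.sum_sub_distrib, Finset.mul_sum, ← sub_add_eq_sub_sub, ← sub_add_eq_sub_sub,
      add_comm]
    congr 2
    refine Finset.sum_congr rfl fun m _ => ?_
    ring
  rw [h1, dotProduct_sub, dotProduct_smul, smul_eq_mul]
  have h2 : f ⬝ᵥ (Rᵀ *ᵥ (R *ᵥ z.1.ofLp)) = (Rᵀ *ᵥ (R *ᵥ f)) ⬝ᵥ z.1.ofLp := by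
    rw [dotProduct_mulVec, vecMul_transpose, dotProduct_mulVec, ← mulVec_transpose]
  rw [h2]
  ring

/-- Vectors `f j` with `∑ f_j f_jᵀ = G` that diagonalize the dynamics of SGD sketched by `R`. -/
structure IsSketchBasis (G : Matrix (Fin d) (Fin d) ℝ) (R : Matrix (Fin M) (Fin d) ℝ)
    (f : Fin d → Fin d → ℝ) (τ : Fin d → ℝ) : Prop where
  sum_sq : ∀ u, ∑ j, (f j ⬝ᵥ u) ^ 2 = u ⬝ᵥ G *ᵥ u
  eigen : ∀ j, G *ᵥ (Rᵀ *ᵥ (R *ᵥ f j)) = τ j • f j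
  norm_sq : ∀ j, ∑ m, (R *ᵥ f j) m ^ 2 = τ j

namespace IsSketchBasis

variable {G : Matrix (Fin d) (Fin d) ℝ} {R : Matrix (Fin M) (Fin d) ℝ}
  {f : Fin d → Fin d → ℝ} {τ : Fin d → ℝ}

lemma dotProduct_mulVec_eq (hf : IsSketchBasis G R f τ) (hG : G.PosSemidef) (j : Fin d)
    (u : Fin d → ℝ) : (Rᵀ *ᵥ (R *ᵥ f j)) ⬝ᵥ G *ᵥ u = τ j * (f j ⬝ᵥ u) := by
  have hs : Gᵀ = G := by simpa using hG.isHermitian.eq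
  rw [dotProduct_mulVec, ← mulVec_transpose, hs, hf.eigen, smul_dotProduct, smul_eq_mul]

lemma quadForm_eq (hf : IsSketchBasis G R f τ) (hG : G.PosSemidef) (j : Fin d) :
    (Rᵀ *ᵥ (R *ᵥ f j)) ⬝ᵥ G *ᵥ (Rᵀ *ᵥ (R *ᵥ f j)) = τ j ^ 2 := by
  rw [hf.dotProduct_mulVec_eq hG, dotProduct_mulVec, vecMul_transpose]
  have := hf.norm_sq j
  simp only [sq] at this ⊢
  rw [dotProduct, this]

variable {P : Measure (EuclideanSpace ℝ (Fin d) × EuclideanSpace ℝ (Fin p))}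
  [IsProbabilityMeasure P] {W : Matrix (Fin d) (Fin p) ℝ} {σ s : ℝ}

lemma sum_dirSq (hf : IsSketchBasis G R f τ) (V : Matrix (Fin M) (Fin p) ℝ) :
    ∑ j, dirSq R W (f j) V = ∑ c, resid R W V c ⬝ᵥ G *ᵥ resid R W V c := by
  simp only [dirSq]
  rw [Finset.sum_comm]
  simp_rw [hf.sum_sq]

/-- The update tests the gradient against Rᵀ R f_j, and G Rᵀ R f_j = τ_j f_j. So the mean gradient
is τ_j times the component itself, and directions interact only through the total energy in the
second moment. -/
lemma lintegral_dirSq_sgdStep (hf : IsSketchBasis G R f τ) (h : IsRegressionModel P G W σ s)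
    (hG : G.PosSemidef) (hs : 0 ≤ s) (η : ℝ) (V : Matrix (Fin M) (Fin p) ℝ) (j : Fin d) :
    ENNReal.ofReal ((1 - η * τ j) ^ 2) * ENNReal.ofReal (dirSq R W (f j) V) ≤
      ∫⁻ z, ENNReal.ofReal (dirSq R W (f j) (sgdStep R η V z)) ∂P ∧
    ∫⁻ z, ENNReal.ofReal (dirSq R W (f j) (sgdStep R η V z)) ∂P ≤
      ENNReal.ofReal ((1 - 2 * (η * τ j)) * dirSq R W (f j) V +
        (η * τ j) ^ 2 * (3 * ∑ l, dirSq R W (f l) V + s)) := by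
  obtain ⟨Q, hQ1, hQ2, hQ⟩ := h.lintegral_step_sq hG hs (Rᵀ *ᵥ (R *ᵥ f j)) (resid R W V) η
    fun c => f j ⬝ᵥ resid R W V c
  simp_rw [hf.dotProduct_mulVec_eq hG] at hQ1 hQ2 hQ
  rw [← hf.dotProduct_mulVec_eq hG, hf.quadForm_eq hG, ← hf.sum_dirSq] at hQ2
  have h1 : ∑ c, (τ j * (f j ⬝ᵥ resid R W V c)) ^ 2 = τ j ^ 2 * dirSq R W (f j) V := by
    simp only [dirSq, mul_pow, Finset.mul_sum]
  have h2 : ∑ c, ((f j ⬝ᵥ resid R W V c) ^ 2 -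
      2 * η * (f j ⬝ᵥ resid R W V c) * (τ j * (f j ⬝ᵥ resid R W V c))) =
      (1 - 2 * (η * τ j)) * dirSq R W (f j) V := by
    rw [dirSq, Finset.mul_sum]
    exact Finset.sum_congr rfl fun c _ => by ring
  rw [h1] at hQ1
  rw [h2] at hQ
  have h3 : ∫⁻ z, ENNReal.ofReal (dirSq R W (f j) (sgdStep R η V z)) ∂P =
      ENNReal.ofReal ((1 - 2 * (η * τ j)) * dirSq R W (f j) V + η ^ 2 * Q) := by
    rw [← hQ]
    simp only [dirSq, dotProduct_resid_sgdStep]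
  rw [h3, ← ENNReal.ofReal_mul (sq_nonneg _)]
  have h4 := mul_le_mul_of_nonneg_left hQ1 (sq_nonneg η)
  have h5 := mul_le_mul_of_nonneg_left hQ2 (sq_nonneg η)
  exact ⟨ENNReal.ofReal_le_ofReal (by linarith), ENNReal.ofReal_le_ofReal (by linarith)⟩

end IsSketchBasis

/-! ### Averaging over the sample sequence. -/

section Iteration

lemma measurable_matrix {Ω : Type*} [MeasurableSpace Ω] {m n : ℕ} {g : Ω → Matrix (Fin m) (Fin n) ℝ}
    (hg : ∀ i j, Measurable fun x => g x i j) : Measurable g :=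
  measurable_pi_lambda (X := fun _ : Fin m => Fin n → ℝ) g fun i =>
    measurable_pi_lambda (X := fun _ : Fin n => ℝ) _ fun j => hg i j

lemma measurable_sgdStep (R : Matrix (Fin M) (Fin d) ℝ) (η : ℝ) :
    Measurable fun x : Matrix (Fin M) (Fin p) ℝ ×
      (EuclideanSpace ℝ (Fin d) × EuclideanSpace ℝ (Fin p)) => sgdStep R η x.1 x.2 := by
  have hV : ∀ i j, Measurable fun x : Matrix (Fin M) (Fin p) ℝ ×
      (EuclideanSpace ℝ (Fin d) × EuclideanSpace ℝ (Fin p)) => x.1 i j := fun i j =>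
    (measurable_entry i j).comp measurable_fst
  have hRx : ∀ i, Measurable fun x : Matrix (Fin M) (Fin p) ℝ ×
      (EuclideanSpace ℝ (Fin d) × EuclideanSpace ℝ (Fin p)) => (R *ᵥ x.2.1.ofLp) i := fun i => by
    unfold mulVec dotProduct; fun_prop
  refine measurable_matrix fun i j => ?_
  simp only [sgdStep, Matrix.sub_apply, Matrix.smul_apply, vecMulVec_apply, smul_eq_mul, act]
  refine (hV i j).sub (((hRx i).mul ?_).const_mul η)
  refine Measurable.sub (f := fun x : Matrix (Fin M) (Fin p) ℝ ×
      (EuclideanSpace ℝ (Fin d) × EuclideanSpace ℝ (Fin p)) => (x.1ᵀ *ᵥ (R *ᵥ x.2.1.ofLp)) j)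
      (g := fun x => x.2.2 j) ?_ (by fun_prop)
  simp only [mulVec, dotProduct, transpose_apply]
  exact Finset.measurable_sum _ fun l _ => (hV l j).mul (hRx l)

lemma measurable_dirSq (R : Matrix (Fin M) (Fin d) ℝ) (W : Matrix (Fin d) (Fin p) ℝ)
    (f : Fin d → ℝ) : Measurable fun V => dirSq R W f V := by
  unfold dirSq resid dotProduct
  refine Finset.measurable_sum _ fun c _ => (Finset.measurable_sum _ fun i _ =>
    Measurable.const_mul ?_ _).pow_const 2
  simp only [transpose_apply, Matrix.sub_apply, mul_apply]
  exact (Finset.measurable_sum _ fun m _ => (measurable_entry m c).const_mul _).sub_const _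

/-- The extension of a finite sample by zero. -/
def extendZero {Z : Type*} [Zero Z] {n : ℕ} (D : Fin n → Z) (t : ℕ) : Z :=
  if h : t < n then D ⟨t, h⟩ else 0

lemma sgdIter_congr (R : Matrix (Fin M) (Fin d) ℝ) (η : ℕ → ℝ)
    {z z' : ℕ → EuclideanSpace ℝ (Fin d) × EuclideanSpace ℝ (Fin p)} {n : ℕ}
    (h : ∀ t < n, z t = z' t) : sgdIter R η z n = sgdIter R η z' n := by
  induction n with
  | zero => rfl
  | succ n ih => rw [sgdIter, sgdIter, ih fun t ht => h t (by omega), h n (by omega)]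

lemma measurable_sgdIter (R : Matrix (Fin M) (Fin d) ℝ) (η : ℕ → ℝ) {Ω : Type*} [MeasurableSpace Ω]
    {z : Ω → ℕ → EuclideanSpace ℝ (Fin d) × EuclideanSpace ℝ (Fin p)}
    (hz : ∀ t, Measurable fun ω => z ω t) (n : ℕ) : Measurable fun ω => sgdIter R η (z ω) n := by
  induction n with
  | zero => exact measurable_const
  | succ n ih => exact (measurable_sgdStep R (η n)).comp (ih.prodMk (hz n))

lemma measurable_extendZero {n : ℕ} (t : ℕ) :
    Measurable fun D : Fin n → EuclideanSpace ℝ (Fin d) × EuclideanSpace ℝ (Fin p) =>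
      extendZero D t := by
  unfold extendZero
  split_ifs with h
  · exact measurable_pi_apply _
  · exact measurable_const

variable (P : Measure (EuclideanSpace ℝ (Fin d) × EuclideanSpace ℝ (Fin p)))

/-- The mean of `F (V_n)` over the first `n` samples. -/
noncomputable def iterMean (R : Matrix (Fin M) (Fin d) ℝ) (η : ℕ → ℝ) (n : ℕ)
    (F : Matrix (Fin M) (Fin p) ℝ → ℝ≥0∞) : ℝ≥0∞ :=
  ∫⁻ D, F (sgdIter R η (extendZero D) n) ∂Measure.pi fun _ : Fin n => P

lemma iterMean_mono (R : Matrix (Fin M) (Fin d) ℝ) (η : ℕ → ℝ) (n : ℕ)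
    {F F' : Matrix (Fin M) (Fin p) ℝ → ℝ≥0∞} (h : ∀ V, F V ≤ F' V) :
    iterMean P R η n F ≤ iterMean P R η n F' :=
  lintegral_mono fun _ => h _

variable [IsProbabilityMeasure P]

/-- V_n depends on the first n samples only, so the last one is split off and integrated first by
Tonelli. This is where one-pass sampling enters. -/
lemma iterMean_succ (R : Matrix (Fin M) (Fin d) ℝ) (η : ℕ → ℝ) (n : ℕ)
    {F : Matrix (Fin M) (Fin p) ℝ → ℝ≥0∞} (hF : Measurable F) :
    iterMean P R η (n + 1) F = iterMean P R η n fun V => ∫⁻ z, F (sgdStep R (η n) V z) ∂P := by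
  let K : (EuclideanSpace ℝ (Fin d) × EuclideanSpace ℝ (Fin p)) ×
      (Fin n → EuclideanSpace ℝ (Fin d) × EuclideanSpace ℝ (Fin p)) → ℝ≥0∞ :=
    fun x => F (sgdStep R (η n) (sgdIter R η (extendZero x.2) n) x.1)
  have hK : Measurable K := hF.comp ((measurable_sgdStep R (η n)).comp
    ((measurable_sgdIter R η (fun t => (measurable_extendZero t).comp measurable_snd) n).prodMk
      measurable_fst))
  have e := measurePreserving_piFinSuccAbove (fun _ : Fin (n + 1) => P) (Fin.last n)
  have h1 : ∀ D : Fin (n + 1) → EuclideanSpace ℝ (Fin d) × EuclideanSpace ℝ (Fin p),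
      F (sgdIter R η (extendZero D) (n + 1)) =
        K (MeasurableEquiv.piFinSuccAbove (fun _ => _) (Fin.last n) D) := fun D => by
    simp only [K, sgdIter]
    congr 2
    · refine sgdIter_congr R η fun t ht => ?_
      simp only [extendZero, ht, dif_pos, show t < n + 1 by omega,
        MeasurableEquiv.piFinSuccAbove_apply, Fin.insertNthEquiv_symm_apply, Fin.removeNth,
        Fin.succAbove_last]
      rfl
    · simp [extendZero, MeasurableEquiv.piFinSuccAbove_apply, Fin.last]
  rw [iterMean]
  simp_rw [h1]
  rw [e.lintegral_comp hK, lintegral_prod_symm _ hK.aemeasurable]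
  rfl

variable {P} {G : Matrix (Fin d) (Fin d) ℝ} {R : Matrix (Fin M) (Fin d) ℝ}
  {f : Fin d → Fin d → ℝ} {τ : Fin d → ℝ} {W : Matrix (Fin d) (Fin p) ℝ} {σ s : ℝ} {η : ℕ → ℝ}

lemma measurable_dirSq_sgdIter (f : Fin d → ℝ) (n : ℕ) :
    Measurable fun D : Fin n → EuclideanSpace ℝ (Fin d) × EuclideanSpace ℝ (Fin p) =>
      ENNReal.ofReal (dirSq R W f (sgdIter R η (extendZero D) n)) :=
  ((measurable_dirSq R W f).comp (measurable_sgdIter R η measurable_extendZero n)).ennreal_ofReal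

namespace IsSketchBasis

/-- The one-step bound is affine in the energies with nonnegative coefficients, so it survives
averaging over V_n and the induction hypothesis can be inserted. -/
lemma iterMean_dirSq_le (hf : IsSketchBasis G R f τ) (h : IsRegressionModel P G W σ s)
    (hG : G.PosSemidef) (hs : 0 ≤ s) (h0 : ∀ t j, 0 ≤ 1 - 2 * (η t * τ j)) (n : ℕ) (j : Fin d) :
    iterMean P R η n (fun V => ENNReal.ofReal (dirSq R W (f j) V)) ≤
      ENNReal.ofReal (riskRec η τ s (fun j => dirSq R W (f j) 0) n j) := by
  induction n generalizing j with
  | zero => simp [iterMean, sgdIter, riskRec]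
  | succ n ih =>
    rw [iterMean_succ P R η n (measurable_dirSq R W (f j)).ennreal_ofReal]
    have hr := fun j => riskRec_nonneg h0 hs (β := fun j => dirSq R W (f j) 0)
      (fun j => dirSq_nonneg R W (f j) 0) n j
    refine (iterMean_mono P R η n fun V =>
      (hf.lintegral_dirSq_sgdStep h hG hs (η n) V j).2).trans ?_
    have e : ∀ b : Fin d → ℝ, (∀ l, 0 ≤ b l) → ENNReal.ofReal ((1 - 2 * (η n * τ j)) * b j +
        (η n * τ j) ^ 2 * (3 * ∑ l, b l + s)) =
        ENNReal.ofReal (1 - 2 * (η n * τ j)) * ENNReal.ofReal (b j) +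
          ENNReal.ofReal ((η n * τ j) ^ 2) * (3 * ∑ l, ENNReal.ofReal (b l) + ENNReal.ofReal s) :=
      fun b hb => by
        have hb' := Finset.sum_nonneg fun l (_ : l ∈ Finset.univ) => hb l
        rw [ENNReal.ofReal_add (mul_nonneg (h0 n j) (hb j)) (by positivity),
          ENNReal.ofReal_mul (h0 n j), ENNReal.ofReal_mul (sq_nonneg _),
          ENNReal.ofReal_add (by positivity) hs, ENNReal.ofReal_mul (by norm_num),
          ENNReal.ofReal_sum_of_nonneg fun l _ => hb l]
        norm_num
    rw [riskRec, e _ hr, iterMean]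
    have e' := fun V => e (fun l => dirSq R W (f l) V) fun l => dirSq_nonneg R W (f l) V
    simp_rw [e']
    have hm := fun l => measurable_dirSq_sgdIter (R := R) (W := W) (η := η) (f l) n
    rw [lintegral_add_left ((hm j).const_mul _), lintegral_const_mul _ (hm j),
      lintegral_const_mul _ (((Finset.measurable_sum _ fun l _ => hm l).const_mul _).add_const _),
      lintegral_add_right _ measurable_const,
      lintegral_const_mul _ (Finset.measurable_sum _ fun l _ => hm l),
      lintegral_finsetSum _ fun l _ => hm l, lintegral_const, measure_univ, mul_one]
    gcongr with l
    · exact ih j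
    · exact ih l

lemma le_iterMean_dirSq (hf : IsSketchBasis G R f τ) (h : IsRegressionModel P G W σ s)
    (hG : G.PosSemidef) (hs : 0 ≤ s) (n : ℕ) (j : Fin d) :
    ENNReal.ofReal (∏ t ∈ Finset.range n, (1 - η t * τ j) ^ 2) *
      ENNReal.ofReal (dirSq R W (f j) 0) ≤
      iterMean P R η n (fun V => ENNReal.ofReal (dirSq R W (f j) V)) := by
  induction n with
  | zero => simp [iterMean, sgdIter]
  | succ n ih =>
    rw [iterMean_succ P R η n (measurable_dirSq R W (f j)).ennreal_ofReal]
    refine le_trans ?_ (iterMean_mono P R η n fun V =>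
      (hf.lintegral_dirSq_sgdStep h hG hs (η n) V j).1)
    have hm := measurable_dirSq_sgdIter (R := R) (W := W) (η := η) (f j) n
    rw [Finset.prod_range_succ, mul_comm (∏ t ∈ Finset.range n, _), ENNReal.ofReal_mul (sq_nonneg _),
      mul_assoc, iterMean, lintegral_const_mul _ hm]
    gcongr
    exact ih

lemma lintegral_sketchedRisk_eq (hf : IsSketchBasis G R f τ) (h : IsRegressionModel P G W σ s)
    (hG : G.PosSemidef) (γ : ℝ) (N : ℕ) :
    ∫⁻ D, sketchedRisk P R (sgdOutput R γ D) ∂(Measure.pi fun _ : Fin N => P) =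
      ENNReal.ofReal (σ ^ 2) +
        ∑ j, iterMean P R (stepSize γ N) N (fun V => ENNReal.ofReal (dirSq R W (f j) V)) := by
  have h1 : ∀ D : Fin N → EuclideanSpace ℝ (Fin d) × EuclideanSpace ℝ (Fin p),
      sketchedRisk P R (sgdOutput R γ D) = ENNReal.ofReal (σ ^ 2) + ∑ j, ENNReal.ofReal
        (dirSq R W (f j) (sgdIter R (stepSize γ N) (extendZero D) N)) := fun D => by
    rw [h.sketchedRisk_eq hG, ← hf.sum_dirSq, ENNReal.ofReal_add (sq_nonneg _)
      (Finset.sum_nonneg fun _ _ => dirSq_nonneg _ _ _ _),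
      ENNReal.ofReal_sum_of_nonneg fun _ _ => dirSq_nonneg _ _ _ _]
    rfl
  simp_rw [h1]
  rw [lintegral_add_left measurable_const, lintegral_const, measure_univ, mul_one,
    lintegral_finsetSum _ fun j _ => measurable_dirSq_sgdIter (f j) N]
  rfl

end IsSketchBasis

end Iteration

/-! ### Averaging over the prior. -/

section Prior

variable {d p M : ℕ} {π : Measure (Matrix (Fin d) (Fin p) ℝ)}

lemma measurable_gram (i l : Fin d) :
    Measurable fun W : Matrix (Fin d) (Fin p) ℝ => (W * Wᵀ) i l := by
  simp only [mul_apply, transpose_apply]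
  exact Finset.measurable_sum _ fun c _ => (measurable_entry i c).mul (measurable_entry l c)

/-- A Bochner integral of a non-integrable function is 0, so the diagonal values 1 force
integrability there; off-diagonal entries are dominated by two diagonal ones. -/
lemma integrable_gram
    (hW : ∀ i j : Fin d, ∫ W, (W * Wᵀ) i j ∂π = (1 : Matrix (Fin d) (Fin d) ℝ) i j)
    (i l : Fin d) : Integrable (fun W : Matrix (Fin d) (Fin p) ℝ => (W * Wᵀ) i l) π := by
  have hdiag : ∀ i, Integrable (fun W : Matrix (Fin d) (Fin p) ℝ => (W * Wᵀ) i i) π := fun i => by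
    by_contra hn
    have h1 := hW i i
    rw [integral_undef hn] at h1
    simp at h1
  refine ((hdiag i).add (hdiag l)).mono' (measurable_gram i l).aestronglyMeasurable
    (Filter.Eventually.of_forall fun W => ?_)
  simp only [Pi.add_apply, mul_apply, transpose_apply, ← Finset.sum_add_distrib]
  refine (norm_sum_le _ _).trans (Finset.sum_le_sum fun c _ => ?_)
  rw [Real.norm_eq_abs, abs_le]
  constructor <;> nlinarith [sq_nonneg (W i c + W l c), sq_nonneg (W i c - W l c)]

lemma dirSq_zero (R : Matrix (Fin M) (Fin d) ℝ) (W : Matrix (Fin d) (Fin p) ℝ) (f : Fin d → ℝ) :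
    dirSq R W f 0 = ∑ i, ∑ l, f i * f l * (W * Wᵀ) i l := by
  have h1 : ∀ c, (f ⬝ᵥ resid R W 0 c) ^ 2 = ∑ i, ∑ l, f i * f l * (W i c * W l c) := fun c => by
    rw [sq, dotProduct, Finset.sum_mul_sum]
    refine Finset.sum_congr rfl fun i _ => Finset.sum_congr rfl fun l _ => ?_
    simp [resid]
    ring
  simp only [dirSq, h1, mul_apply, transpose_apply]
  rw [Finset.sum_comm]
  refine Finset.sum_congr rfl fun i _ => ?_
  rw [Finset.sum_comm]
  exact Finset.sum_congr rfl fun l _ => by rw [Finset.mul_sum]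

lemma integrable_dirSq_zero
    (hW : ∀ i j : Fin d, ∫ W, (W * Wᵀ) i j ∂π = (1 : Matrix (Fin d) (Fin d) ℝ) i j)
    (R : Matrix (Fin M) (Fin d) ℝ) (f : Fin d → ℝ) :
    Integrable (fun W => dirSq R W f 0) π ∧ ∫ W, dirSq R W f 0 ∂π = ∑ i, f i ^ 2 := by
  have hi := fun i l => (integrable_gram hW i l).const_mul (f i * f l)
  simp_rw [dirSq_zero]
  refine ⟨integrable_finsetSum _ fun i _ => integrable_finsetSum _ fun l _ => hi i l, ?_⟩
  rw [integral_finsetSum _ fun i _ => integrable_finsetSum _ fun l _ => hi i l]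
  refine Finset.sum_congr rfl fun i _ => ?_
  rw [integral_finsetSum _ fun l _ => hi i l]
  simp_rw [integral_const_mul, hW]
  simp [Matrix.one_apply, sq]

/-- The recursion is affine in its initial value, hence commutes with the prior expectation. -/
lemma integral_riskRec [IsProbabilityMeasure π] {η : ℕ → ℝ} {τ : Fin d → ℝ} {s : ℝ}
    {β : Matrix (Fin d) (Fin p) ℝ → Fin d → ℝ} (hβ : ∀ j, Integrable (fun W => β W j) π) (n : ℕ)
    (j : Fin d) : Integrable (fun W => riskRec η τ s (β W) n j) π ∧
      ∫ W, riskRec η τ s (β W) n j ∂π = riskRec η τ s (fun j => ∫ W, β W j ∂π) n j := by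
  induction n generalizing j with
  | zero => exact ⟨hβ j, rfl⟩
  | succ n ih =>
    have hS := integrable_finsetSum Finset.univ fun l _ => (ih l).1
    have h1 := (ih j).1.const_mul (1 - 2 * (η n * τ j))
    have h2 : Integrable (fun W => (η n * τ j) ^ 2 * (3 * ∑ l, riskRec η τ s (β W) n l + s)) π :=
      ((hS.const_mul 3).add (integrable_const s)).const_mul _
    refine ⟨h1.add h2, ?_⟩
    simp only [riskRec]
    rw [integral_add h1 h2, integral_const_mul, integral_const_mul,
      integral_add (hS.const_mul 3) (integrable_const s), integral_const_mul,
      integral_finsetSum _ fun l _ => (ih l).1]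
    simp [ih]

variable [IsProbabilityMeasure π]
  {P : Kernel (Matrix (Fin d) (Fin p) ℝ) (EuclideanSpace ℝ (Fin d) × EuclideanSpace ℝ (Fin p))}
  [IsMarkovKernel P] {G : Matrix (Fin d) (Fin d) ℝ} {R : Matrix (Fin M) (Fin d) ℝ}
  {f : Fin d → Fin d → ℝ} {τ : Fin d → ℝ} {σ s γ : ℝ} {N : ℕ}

lemma IsSketchBasis.le_expectedRisk (hf : IsSketchBasis G R f τ) (hG : G.PosSemidef) (hs : 0 ≤ s)
    (hW : ∀ i j : Fin d, ∫ W, (W * Wᵀ) i j ∂π = (1 : Matrix (Fin d) (Fin d) ℝ) i j)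
    (hP : ∀ᵐ W ∂π, IsRegressionModel (P W) G W σ s) :
    ENNReal.ofReal (σ ^ 2 + ∑ j, (∏ t ∈ Finset.range N, (1 - stepSize γ N t * τ j) ^ 2) *
      ∑ i, f j i ^ 2) ≤ expectedRisk π P R γ N := by
  have hβ := fun j => integrable_dirSq_zero hW R (f j)
  have hq : ∀ j, 0 ≤ ∏ t ∈ Finset.range N, (1 - stepSize γ N t * τ j) ^ 2 := fun j =>
    Finset.prod_nonneg fun _ _ => sq_nonneg _
  have hsum := integrable_finsetSum Finset.univ fun j _ =>
    (hβ j).1.const_mul (∏ t ∈ Finset.range N, (1 - stepSize γ N t * τ j) ^ 2)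
  have h1 : ∫ W, (σ ^ 2 + ∑ j, (∏ t ∈ Finset.range N, (1 - stepSize γ N t * τ j) ^ 2) *
      dirSq R W (f j) 0) ∂π = σ ^ 2 + ∑ j, (∏ t ∈ Finset.range N, (1 - stepSize γ N t * τ j) ^ 2) *
      ∑ i, f j i ^ 2 := by
    rw [integral_add (integrable_const _) hsum,
      integral_finsetSum _ fun j _ => (hβ j).1.const_mul _]
    simp [integral_const_mul, hβ]
  have hI : Integrable (fun W => σ ^ 2 +
      ∑ j, (∏ t ∈ Finset.range N, (1 - stepSize γ N t * τ j) ^ 2) * dirSq R W (f j) 0) π :=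
    (integrable_const _).add hsum
  rw [← h1, ofReal_integral_eq_lintegral_ofReal hI
    (Filter.Eventually.of_forall fun W => add_nonneg (sq_nonneg _)
      (Finset.sum_nonneg fun j _ => mul_nonneg (hq j) (dirSq_nonneg _ _ _ _))), expectedRisk]
  refine lintegral_mono_ae ?_
  filter_upwards [hP] with W hPW
  rw [hf.lintegral_sketchedRisk_eq hPW hG, ENNReal.ofReal_add (sq_nonneg _)
    (Finset.sum_nonneg fun j _ => mul_nonneg (hq j) (dirSq_nonneg _ _ _ _)),
    ENNReal.ofReal_sum_of_nonneg fun j _ => mul_nonneg (hq j) (dirSq_nonneg _ _ _ _)]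
  gcongr with j
  rw [ENNReal.ofReal_mul (hq j)]
  exact hf.le_iterMean_dirSq hPW hG hs N j

lemma IsSketchBasis.expectedRisk_le (hf : IsSketchBasis G R f τ) (hG : G.PosSemidef) (hs : 0 ≤ s)
    (h0 : ∀ t j, 0 ≤ 1 - 2 * (stepSize γ N t * τ j))
    (hW : ∀ i j : Fin d, ∫ W, (W * Wᵀ) i j ∂π = (1 : Matrix (Fin d) (Fin d) ℝ) i j)
    (hP : ∀ᵐ W ∂π, IsRegressionModel (P W) G W σ s) :
    expectedRisk π P R γ N ≤
      ENNReal.ofReal (σ ^ 2 + ∑ j, riskRec (stepSize γ N) τ s (fun j => ∑ i, f j i ^ 2) N j) := by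
  have hβ := fun j => integrable_dirSq_zero hW R (f j)
  have hr := fun j => integral_riskRec (η := stepSize γ N) (τ := τ) (s := s)
    (β := fun W j => dirSq R W (f j) 0) (fun j => (hβ j).1) N j
  have hr0 := fun W : Matrix (Fin d) (Fin p) ℝ => riskRec_nonneg h0 hs
    (β := fun j => dirSq R W (f j) 0) (fun j => dirSq_nonneg R W (f j) 0) N
  have hsum := integrable_finsetSum Finset.univ fun j _ => (hr j).1
  have h1 : ∫ W, (σ ^ 2 + ∑ j, riskRec (stepSize γ N) τ s (fun j => dirSq R W (f j) 0) N j) ∂π =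
      σ ^ 2 + ∑ j, riskRec (stepSize γ N) τ s (fun j => ∑ i, f j i ^ 2) N j := by
    rw [integral_add (integrable_const _) hsum, integral_finsetSum _ fun j _ => (hr j).1]
    simp [hr, hβ]
  have hI : Integrable (fun W => σ ^ 2 +
      ∑ j, riskRec (stepSize γ N) τ s (fun j => dirSq R W (f j) 0) N j) π :=
    (integrable_const _).add hsum
  rw [← h1, ofReal_integral_eq_lintegral_ofReal hI
    (Filter.Eventually.of_forall fun W => add_nonneg (sq_nonneg _)
      (Finset.sum_nonneg fun j _ => hr0 W j)), expectedRisk]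
  refine lintegral_mono_ae ?_
  filter_upwards [hP] with W hPW
  rw [hf.lintegral_sketchedRisk_eq hPW hG, ENNReal.ofReal_add (sq_nonneg _)
    (Finset.sum_nonneg fun j _ => hr0 W j), ENNReal.ofReal_sum_of_nonneg fun j _ => hr0 W j]
  gcongr with j
  exact hf.iterMean_dirSq_le hPW hG hs h0 N j

end Prior

/-! ### From the spectrum of G to adapted directions. -/

section SpectralBasis

variable {d M : ℕ}

/-- The eigenvectors of `G`, scaled by the square roots of the eigenvalues, as the columns of a
matrix. -/
noncomputable def scaledBasis (e : Fin d → Fin d → ℝ) (lam : Fin d → ℝ) :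
    Matrix (Fin d) (Fin d) ℝ :=
  Matrix.of fun a i => √(lam i) * e i a

lemma exists_ordered_eigenbasis {G : Matrix (Fin d) (Fin d) ℝ} (hG : G.PosSemidef) :
    ∃ e : Fin d → Fin d → ℝ, (∀ l l', e l ⬝ᵥ e l' = if l = l' then 1 else 0) ∧
      scaledBasis e (fun i => hG.isHermitian.eigenvalues₀ (Fin.cast (Fintype.card_fin d).symm i)) *
        (scaledBasis e
          (fun i => hG.isHermitian.eigenvalues₀ (Fin.cast (Fintype.card_fin d).symm i)))ᵀ = G ∧
      ∀ i, 0 ≤ hG.isHermitian.eigenvalues₀ (Fin.cast (Fintype.card_fin d).symm i) := by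
  -- The eigenbasis is indexed through an arbitrary equivalence; ι undoes it, so that index i
  -- carries the i-th eigenvalue in decreasing order.
  let ι : Fin d ≃ Fin d := (finCongr (Fintype.card_fin d).symm).trans
    (Fintype.equivOfCardEq (Fintype.card_fin _))
  have hι : ∀ i, hG.isHermitian.eigenvalues₀ (Fin.cast (Fintype.card_fin d).symm i) =
      hG.isHermitian.eigenvalues (ι i) := fun i => by
    simp [IsHermitian.eigenvalues, ι]
  let b := hG.isHermitian.eigenvectorBasis
  refine ⟨fun i => (b (ι i)).ofLp, fun l l' => ?_, ?_, fun i => ?_⟩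
  · have h1 := orthonormal_iff_ite.1 b.orthonormal (ι l') (ι l)
    rw [EuclideanSpace.inner_eq_star_dotProduct] at h1
    simpa [eq_comm] using h1
  · ext x y
    have h1 := congrFun (congrFun hG.isHermitian.spectral_theorem x) y
    rw [Unitary.conjStarAlgAut_apply] at h1
    rw [h1]
    simp only [mul_apply, scaledBasis, of_apply, transpose_apply, hι,
      diagonal_apply, mul_ite, mul_zero, Finset.sum_ite_eq', Finset.mem_univ, if_true, star_eq_conjTranspose,
      conjTranspose_apply, star_trivial, IsHermitian.eigenvectorUnitary_apply, Function.comp]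
    refine Eq.trans (Finset.sum_congr rfl fun i _ => ?_) (Equiv.sum_comp ι _)
    have h2 := Real.mul_self_sqrt (hG.eigenvalues_nonneg (ι i))
    simp only [RCLike.ofReal_real_eq_id, id]
    linear_combination (b (ι i) x * b (ι i) y) * h2
  · rw [hι]
    exact hG.eigenvalues_nonneg _

variable {e : Fin d → Fin d → ℝ} {lam : Fin d → ℝ} {G : Matrix (Fin d) (Fin d) ℝ}
  {R : Matrix (Fin M) (Fin d) ℝ} {v : Fin d → Fin d → ℝ} {τ : Fin d → ℝ}

/-- B intertwines the symmetric matrix Bᵀ Rᵀ R B with the non-symmetric G Rᵀ R, since G = B Bᵀ. -/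
lemma IsGramEigenbasis.isSketchBasis {B : Matrix (Fin d) (Fin d) ℝ} (hB : B * Bᵀ = G)
    (h : IsGramEigenbasis (R * B) v τ) : IsSketchBasis G R (fun j => B *ᵥ v j) τ where
  sum_sq u := by
    have h1 : ∀ j, (B *ᵥ v j) ⬝ᵥ u = (Bᵀ *ᵥ u) ⬝ᵥ v j := fun j => by
      rw [dotProduct_comm, dotProduct_mulVec, ← mulVec_transpose]
    simp_rw [h1]
    rw [h.parseval, ← hB, ← mulVec_mulVec, dotProduct_mulVec, ← mulVec_transpose]
    simp [dotProduct, sq]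
  eigen j := by
    have h1 := congrArg (B *ᵥ ·) (h.gram j)
    simp only [transpose_mul, mulVec_smul, ← mulVec_mulVec] at h1
    rw [← h1, ← hB, ← mulVec_mulVec]
  norm_sq j := by
    have := h.norm_sq_mulVec j
    simpa only [mulVec_mulVec] using this

lemma scaledBasis_mulVec (e : Fin d → Fin d → ℝ) (lam u : Fin d → ℝ) :
    scaledBasis e lam *ᵥ u = ∑ i, (√(lam i) * u i) • e i := by
  ext a
  simp only [scaledBasis, mulVec, dotProduct, of_apply, Finset.sum_apply, Pi.smul_apply,
    smul_eq_mul]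
  exact Finset.sum_congr rfl fun i _ => by ring

lemma sum_sq_scaledBasis_mulVec (he : ∀ l l', e l ⬝ᵥ e l' = if l = l' then 1 else 0)
    (hlam : ∀ i, 0 ≤ lam i) (u : Fin d → ℝ) :
    ∑ a, (scaledBasis e lam *ᵥ u) a ^ 2 = ∑ i, lam i * u i ^ 2 := by
  have h1 := sum_sq_combine he (WithLp.toLp 2 fun i => √(lam i) * u i)
  rw [EuclideanSpace.norm_sq_eq] at h1
  rw [scaledBasis_mulVec]
  simp only [combine] at h1
  rw [h1]
  refine Finset.sum_congr rfl fun i _ => ?_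
  rw [Real.norm_eq_abs, sq_abs, mul_pow, Real.sq_sqrt (hlam i)]

lemma colTail_scaledBasis (hlam : ∀ i, 0 ≤ lam i) (R : Matrix (Fin M) (Fin d) ℝ) (k : ℕ) :
    colTail (R * scaledBasis e lam) k = ∑ i : Fin d with k ≤ i.val, lam i * sqLen R (e i) := by
  refine Finset.sum_congr rfl fun i _ => ?_
  rw [sqLen, Finset.mul_sum]
  refine Finset.sum_congr rfl fun m _ => ?_
  have : (R * scaledBasis e lam) m i = √(lam i) * (R *ᵥ e i) m := by
    simp only [mul_apply, scaledBasis, of_apply, mulVec, dotProduct, Finset.mul_sum]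
    exact Finset.sum_congr rfl fun _ _ => by ring
  rw [this, mul_pow, Real.sq_sqrt (hlam i)]

lemma sum_castLE {X : Type*} [AddCommMonoid X] {k : ℕ} (hk : k ≤ d) {g : Fin d → X}
    (hg : ∀ i, k ≤ i.val → g i = 0) : ∑ l : Fin k, g (Fin.castLE hk l) = ∑ i, g i := by
  refine (Finset.sum_map Finset.univ (Fin.castLEEmb hk) g).symm.trans
    (Finset.sum_subset (Finset.subset_univ _) fun i _ hi => hg i ?_)
  by_contra hik
  exact hi (Finset.mem_map.2 ⟨⟨i, not_le.1 hik⟩, Finset.mem_univ _, rfl⟩)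

/-- The vector B u has coordinates √λ_i u_i in the orthonormal eigenvectors, so the small-ball
estimate on their span becomes the weighted inequality needed for the ridge bias. -/
lemma lower_bound_scaledBasis {k : ℕ} (hk : k ≤ d) (hlam : ∀ i, 0 ≤ lam i) {c : ℝ}
    (hR : ∀ w : EuclideanSpace ℝ (Fin k),
      c * ‖w‖ ^ 2 ≤ sqLen R (combine (fun l => e (Fin.castLE hk l)) w))
    (u : Fin d → ℝ) (hu : ∀ i, k ≤ i.val → u i = 0) :
    c * ∑ i, lam i * u i ^ 2 ≤ ∑ m, ((R * scaledBasis e lam) *ᵥ u) m ^ 2 := by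
  have h1 := hR (WithLp.toLp 2 fun l => √(lam (Fin.castLE hk l)) * u (Fin.castLE hk l))
  have h2 : ‖WithLp.toLp 2 fun l : Fin k => √(lam (Fin.castLE hk l)) * u (Fin.castLE hk l)‖ ^ 2 =
      ∑ i, lam i * u i ^ 2 := by
    rw [EuclideanSpace.norm_sq_eq, ← sum_castLE hk fun i hi => by rw [hu i hi]; simp]
    refine Finset.sum_congr rfl fun i _ => ?_
    rw [Real.norm_eq_abs, sq_abs, mul_pow, Real.sq_sqrt (hlam _)]
  have h3 : combine (fun l => e (Fin.castLE hk l)) (WithLp.toLp 2 fun l : Fin k =>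
      √(lam (Fin.castLE hk l)) * u (Fin.castLE hk l)) = scaledBasis e lam *ᵥ u := by
    rw [scaledBasis_mulVec, ← sum_castLE hk fun i hi => by rw [hu i hi]; simp]
    rfl
  rw [h2, h3, sqLen, mulVec_mulVec] at h1
  exact h1

end SpectralBasis

/-! ### Critical dimensions and rates. -/

section Rates

variable {a γ y : ℝ} {M N : ℕ}

lemma stageLength_eq (N : ℕ) : stageLength N = Real.log 2 * effSampleSize N := by
  rw [stageLength, effSampleSize, Real.logb, div_div_eq_mul_div]
  ring

lemma stageLength_bounds (N : ℕ) :
    effSampleSize N / 2 ≤ stageLength N ∧ stageLength N ≤ effSampleSize N := by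
  have h0 : 0 ≤ effSampleSize N := div_nonneg (Nat.cast_nonneg _) (Real.log_natCast_nonneg _)
  have h1 := Real.log_two_gt_d9
  have h2 := Real.log_two_lt_d9
  rw [stageLength_eq]
  constructor <;> nlinarith

/-- The critical dimension of the SGD dynamics. -/
noncomputable def critDim (a y : ℝ) : ℝ := y ^ (1 / a)

lemma critDim_pos (hy : 0 < y) : 0 < critDim a y := Real.rpow_pos_of_pos hy _

lemma critDim_rpow (ha : 1 < a) (hy : 0 < y) :
    critDim a y ^ (1 - a) = y ^ (-((a - 1) / a)) := by
  have : a ≠ 0 := by linarith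
  rw [critDim, ← Real.rpow_mul hy.le]
  congr 1
  field_simp
  ring

/-- The critical dimension x balances the two parts k and y k^{1-a} of the effective dimension. -/
lemma mul_critDim_rpow (ha : 1 < a) (hy : 0 < y) :
    y * critDim a y ^ (1 - a) = critDim a y := by
  have ha0 : a ≠ 0 := by linarith
  have h1 : critDim a y ^ a = y := by
    rw [critDim, ← Real.rpow_mul hy.le, one_div_mul_cancel ha0, Real.rpow_one]
  nth_rewrite 1 [← h1]
  rw [← Real.rpow_add (critDim_pos hy)]
  simp

lemma scalingRate_eq (ha : 1 < a) (hy : 0 < effSampleSize N * γ) :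
    scalingRate a γ M N = (M : ℝ) ^ (1 - a) + critDim a (effSampleSize N * γ) ^ (1 - a) := by
  rw [scalingRate, critDim_rpow ha hy]

lemma floor_add_one_rpow_le (ha : 1 < a) {x : ℝ} (hx : 0 < x) :
    ((⌊x⌋₊ : ℝ) + 1) ^ (1 - a) ≤ x ^ (1 - a) :=
  Real.rpow_le_rpow_of_nonpos hx (Nat.lt_floor_add_one x).le (by linarith)

/-- The constant relating the number of rows of the sketch to the dimension of the subspaces on
which it is bounded below. -/
noncomputable def dimFactor : ℝ := Real.log (2 / netRadius)

lemma one_le_dimFactor : 1 ≤ dimFactor := by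
  rw [dimFactor, Real.le_log_iff_exp_le (div_pos two_pos netRadius_pos), le_div_iff₀ netRadius_pos]
  nlinarith [Real.exp_one_lt_d9, netRadius_le, netRadius_pos]

/-- The number of leading directions that the sketch preserves and SGD learns. -/
noncomputable def learnedDim (a y : ℝ) (M : ℕ) : ℕ := ⌊min (M / dimFactor) (critDim a y)⌋₊

lemma learnedDim_le (a y : ℝ) (hy : 0 < y) : (learnedDim a y M : ℝ) ≤ M / dimFactor ∧
    (learnedDim a y M : ℝ) ≤ critDim a y := by
  have h1 : (0 : ℝ) ≤ min (M / dimFactor) (critDim a y) :=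
    le_min (div_nonneg (Nat.cast_nonneg _) (by linarith [one_le_dimFactor])) (critDim_pos hy).le
  have h2 := Nat.floor_le h1
  exact ⟨h2.trans (min_le_left _ _), h2.trans (min_le_right _ _)⟩

lemma learnedDim_le_self (hy : 0 < y) : learnedDim a y M ≤ M := by
  have h := (learnedDim_le a y (M := M) hy).1.trans
    (div_le_self (Nat.cast_nonneg _) one_le_dimFactor)
  exact_mod_cast h

lemma pow_learnedDim_le (hy : 0 < y) : (2 / netRadius) ^ learnedDim a y M ≤ Real.exp M := by
  have h := (learnedDim_le a y (M := M) hy).1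
  have h0 := one_le_dimFactor
  rw [le_div_iff₀ (by linarith)] at h
  have h1 : 2 / netRadius = Real.exp dimFactor :=
    (Real.exp_log (div_pos two_pos netRadius_pos)).symm
  rw [h1, ← Real.exp_nat_mul]
  exact Real.exp_le_exp.2 h

/-- As 1 - a < 0, the power of a minimum is the larger of the two powers, and so at most their sum:
this is how the two rates come to be added. -/
lemma learnedDim_add_one_rpow_le (ha : 1 < a) (hy : 0 < y) (hM : 1 ≤ M) :
    ((learnedDim a y M : ℝ) + 1) ^ (1 - a) ≤
      dimFactor ^ (a - 1) * ((M : ℝ) ^ (1 - a) + critDim a y ^ (1 - a)) := by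
  have h0 := one_le_dimFactor
  have h00 : 0 < dimFactor := by linarith
  have hM0 : (0 : ℝ) < M := by positivity
  have hx := critDim_pos (a := a) hy
  have hE : 1 ≤ dimFactor ^ (a - 1) := Real.one_le_rpow h0 (by linarith)
  have hu : 0 < (M : ℝ) / dimFactor := by positivity
  refine (floor_add_one_rpow_le ha (lt_min hu hx)).trans ?_
  have hM1 : (0 : ℝ) < (M : ℝ) ^ (1 - a) := by positivity
  have hx1 : 0 < critDim a y ^ (1 - a) := by positivity
  rcases min_choice ((M : ℝ) / dimFactor) (critDim a y) with h | h
  · rw [h, Real.div_rpow hM0.le h00.le, div_eq_mul_inv, ← Real.rpow_neg h00.le, neg_sub]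
    nlinarith
  · rw [h]
    nlinarith

end Rates

/-! ### Risk bounds for a fixed good sketch. -/

section Deterministic

variable {d M N : ℕ} {a γ T s : ℝ} {A : Matrix (Fin M) (Fin d) ℝ} {v : Fin d → Fin d → ℝ}
  {lam τ : Fin d → ℝ}

/-- The constant of the upper bound. -/
noncomputable def upperConst (a T s : ℝ) : ℝ :=
  T * dimFactor ^ (a - 1) + 2 / sketchLower * (2 + 32 * T * dimFactor ^ (a - 1)) +
    (6 * T + 4 * s) * (1296 * (1 / (48 * T))) * (1 + 16 * T)

lemma upperConst_pos (hT : 0 < T) (hs : 0 ≤ s) : 0 < upperConst a T s := by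
  have := sketchLower_pos
  have h0 : 0 < dimFactor := by linarith [one_le_dimFactor]
  unfold upperConst
  positivity

lemma IsGramEigenbasis.sum_riskRec_le (h : IsGramEigenbasis A v τ) (ha : 1 < a) (hT : 0 < T)
    (hs : 0 ≤ s) (hγ : 0 < γ) (hγT : γ ≤ 1 / (48 * T)) (hN : 2 ≤ N) (hM : 1 ≤ M)
    (hy : 0 < effSampleSize N * γ) (hlam : ∀ i, 0 ≤ lam i)
    (hT' : ∀ k : ℕ, ∑ i : Fin d with k ≤ i.val, lam i ≤ T * ((k : ℝ) + 1) ^ (1 - a))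
    (hA0 : colTail A 0 ≤ 16 * T)
    (hA1 : colTail A ⌊critDim a (effSampleSize N * γ)⌋₊ ≤
      16 * T * ((⌊critDim a (effSampleSize N * γ)⌋₊ : ℝ) + 1) ^ (1 - a))
    (hA2 : colTail A (learnedDim a (effSampleSize N * γ) M) ≤
      16 * T * ((learnedDim a (effSampleSize N * γ) M : ℝ) + 1) ^ (1 - a))
    (hlow : ∀ u : Fin d → ℝ, (∀ i, learnedDim a (effSampleSize N * γ) M ≤ i.val → u i = 0) →
      sketchLower * ∑ i, lam i * u i ^ 2 ≤ ∑ m, (A *ᵥ u) m ^ 2) :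
    ∑ j, riskRec (stepSize γ N) τ s (fun j => ∑ i, lam i * v j i ^ 2) N j ≤
      upperConst a T s * scalingRate a γ M N := by
  set y := effSampleSize N * γ with hydef
  set x := critDim a y with hxdef
  set k₂ := learnedDim a y M with hk₂
  set E := dimFactor ^ (a - 1) with hE
  have hx : 0 < x := critDim_pos hy
  have hδ := sketchLower_pos
  have hE0 : 0 < E := by
    have := one_le_dimFactor
    rw [hE]; positivity
  have hL := one_le_stageLength hN
  obtain ⟨hL1, hL2⟩ := stageLength_bounds N
  have hyx : y * x ^ (1 - a) = x := mul_critDim_rpow ha hy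
  have hM1 : (0 : ℝ) < (M : ℝ) ^ (1 - a) := by positivity
  have hx1 : 0 < x ^ (1 - a) := by positivity
  have hrate := scalingRate_eq (M := M) ha hy
  rw [← hxdef] at hrate
  have hk₂r : ((k₂ : ℝ) + 1) ^ (1 - a) ≤ E * scalingRate a γ M N := by
    rw [hrate]; exact learnedDim_add_one_rpow_le ha hy hM
  have hxr : x ^ (1 - a) ≤ scalingRate a γ M N := by rw [hrate]; linarith
  have hr0 : 0 < scalingRate a γ M N := by rw [hrate]; positivity
  have hγτ : γ * ∑ j, τ j ≤ 1 / 3 := by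
    rw [h.sum_eigenvalues]
    calc γ * colTail A 0 ≤ 1 / (48 * T) * (16 * T) :=
          mul_le_mul hγT hA0 (colTail_nonneg _ _) (by positivity)
      _ = 1 / 3 := by field_simp; norm_num
  have hβ : ∀ j, 0 ≤ ∑ i, lam i * v j i ^ 2 := fun j =>
    Finset.sum_nonneg fun i _ => mul_nonneg (hlam i) (sq_nonneg _)
  have hβsum : ∑ j, ∑ i, lam i * v j i ^ 2 ≤ T := by
    rw [Finset.sum_comm]
    simp_rw [← Finset.mul_sum, h.sum_sq, mul_one]
    have := hT' 0
    simpa using this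
  have hβ0 : 0 ≤ ∑ j, ∑ i, lam i * v j i ^ 2 := Finset.sum_nonneg fun j _ => hβ j
  refine (riskRec_stepSize_le hγ hN h.nonneg hγτ hs hβ).trans ?_
  set S := γ * stageLength N with hS
  have hS0 : 0 < S := by positivity
  have hSy : S ≤ y := by rw [hS, hydef, mul_comm]; gcongr
  have hyS : y ≤ 2 * S := by rw [hS, hydef]; nlinarith
  have hbias : ∑ j, 1 / (1 + S * τ j) * ∑ i, lam i * v j i ^ 2 ≤
      (T * E + 2 / sketchLower * (2 + 32 * T * E)) * scalingRate a γ M N := by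
    refine (h.ridge_bias_le hlam hδ hS0 k₂ hlow).trans ?_
    have h1 : (k₂ : ℝ) / S ≤ 2 * scalingRate a γ M N := by
      rw [div_le_iff₀ hS0]
      calc (k₂ : ℝ) ≤ x := (learnedDim_le a y hy).2
        _ = y * x ^ (1 - a) := hyx.symm
        _ ≤ 2 * S * scalingRate a γ M N := by gcongr
        _ = _ := by ring
    have h2 : ∑ i : Fin d with k₂ ≤ i.val, lam i ≤ T * (E * scalingRate a γ M N) :=
      (hT' k₂).trans (by gcongr)
    have h3 : colTail A k₂ ≤ 16 * T * (E * scalingRate a γ M N) := hA2.trans (by gcongr)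
    calc _ ≤ T * (E * scalingRate a γ M N) + 2 / sketchLower *
          (2 * scalingRate a γ M N + 2 * (16 * T * (E * scalingRate a γ M N))) := by gcongr
      _ = _ := by ring
  have hdim : ∑ j, S * τ j / (1 + S * τ j) ≤ (1 + 16 * T) * x := by
    refine (h.sum_effdim_le hS0.le ⌊x⌋₊).trans ?_
    have h1 : (⌊x⌋₊ : ℝ) ≤ x := Nat.floor_le hx.le
    have h2 : colTail A ⌊x⌋₊ ≤ 16 * T * x ^ (1 - a) :=
      hA1.trans (mul_le_mul_of_nonneg_left (floor_add_one_rpow_le ha hx) (by positivity))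
    have h3 : S * colTail A ⌊x⌋₊ ≤ y * (16 * T * x ^ (1 - a)) :=
      mul_le_mul hSy h2 (colTail_nonneg _ _) hy.le
    have h4 : y * (16 * T * x ^ (1 - a)) = 16 * T * x := by linear_combination 16 * T * hyx
    linarith
  have hvar : (6 * ∑ j, ∑ i, lam i * v j i ^ 2 + 4 * s) * (648 / stageLength N) *
      ∑ j, S * τ j / (1 + S * τ j) ≤
      (6 * T + 4 * s) * (1296 * (1 / (48 * T))) * (1 + 16 * T) * scalingRate a γ M N := by
    -- Since x = y x^{1-a} and y ≤ 2 γ L, the stage length cancels and the variance is of order γ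
    -- x^{1-a}, with γ bounded.
    have h1 : 648 / stageLength N * x ≤ 1296 * (1 / (48 * T)) * scalingRate a γ M N := by
      rw [div_mul_eq_mul_div, div_le_iff₀ (by linarith)]
      calc 648 * x = 648 * (y * x ^ (1 - a)) := by rw [hyx]
        _ ≤ 648 * (2 * S * scalingRate a γ M N) := by gcongr
        _ = 1296 * γ * scalingRate a γ M N * stageLength N := by rw [hS]; ring
        _ ≤ 1296 * (1 / (48 * T)) * scalingRate a γ M N * stageLength N := by gcongr
    have hdim0 : 0 ≤ ∑ j, S * τ j / (1 + S * τ j) := Finset.sum_nonneg fun j _ => by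
      have := h.nonneg j
      positivity
    calc _ ≤ (6 * T + 4 * s) * (648 / stageLength N) * ((1 + 16 * T) * x) := by gcongr
      _ = (6 * T + 4 * s) * (1 + 16 * T) * (648 / stageLength N * x) := by ring
      _ ≤ (6 * T + 4 * s) * (1 + 16 * T) * (1296 * (1 / (48 * T)) * scalingRate a γ M N) := by
          gcongr
      _ = _ := by ring
  calc _ ≤ _ := add_le_add hbias hvar
    _ = _ := by rw [upperConst]; ring

/-- The fraction of the directions that survives sketching. -/
noncomputable def shareConst (ρ : ℝ) : ℝ := min 1 (ρ - 1) / 2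

/-- The ratio of the number of learned directions to the critical dimension. -/
noncomputable def rankFactor (a T r : ℝ) : ℝ := 1 + 128 * T + (r ^ (1 / a))⁻¹

/-- The constant of the lower bound. -/
noncomputable def lowerConst (a b₁ T ρ r : ℝ) : ℝ :=
  shareConst ρ * b₁ * 2 ^ (-a) / 8 * min (2 ^ (1 - a)) (rankFactor a T r ^ (1 - a))

lemma shareConst_pos {ρ : ℝ} (hρ : 1 < ρ) : 0 < shareConst ρ :=
  div_pos (lt_min one_pos (by linarith)) two_pos

lemma lowerConst_pos {ρ b₁ r : ℝ} (hρ : 1 < ρ) (hb₁ : 0 < b₁) (hT : 0 < T) (hr : 0 < r) :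
    0 < lowerConst a b₁ T ρ r := by
  have := shareConst_pos hρ
  have h1 : 0 < rankFactor a T r := by unfold rankFactor; positivity
  unfold lowerConst
  positivity

lemma IsGramEigenbasis.le_sum_prod (h : IsGramEigenbasis A v τ) {ρ b₁ r : ℝ} (ha : 1 < a)
    (hT : 0 < T) (hρ : 1 < ρ) (hb₁ : 0 < b₁) (hr : 0 < r) (hγ : 0 < γ) (hN : 2 ≤ N) (hM : 1 ≤ M)
    (hρd : ρ * M ≤ d) (hy : r ≤ effSampleSize N * γ)
    (hlam : ∀ i : Fin d, b₁ * ((i : ℝ) + 1) ^ (-a) ≤ lam i)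
    (hA1 : colTail A ⌊critDim a (effSampleSize N * γ)⌋₊ ≤
      16 * T * ((⌊critDim a (effSampleSize N * γ)⌋₊ : ℝ) + 1) ^ (1 - a)) :
    lowerConst a b₁ T ρ r * scalingRate a γ M N ≤
      ∑ j, (∏ t ∈ Finset.range N, (1 - stepSize γ N t * τ j) ^ 2) * ∑ i, lam i * v j i ^ 2 := by
  have hy0 : 0 < effSampleSize N * γ := hr.trans_le hy
  have hrate := scalingRate_eq (M := M) ha hy0
  set y := effSampleSize N * γ with hydef
  set x := critDim a y with hxdef
  have hx : 0 < x := critDim_pos hy0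
  have hyx : y * x ^ (1 - a) = x := mul_critDim_rpow ha hy0
  obtain ⟨hL1, hL2⟩ := stageLength_bounds N
  -- The steps sum to at most 4 y, so τ_j ≤ t keeps ∑ η τ_j ≤ 1/2 and at least (1/2)² of the energy.
  set t : ℝ := 1 / (8 * y) with ht
  have ht0 : 0 < t := by positivity
  set m := (Finset.univ.filter fun j => t < τ j).card with hm
  have hmM : m ≤ M := h.card_lt_le_height ht0
  have hmx : (m : ℝ) ≤ (1 + 128 * T) * x := by
    refine (h.card_lt_le ht0 ⌊x⌋₊).trans ?_
    have h1 : (⌊x⌋₊ : ℝ) ≤ x := Nat.floor_le hx.le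
    have h2 : colTail A ⌊x⌋₊ ≤ 16 * T * x ^ (1 - a) :=
      hA1.trans (mul_le_mul_of_nonneg_left (floor_add_one_rpow_le ha hx) (by positivity))
    have h3 : t⁻¹ * colTail A ⌊x⌋₊ ≤ 8 * y * (16 * T * x ^ (1 - a)) := by
      rw [ht, one_div, inv_inv]; gcongr
    have h4 : 8 * y * (16 * T * x ^ (1 - a)) = 128 * T * x := by linear_combination 128 * T * hyx
    linarith
  have hc := shareConst_pos hρ
  have hc1 : shareConst ρ ≤ 1 / 2 := by
    unfold shareConst
    have := min_le_left 1 (ρ - 1)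
    linarith
  have hc2 : 2 * shareConst ρ ≤ ρ - 1 := by
    unfold shareConst
    have := min_le_right 1 (ρ - 1)
    linarith
  have hM0 : (1 : ℝ) ≤ M := by exact_mod_cast hM
  have hmM' : (m : ℝ) ≤ M := by exact_mod_cast hmM
  have hm0 : (0 : ℝ) ≤ m := Nat.cast_nonneg _
  have hMd : M < d := by
    have : (M : ℝ) < d := by nlinarith
    exact_mod_cast this
  have hmd : (1 : ℝ) ≤ ((d - m : ℕ) : ℝ) := by
    have : 1 ≤ d - m := by omega
    exact_mod_cast this
  have hmd' : ((d - m : ℕ) : ℝ) = d - m := Nat.cast_sub (by omega)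
  -- With c the share, d - m ≥ (ρ - 1) m ≥ 2 c m and d - m ≥ 1 ≥ 2 c; averaging gives room for n.
  -- The gap d ≥ ρ M thus leaves a number of directions proportional to m + 1.
  set n := ⌈shareConst ρ * (m + 1)⌉₊ with hn
  have hnd : m + n ≤ d := by
    have : n ≤ d - m := by
      rw [hn, Nat.ceil_le]
      rw [hmd'] at hmd ⊢
      have h1 : ρ * m ≤ ρ * M := by gcongr
      nlinarith
    omega
  have hn1 : shareConst ρ * (m + 1) ≤ n := Nat.le_ceil _
  have hn2 : (n : ℝ) < shareConst ρ * (m + 1) + 1 := Nat.ceil_lt_add_one (by positivity)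
  have hlam0 : ∀ i, 0 ≤ lam i := fun i => le_trans (by positivity) (hlam i)
  have hη : ∀ t, 0 < stepSize γ N t := fun t => stepSize_pos hγ t
  have hmain := h.le_sum_weight_mul (lam := lam)
    (q := fun j => ∏ t ∈ Finset.range N, (1 - stepSize γ N t * τ j) ^ 2) hlam0
    (fun j => Finset.prod_nonneg fun _ _ => sq_nonneg _) (t := t) (ε := 1 / 4)
    (l := b₁ * (2 * ((m : ℝ) + 1)) ^ (-a)) (by norm_num) (by positivity)
    (fun j hj => le_prod_one_sub_sq (x := fun t => stepSize γ N t * τ j)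
      (fun t => mul_nonneg (hη t).le (h.nonneg j)) (by
        rw [← Finset.sum_mul]
        calc _ ≤ 4 * (γ * stageLength N) * t :=
              mul_le_mul (sum_stepSize_le hγ.le hN) hj (h.nonneg j)
                (by have := one_le_stageLength hN; positivity)
          _ ≤ 4 * y * t := by
              gcongr
              rw [hydef, mul_comm]
              gcongr
          _ = 1 / 2 := by rw [ht]; field_simp; norm_num))
    (m := m) (n := n) le_rfl hnd fun i hi => by
      refine le_trans ?_ (hlam i)
      have h1 : ((i.val : ℝ) + 1) ≤ m + n := by exact_mod_cast hi
      have h2 : ((i.val : ℝ) + 1) ≤ 2 * (m + 1) := by nlinarith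
      have h3 : (2 * ((m : ℝ) + 1)) ^ (-a) ≤ ((i.val : ℝ) + 1) ^ (-a) :=
        Real.rpow_le_rpow_of_nonpos (by positivity) h2 (by linarith)
      gcongr
  refine le_trans ?_ hmain
  have hm1 : (0 : ℝ) < m + 1 := by positivity
  have hpow : ((m : ℝ) + 1) * (2 * ((m : ℝ) + 1)) ^ (-a) = 2 ^ (-a) * ((m : ℝ) + 1) ^ (1 - a) := by
    rw [Real.mul_rpow (by norm_num) hm1.le, sub_eq_add_neg, Real.rpow_add hm1, Real.rpow_one]
    ring
  have hH : 0 < rankFactor a T r := by unfold rankFactor; positivity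
  -- The bound y ≥ r keeps x away from 0, so the extra 1 is a multiple of x; this makes the constant
  -- depend on r.
  have hmH : (m : ℝ) + 1 ≤ rankFactor a T r * x := by
    have h1 : r ^ (1 / a) ≤ x := Real.rpow_le_rpow hr.le hy (by positivity)
    have h2 : 1 ≤ (r ^ (1 / a))⁻¹ * x := by
      rw [inv_mul_eq_div, one_le_div (by positivity)]; exact h1
    rw [rankFactor, add_mul]
    linarith
  have hr1 : 2 ^ (1 - a) * (M : ℝ) ^ (1 - a) ≤ ((m : ℝ) + 1) ^ (1 - a) := by
    rw [← Real.mul_rpow (by norm_num) (by positivity)]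
    exact Real.rpow_le_rpow_of_nonpos hm1 (by linarith) (by linarith)
  have hr2 : rankFactor a T r ^ (1 - a) * x ^ (1 - a) ≤ ((m : ℝ) + 1) ^ (1 - a) := by
    rw [← Real.mul_rpow hH.le hx.le]
    exact Real.rpow_le_rpow_of_nonpos hm1 hmH (by linarith)
  set μ := min ((2 : ℝ) ^ (1 - a)) (rankFactor a T r ^ (1 - a)) with hμ
  have hrate' : μ * scalingRate a γ M N ≤ 2 * ((m : ℝ) + 1) ^ (1 - a) := by
    rw [hrate, mul_add]
    have h1 : μ * (M : ℝ) ^ (1 - a) ≤ 2 ^ (1 - a) * (M : ℝ) ^ (1 - a) := by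
      gcongr; exact min_le_left _ _
    have h2 : μ * x ^ (1 - a) ≤ rankFactor a T r ^ (1 - a) * x ^ (1 - a) := by
      gcongr; exact min_le_right _ _
    linarith
  calc lowerConst a b₁ T ρ r * scalingRate a γ M N
      = shareConst ρ * b₁ * 2 ^ (-a) / 8 * (μ * scalingRate a γ M N) := by
        rw [lowerConst]; ring
    _ ≤ shareConst ρ * b₁ * 2 ^ (-a) / 8 * (2 * ((m : ℝ) + 1) ^ (1 - a)) := by gcongr
    _ = 1 / 4 * (shareConst ρ * (m + 1) * (b₁ * (2 * ((m : ℝ) + 1)) ^ (-a))) := by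
        linear_combination (-(1 / 4) * shareConst ρ * b₁) * hpow
    _ ≤ _ := by gcongr

end Deterministic

/-! ### The exceptional event. -/

section Probability

variable {d M : ℕ} {a T : ℝ} {e : Fin d → Fin d → ℝ} {lam : Fin d → ℝ}

lemma sketchLaw_colTail_gt_le (hM : 1 ≤ M)
    (he : ∀ l l', e l ⬝ᵥ e l' = if l = l' then 1 else 0) (hlam : ∀ i, 0 ≤ lam i)
    (hT : ∀ k : ℕ, ∑ i : Fin d with k ≤ i.val, lam i ≤ T * ((k : ℝ) + 1) ^ (1 - a)) (k : ℕ) :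
    sketchLaw M d {R | ¬ colTail (R * scaledBasis e lam) k ≤ 16 * T * ((k : ℝ) + 1) ^ (1 - a)} ≤
      ENNReal.ofReal (Real.exp (-(3 * M))) := by
  refine (measure_mono fun R hR => ?_).trans (sketchLaw_weighted_sqLen_gt_le hM
    (Finset.univ.filter fun i : Fin d => k ≤ i.val) lam (fun i _ => hlam i) e fun i _ => ?_)
  · rw [Set.mem_ofPred_eq, colTail_scaledBasis hlam, not_le] at hR
    have := hT k
    rw [Set.mem_ofPred_eq]
    linarith
  · have := he i i
    simpa [dotProduct, sq] using this

/-- Both cut-off dimensions are deterministic, so a union bound suffices: three column tails and,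
counted twice, the small-ball event. -/
lemma sketchLaw_isGood_compl_le (hM : 1 ≤ M) (hMd : M ≤ d) {y : ℝ} (hy : 0 < y)
    (he : ∀ l l', e l ⬝ᵥ e l' = if l = l' then 1 else 0) (hlam : ∀ i, 0 ≤ lam i)
    (hT : ∀ k : ℕ, ∑ i : Fin d with k ≤ i.val, lam i ≤ T * ((k : ℝ) + 1) ^ (1 - a)) :
    sketchLaw M d {R | ¬ (colTail (R * scaledBasis e lam) 0 ≤ 16 * T ∧
      colTail (R * scaledBasis e lam) ⌊critDim a y⌋₊ ≤
        16 * T * ((⌊critDim a y⌋₊ : ℝ) + 1) ^ (1 - a) ∧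
      colTail (R * scaledBasis e lam) (learnedDim a y M) ≤
        16 * T * ((learnedDim a y M : ℝ) + 1) ^ (1 - a) ∧
      ∀ u : Fin d → ℝ, (∀ i, learnedDim a y M ≤ i.val → u i = 0) →
        sketchLower * ∑ i, lam i * u i ^ 2 ≤ ∑ m, ((R * scaledBasis e lam) *ᵥ u) m ^ 2)} ≤
      5 * ENNReal.ofReal (Real.exp (-(3 * M))) := by
  have hk : learnedDim a y M ≤ d := (learnedDim_le_self hy).trans hMd
  have h0 := sketchLaw_colTail_gt_le hM he hlam hT 0
  have h1 := sketchLaw_colTail_gt_le hM he hlam hT ⌊critDim a y⌋₊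
  have h2 := sketchLaw_colTail_gt_le hM he hlam hT (learnedDim a y M)
  have h3 := sketchLaw_not_lower_le (M := M) (e := fun l => e (Fin.castLE hk l)) hM
    (pow_learnedDim_le hy) fun l l' => by rw [he]; simp
  refine (measure_mono fun R hR => ?_).trans ((measure_union_le _ _).trans
    ((add_le_add ((measure_union_le _ _).trans (add_le_add ((measure_union_le _ _).trans
      (add_le_add h0 h1)) h2)) h3).trans_eq (by ring)))
  by_contra hgood
  simp only [Set.mem_union, Set.mem_ofPred_eq, not_or, not_not] at hgood
  obtain ⟨⟨⟨g0, g1⟩, g2⟩, g3⟩ := hgood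
  exact hR ⟨by simpa using g0, g1, g2, lower_bound_scaledBasis hk hlam g3⟩

/-- Subadditivity of the outer measure avoids any measurability of the success event, and 5 ≤ e^{2M}
absorbs the constant. -/
lemma one_sub_exp_le_measureReal {Ω : Type*} {_ : MeasurableSpace Ω} {μ : Measure Ω}
    [IsProbabilityMeasure μ] {S B : Set Ω} (hM : 1 ≤ M) (hSB : ∀ ω, ω ∉ B → ω ∈ S)
    (hB : μ B ≤ 5 * ENNReal.ofReal (Real.exp (-(3 * M)))) :
    1 - Real.exp (-(1 * M)) ≤ μ.real S := by
  have hreal : μ.real B ≤ 5 * Real.exp (-(3 * M)) := by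
    rw [measureReal_def]
    refine (ENNReal.toReal_mono (by finiteness) hB).trans_eq ?_
    rw [ENNReal.toReal_mul, ENNReal.toReal_ofReal (Real.exp_pos _).le]
    norm_num
  have hun : 1 ≤ μ.real S + μ.real B := by
    refine le_trans ?_ (measureReal_union_le S B)
    rw [show S ∪ B = Set.univ from Set.eq_univ_of_forall fun ω => by
      by_cases h : ω ∈ B
      · exact Or.inr h
      · exact Or.inl (hSB ω h)]
    simp
  have hexp : 5 * Real.exp (-(3 * M)) ≤ Real.exp (-(1 * M)) := by
    have hM0 : (1 : ℝ) ≤ M := by exact_mod_cast hM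
    have h1 : Real.exp (-(1 * M)) = Real.exp (2 * M) * Real.exp (-(3 * M)) := by
      rw [← Real.exp_add]; ring_nf
    have h2 : Real.exp 1 * Real.exp 1 ≤ Real.exp (2 * M) := by
      rw [← Real.exp_add]; exact Real.exp_le_exp.2 (by linarith)
    rw [h1]
    have := Real.exp_one_gt_d9
    gcongr
    nlinarith
  linarith

end Probability

/-! ### Tail constant and assembly of the theorem. -/

/-- The constant in the tail bound `∑_{i ≥ k} λ_i ≤ T (k + 1)^{1 - a}`. -/
noncomputable def tailConst (a b₂ : ℝ) : ℝ := b₂ * (2 ^ a / (a - 1))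

lemma tailConst_pos {a b₂ : ℝ} (ha : 1 < a) (hb₂ : 0 < b₂) : 0 < tailConst a b₂ := by
  have : 0 < a - 1 := by linarith
  unfold tailConst
  positivity

lemma sum_tail_le_tailConst {d : ℕ} {a b₂ : ℝ} {lam : Fin d → ℝ} (ha : 1 < a) (hb₂ : 0 < b₂)
    (hlam : ∀ i : Fin d, lam i ≤ b₂ * ((i : ℝ) + 1) ^ (-a)) (k : ℕ) :
    ∑ i : Fin d with k ≤ i.val, lam i ≤ tailConst a b₂ * ((k : ℝ) + 1) ^ (1 - a) :=
  calc ∑ i : Fin d with k ≤ i.val, lam i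
      ≤ ∑ i : Fin d with k ≤ i.val, b₂ * ((i : ℝ) + 1) ^ (-a) :=
        Finset.sum_le_sum fun i _ => hlam i
    _ ≤ b₂ * (2 ^ a / (a - 1) * ((k : ℝ) + 1) ^ (1 - a)) := by
        rw [← Finset.mul_sum]
        exact mul_le_mul_of_nonneg_left (sum_tail_rpow_le ha d k) hb₂.le
    _ = _ := by rw [tailConst, mul_assoc]

end SketchedRegression

open SketchedRegression

theorem mainTheorem1 (a b₁ b₂ : ℝ) (ha : 1 < a) (hb₁ : 0 < b₁) (hb₂ : b₁ ≤ b₂) :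
    ∃ c : ℝ, 0 < c ∧ ∀ ρ : ℝ, 1 < ρ → ∃ κ : ℝ, 0 < κ ∧ ∀ s r : ℝ, 0 < s → 0 < r →
      ∃ C₁ C₂ : ℝ, 0 < C₁ ∧ 0 < C₂ ∧
        ∀ (d p M N : ℕ) (G : Matrix (Fin d) (Fin d) ℝ) (hG : G.PosSemidef)
          (π : MeasureTheory.Measure (Matrix (Fin d) (Fin p) ℝ))
          (P : ProbabilityTheory.Kernel (Matrix (Fin d) (Fin p) ℝ)
            (EuclideanSpace ℝ (Fin d) × EuclideanSpace ℝ (Fin p)))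
          (σ γ : ℝ),
          MeasureTheory.IsProbabilityMeasure π → ProbabilityTheory.IsMarkovKernel P →
          1 ≤ M → ρ * M ≤ d → 2 ≤ N →
          γ ≤ c → r ≤ SketchedRegression.effSampleSize N * γ →
          SketchedRegression.HasPowerLawSpectrum hG a b₁ b₂ →
          (∀ i j : Fin d, ∫ W, (W * Wᵀ) i j ∂π = (1 : Matrix (Fin d) (Fin d) ℝ) i j) →
          (∀ᵐ W ∂π, SketchedRegression.IsRegressionModel (P W) G W σ s) →
          1 - Real.exp (-(κ * M)) ≤
            (SketchedRegression.sketchLaw M d).real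
              {R | ENNReal.ofReal (σ ^ 2 + C₁ * SketchedRegression.scalingRate a γ M N) ≤
                    SketchedRegression.expectedRisk π P R γ N ∧
                  SketchedRegression.expectedRisk π P R γ N ≤
                    ENNReal.ofReal (σ ^ 2 + C₂ * SketchedRegression.scalingRate a γ M N)} := by
  have hb₂0 : 0 < b₂ := hb₁.trans_le hb₂
  have hT := tailConst_pos ha hb₂0
  set T := tailConst a b₂
  -- On the good event tr(Aᵀ A) ≤ 16 T, so this c gives γ tr(Aᵀ A) ≤ 1/3. The exponent κ = 1 serves
  -- every ρ, which enters only through the lower constant.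
  refine ⟨1 / (48 * T), by positivity, fun ρ hρ => ⟨1, one_pos, fun s r hs hr =>
    ⟨lowerConst a b₁ T ρ r, upperConst a T s, lowerConst_pos hρ hb₁ hT hr,
      upperConst_pos hT hs.le, ?_⟩⟩⟩
  intro d p M N G hG π P σ γ _ _ hM hρd hN hγT hy hspec hW hP
  have hy0 : 0 < effSampleSize N * γ := hr.trans_le hy
  have hγ : 0 < γ := by
    have hn : 0 ≤ effSampleSize N := div_nonneg (Nat.cast_nonneg _) (Real.log_natCast_nonneg _)
    exact pos_of_mul_pos_right hy0 hn
  have hMd : M ≤ d := by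
    have hM0 : (0 : ℝ) ≤ M := Nat.cast_nonneg _
    have : (M : ℝ) ≤ d := by nlinarith
    exact_mod_cast this
  obtain ⟨e, he, hB, hlam⟩ := exists_ordered_eigenbasis hG
  set lam : Fin d → ℝ := fun i =>
    hG.isHermitian.eigenvalues₀ (Fin.cast (Fintype.card_fin d).symm i)
  have hlam₁ : ∀ i : Fin d, b₁ * ((i : ℝ) + 1) ^ (-a) ≤ lam i := fun i =>
    (hspec (Fin.cast (Fintype.card_fin d).symm i)).1
  have hlam₂ : ∀ i : Fin d, lam i ≤ b₂ * ((i : ℝ) + 1) ^ (-a) := fun i =>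
    (hspec (Fin.cast (Fintype.card_fin d).symm i)).2
  have htail := sum_tail_le_tailConst ha hb₂0 hlam₂
  refine one_sub_exp_le_measureReal hM (fun R hR => ?_)
    (sketchLaw_isGood_compl_le hM hMd hy0 he hlam htail)
  obtain ⟨hA0, hA1, hA2, hlow⟩ := not_not.1 hR
  obtain ⟨v, τ, hv⟩ := exists_isGramEigenbasis (R * scaledBasis e lam)
  have hf := hv.isSketchBasis hB
  have hsum : ∀ j, ∑ i, (scaledBasis e lam *ᵥ v j) i ^ 2 = ∑ i, lam i * v j i ^ 2 := fun j =>
    sum_sq_scaledBasis_mulVec he hlam (v j)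
  have hstep : ∀ t j, 0 ≤ 1 - 2 * (stepSize γ N t * τ j) := fun t j => by
    have h1 : τ j ≤ 16 * T :=
      (Finset.single_le_sum (fun i _ => hv.nonneg i) (Finset.mem_univ j)).trans
        (hv.sum_eigenvalues.trans_le hA0)
    have h2 : stepSize γ N t * τ j ≤ 1 / (48 * T) * (16 * T) :=
      mul_le_mul ((stepSize_le_self hγ.le t).trans hγT) h1 (hv.nonneg j) (by positivity)
    have h3 : 1 / (48 * T) * (16 * T) = 1 / 3 := by field_simp; norm_num
    linarith
  constructor
  · refine (ENNReal.ofReal_le_ofReal ?_).trans (hf.le_expectedRisk hG hs.le hW hP)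
    simp_rw [hsum]
    gcongr
    exact hv.le_sum_prod ha hT hρ hb₁ hr hγ hN hM hρd hy hlam₁ hA1
  · refine (hf.expectedRisk_le hG hs.le hstep hW hP).trans (ENNReal.ofReal_le_ofReal ?_)
    simp_rw [hsum]
    gcongr
    exact hv.sum_riskRec_le ha hT hs.le hγ hγT hN hM hy0 hlam htail hA0 hA1 hA2 hlow
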